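/- Let $p$ be a prime and let $A$ be a (not necessarily commutative) left and right noetherian ultrametric Banach $\mathbb{Q}_p$-algebra. Radii are positive rational numbers or $\infty$; a radius $t$ corresponds to $|T|=p^{-t/(p-1)}$ (to $T=0$ if $t=\infty$). For radii $s\le r$ with $s<\infty$ let $\Pi_{[s,r],A}$ be the completed tensor product over $\mathbb{Q}_p$ of $A$ with the ring of analytic functions on the annulus $[s,r]$. That is, $\Pi_{[s,r],A}$ is the ring of Laurent series $\sum_{n\in\mathbb{Z}}a_nT^n$ with $a_n\in A$ and $T$ central such that $\|a_n\|p^{-tn/(p-1)}\to 0$ as $n\to\pm\infty$ for all finite $t\in[s,r]$, and $a_n=0$ for $n<0$ if $r=\infty$. Fix a radius $r_0\in\mathbb{Q}_{>0}\cup\{\infty\}$ and let $\Pi_{\mathrm{an},r_0,A}=\bigcap_{0<s\le r_0}\Pi_{[s,r_0],A}$. Assume that $\Pi_{[s,r],A}$ is left and right noetherian for every such interval $[s,r]\subset(0,r_0]$. A coherent sheaf over $\Pi_{\mathrm{an},r_0,A}$ is a family of finitely generated left $\Pi_{[s,r],A}$-modules $M_{[s,r]}$, one for each such $[s,r]\subset(0,r_0]$,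 with isomorphisms $\Pi_{[s'',r''],A}\otimes_{\Pi_{[s',r'],A}}M_{[s',r']}\cong M_{[s'',r'']}$ for $[s'',r'']\subset[s',r']$ satisfying the cocycle condition. Its global section is the left $\Pi_{\mathrm{an},r_0,A}$-module $M=\varprojlim_{s\to0^+}M_{[s,r_0]}$. An admissible covering of $(0,r_0]$ is a covering by such closed intervals with nonempty interiors that has a locally finite refinement by such closed intervals. The sheaf is uniformly finitely generated if there are a positive integer $n$ and an admissible covering such that $M_{[s,r]}$ is generated by $n$ elements for every $[s,r]$ in the covering. It is uniformly finitely presented if there are positive integers $m,n$ and an admissible covering such that for every $[s,r]$ in the covering there is an exact sequence $\Pi_{[s,r],A}^m\to\Pi_{[s,r],A}^n\to M_{[s,r]}\to0$ of left modules. Then for every coherent sheaf $(M_{[s,r]})$ over $\Pi_{\mathrm{an},r_0,A}$ with global section $M$: I. $(M_{[s,r]})$ is uniformly finitely generated if and only if $M$ is a finitely generated $\Pi_{\mathrm{an},r_0,A}$-module; II. $(M_{[s,r]})$ is uniformly finitely presented if and only if $M$ is a finitely presented $\Pi_{\mathrm{an},r_0,A}$-module. -/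

import Mathlib

open scoped ENNReal Topology
open Filter

universe u v

namespace RelRobba

set_option linter.unusedSectionVars false

/-! ### Annuli and rings of analytic functions with coefficients in `A` -/

/-- The norm `|T|` of the coordinate at the radius `t ∈ (0, ∞]`, namely `p ^ (-t / (p - 1))`, for
finite `t`.  The radius `t = ∞` is the point `T = 0`, and is treated separately below. -/
noncomputable def absT (p : ℕ) (t : ℝ≥0∞) : ℝ := (p : ℝ) ^ (-(t.toReal / ((p : ℝ) - 1)))

/-- A two-sided sequence of coefficients `f : ℤ → A`, that is, the formal Laurent series
`∑ f n T ^ n`, converges at the radius `t`: for finite `t` this says `‖f n‖ p ^ (-t n / (p - 1)) → 0`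
as `n → ±∞`; for `t = ∞` (where `T = 0`) it says that no negative power of `T` occurs. -/
def ConvergesAt (p : ℕ) {A : Type*} [NormedRing A] (f : ℤ → A) (t : ℝ≥0∞) : Prop :=
  (t ≠ ⊤ → Tendsto (fun n : ℤ => ‖f n‖ * absT p t ^ n) cofinite (𝓝 0)) ∧
    (t = ⊤ → ∀ n < 0, f n = 0)

/-- A set of radii containing at least one finite radius. -/
structure Region where
  carrier : Set ℝ≥0∞
  exists_ne_top : ∃ t ∈ carrier, t ≠ ⊤

/-- The ring of Laurent series with coefficients in `A` (and central variable `T`) which converge at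
all radii in `U`.

For `U = [s, r]` with `s < ∞` this is the completion of `A[T, T⁻¹]` (of `A[T]` if `r = ∞`) for the
maximum of the Gauss norms at `s` and `r`, i.e. the completed tensor product of `A` with the ring of
analytic functions on the annulus. For `U = (0, r₀]` it is the intersection of the rings for
`[s, r₀]`, `0 < s ≤ r₀`. -/
@[ext]
structure AnRing (p : ℕ) (A : Type*) [NormedRing A] (U : Region) where
  coeff : ℤ → A
  convergesAt : ∀ t ∈ U.carrier, ConvergesAt p coeff t

section Ring

variable {p : ℕ} [hp : Fact p.Prime] {A : Type*} [NormedRing A]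

theorem absT_pos (t : ℝ≥0∞) : 0 < absT p t :=
  Real.rpow_pos_of_pos (by exact_mod_cast hp.out.pos) _

/-- The coefficients of a product of Laurent series. -/
noncomputable def convolve (f g : ℤ → A) (n : ℤ) : A := ∑' k : ℤ, f k * g (n - k)

theorem term_tendsto {f g : ℤ → A} {t : ℝ≥0∞} (ht : t ≠ ⊤) (hf : ConvergesAt p f t)
    (hg : ConvergesAt p g t) (n : ℤ) :
    Tendsto (fun k : ℤ => f k * g (n - k)) cofinite (𝓝 0) := by
  have h := tendsto_mul_cofinite_nhds_zero (hf.1 ht) (hg.1 ht)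
  have hi : Function.Injective (fun k : ℤ => (k, n - k)) := fun a b hab => (Prod.ext_iff.1 hab).1
  have h2 := (h.comp hi.tendsto_cofinite).mul_const (absT p t ^ (-n))
  rw [zero_mul] at h2
  refine squeeze_zero_norm (fun k => ?_) h2
  have h0 : absT p t ≠ 0 := (absT_pos t).ne'
  have : absT p t ^ k * absT p t ^ (n - k) * absT p t ^ (-n) = 1 := by
    rw [← zpow_add₀ h0, ← zpow_add₀ h0]; simp
  calc ‖f k * g (n - k)‖ ≤ ‖f k‖ * ‖g (n - k)‖ := norm_mul_le _ _
    _ = ‖f k‖ * ‖g (n - k)‖ * (absT p t ^ k * absT p t ^ (n - k) * absT p t ^ (-n)) := by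
        rw [this, mul_one]
    _ = _ := by simp only [Function.comp]; ring

variable [IsUltrametricDist A]

theorem convolve_convergesAt {f g : ℤ → A} {t : ℝ≥0∞} (hf : ConvergesAt p f t)
    (hg : ConvergesAt p g t) : ConvergesAt p (convolve f g) t := by
  refine ⟨fun ht => ?_, fun ht n hn => ?_⟩
  · have h := tendsto_mul_cofinite_nhds_zero (hf.1 ht) (hg.1 ht)
    have h0 : 0 < absT p t := absT_pos t
    rw [Metric.tendsto_nhds] at h ⊢
    intro ε hε
    have hfin := (h (ε / 2) (half_pos hε))
    rw [eventually_cofinite] at hfin ⊢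
    refine (hfin.image (fun x : ℤ × ℤ => x.1 + x.2)).subset fun n hn => ?_
    by_contra hcon
    apply hn
    have hb : ∀ k : ℤ, ‖f k * g (n - k)‖ ≤ ε / 2 * absT p t ^ (-n) := by
      intro k
      have hk : (k, n - k) ∉ {x : ℤ × ℤ | ¬ dist ((‖f x.1‖ * absT p t ^ x.1) *
          (‖g x.2‖ * absT p t ^ x.2)) 0 < ε / 2} := fun hx => hcon ⟨_, hx, by simp⟩
      simp only [Set.mem_ofPred_eq, not_not, dist_zero_right, Real.norm_eq_abs] at hk
      have hk' := (le_abs_self _).trans hk.le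
      have : absT p t ^ k * absT p t ^ (n - k) * absT p t ^ (-n) = 1 := by
        rw [← zpow_add₀ h0.ne', ← zpow_add₀ h0.ne']; simp
      calc ‖f k * g (n - k)‖ ≤ ‖f k‖ * ‖g (n - k)‖ := norm_mul_le _ _
        _ = ‖f k‖ * ‖g (n - k)‖ * (absT p t ^ k * absT p t ^ (n - k) * absT p t ^ (-n)) := by
            rw [this, mul_one]
        _ = ((‖f k‖ * absT p t ^ k) * (‖g (n - k)‖ * absT p t ^ (n - k))) * absT p t ^ (-n) := by
            ring
        _ ≤ _ := mul_le_mul_of_nonneg_right hk' (zpow_pos h0 _).le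
    have hs : ‖convolve f g n‖ ≤ ε / 2 * absT p t ^ (-n) :=
      (IsUltrametricDist.norm_tsum_le _).trans (ciSup_le hb)
    have hpos := zpow_pos h0 n
    rw [dist_zero_right, Real.norm_eq_abs, abs_of_nonneg (by positivity)]
    calc ‖convolve f g n‖ * absT p t ^ n ≤ ε / 2 * absT p t ^ (-n) * absT p t ^ n :=
          mul_le_mul_of_nonneg_right hs hpos.le
      _ = ε / 2 := by rw [mul_assoc, ← zpow_add₀ h0.ne']; simp
      _ < ε := half_lt_self hε
  · have : ∀ k : ℤ, f k * g (n - k) = 0 := by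
      intro k
      rcases lt_or_ge k 0 with hk | hk
      · rw [hf.2 ht k hk, zero_mul]
      · rw [hg.2 ht (n - k) (by omega), mul_zero]
    simp [convolve, this]

variable [CompleteSpace A]

theorem term_summable {f g : ℤ → A} {t : ℝ≥0∞} (ht : t ≠ ⊤) (hf : ConvergesAt p f t)
    (hg : ConvergesAt p g t) (n : ℤ) : Summable (fun k : ℤ => f k * g (n - k)) :=
  NonarchimedeanAddGroup.summable_of_tendsto_cofinite_zero (term_tendsto ht hf hg n)

theorem convolve_assoc {f g h : ℤ → A} {t : ℝ≥0∞} (ht : t ≠ ⊤) (hf : ConvergesAt p f t)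
    (hg : ConvergesAt p g t) (hh : ConvergesAt p h t) :
    convolve (convolve f g) h = convolve f (convolve g h) := by
  funext n
  have h0 : absT p t ≠ 0 := (absT_pos t).ne'
  have key : Summable (Function.uncurry fun m i : ℤ => f i * g (m - i) * h (n - m)) := by
    apply NonarchimedeanAddGroup.summable_of_tendsto_cofinite_zero
    have H := tendsto_mul_cofinite_nhds_zero
      (tendsto_mul_cofinite_nhds_zero (hf.1 ht) (hg.1 ht)) (hh.1 ht)
    have hi : Function.Injective (fun x : ℤ × ℤ => ((x.2, x.1 - x.2), n - x.1)) := by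
      rintro ⟨a, b⟩ ⟨c, d⟩ hab
      simp only [Prod.mk.injEq] at hab ⊢
      omega
    have h2 := (H.comp hi.tendsto_cofinite).mul_const (absT p t ^ (-n))
    rw [zero_mul] at h2
    refine squeeze_zero_norm (fun x => ?_) h2
    obtain ⟨m, i⟩ := x
    have : absT p t ^ i * absT p t ^ (m - i) * absT p t ^ (n - m) * absT p t ^ (-n) = 1 := by
      rw [← zpow_add₀ h0, ← zpow_add₀ h0, ← zpow_add₀ h0]; simp
    calc ‖f i * g (m - i) * h (n - m)‖ ≤ ‖f i‖ * ‖g (m - i)‖ * ‖h (n - m)‖ := norm_mul₃_le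
      _ = ‖f i‖ * ‖g (m - i)‖ * ‖h (n - m)‖ *
          (absT p t ^ i * absT p t ^ (m - i) * absT p t ^ (n - m) * absT p t ^ (-n)) := by
          rw [this, mul_one]
      _ = _ := by simp only [Function.comp]; ring
  calc convolve (convolve f g) h n = ∑' m, ∑' i, f i * g (m - i) * h (n - m) :=
        tsum_congr fun m => ((term_summable ht hf hg m).tsum_mul_right _).symm
    _ = ∑' i, ∑' m, f i * g (m - i) * h (n - m) := key.tsum_comm.symm
    _ = ∑' i, f i * convolve g h (n - i) := by
        refine tsum_congr fun i => ?_
        rw [convolve, ← (term_summable ht hg hh (n - i)).tsum_mul_left,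
          ← (Equiv.subRight i).tsum_eq (fun j => f i * (g j * h (n - i - j)))]
        refine tsum_congr fun m => ?_
        simp only [Equiv.subRight_apply, mul_assoc]
        rw [show n - i - (m - i) = n - m by ring]
    _ = convolve f (convolve g h) n := rfl

end Ring

namespace AnRing

variable {p : ℕ} {A : Type*} [NormedRing A] {U : Region}

theorem coeff_injective : Function.Injective (coeff : AnRing p A U → ℤ → A) :=
  fun _ _ h => AnRing.ext h

instance : Zero (AnRing p A U) :=
  ⟨⟨fun _ => 0, fun _ _ => ⟨fun _ => by simp, fun _ _ _ => rfl⟩⟩⟩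

instance : One (AnRing p A U) :=
  ⟨⟨Pi.single 0 1, fun t _ => ⟨fun _ => by
    refine tendsto_nhds_of_eventually_eq ?_
    rw [eventually_cofinite]
    refine (Set.finite_singleton (0 : ℤ)).subset fun n hn => ?_
    by_contra h0
    exact hn (by simp [Pi.single_eq_of_ne h0]), fun _ n hn => Pi.single_eq_of_ne hn.ne _⟩⟩⟩

instance : Neg (AnRing p A U) :=
  ⟨fun f => ⟨fun n => -f.coeff n, fun t ht => ⟨fun h => by simpa using (f.convergesAt t ht).1 h,
    fun h n hn => by simp [(f.convergesAt t ht).2 h n hn]⟩⟩⟩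

variable [hp : Fact p.Prime]

instance : Add (AnRing p A U) :=
  ⟨fun f g => ⟨fun n => f.coeff n + g.coeff n, fun t ht => ⟨fun h => by
      have h1 := ((f.convergesAt t ht).1 h).add ((g.convergesAt t ht).1 h)
      rw [add_zero] at h1
      refine squeeze_zero (fun n => mul_nonneg (norm_nonneg _) (zpow_pos (absT_pos t) n).le)
        (fun n => ?_) h1
      rw [← add_mul]
      exact mul_le_mul_of_nonneg_right (norm_add_le _ _) (zpow_pos (absT_pos t) n).le,
    fun h n hn => by simp [(f.convergesAt t ht).2 h n hn, (g.convergesAt t ht).2 h n hn]⟩⟩⟩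

@[simp] theorem coeff_zero : (0 : AnRing p A U).coeff = 0 := rfl
@[simp] theorem coeff_one : (1 : AnRing p A U).coeff = Pi.single 0 1 := rfl
@[simp] theorem coeff_neg (f : AnRing p A U) : (-f).coeff = -f.coeff := rfl
@[simp] theorem coeff_add (f g : AnRing p A U) : (f + g).coeff = f.coeff + g.coeff := rfl

variable [IsUltrametricDist A] [CompleteSpace A]

noncomputable instance : Mul (AnRing p A U) :=
  ⟨fun f g => ⟨convolve f.coeff g.coeff, fun t ht =>
    convolve_convergesAt (f.convergesAt t ht) (g.convergesAt t ht)⟩⟩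

@[simp] theorem coeff_mul (f g : AnRing p A U) :
    (f * g).coeff = convolve f.coeff g.coeff := rfl

noncomputable instance : Ring (AnRing p A U) where
  add_assoc f g h := coeff_injective (add_assoc _ _ _)
  zero_add f := coeff_injective (zero_add _)
  add_zero f := coeff_injective (add_zero _)
  add_comm f g := coeff_injective (add_comm _ _)
  neg_add_cancel f := coeff_injective (neg_add_cancel _)
  nsmul := nsmulRec
  zsmul := zsmulRec
  mul_assoc f g h := by
    obtain ⟨t, ht, ht'⟩ := U.exists_ne_top
    exact coeff_injective (convolve_assoc ht' (f.convergesAt t ht) (g.convergesAt t ht) (h.convergesAt t ht))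
  left_distrib f g h := by
    obtain ⟨t, ht, ht'⟩ := U.exists_ne_top
    refine coeff_injective (funext fun n => ?_)
    simp only [coeff_mul, coeff_add, Pi.add_apply, convolve, mul_add]
    exact (term_summable ht' (f.convergesAt t ht) (g.convergesAt t ht) n).tsum_add
      (term_summable ht' (f.convergesAt t ht) (h.convergesAt t ht) n)
  right_distrib f g h := by
    obtain ⟨t, ht, ht'⟩ := U.exists_ne_top
    refine coeff_injective (funext fun n => ?_)
    simp only [coeff_mul, coeff_add, Pi.add_apply, convolve, add_mul]
    exact (term_summable ht' (f.convergesAt t ht) (h.convergesAt t ht) n).tsum_add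
      (term_summable ht' (g.convergesAt t ht) (h.convergesAt t ht) n)
  zero_mul f := coeff_injective (funext fun n => by simp [convolve])
  mul_zero f := coeff_injective (funext fun n => by simp [convolve])
  one_mul f := coeff_injective (funext fun n => by
    simp only [coeff_mul, coeff_one, convolve]
    rw [tsum_eq_single 0 fun k hk => by rw [Pi.single_eq_of_ne hk, zero_mul]]
    simp)
  mul_one f := coeff_injective (funext fun n => by
    simp only [coeff_mul, coeff_one, convolve]
    rw [tsum_eq_single n fun k hk => by
      rw [Pi.single_eq_of_ne (sub_ne_zero.2 hk.symm), mul_zero]]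
    simp)

/-- Restriction of analytic functions to a smaller region. -/
noncomputable def restrict {U V : Region} (h : U.carrier ⊆ V.carrier) :
    AnRing p A V →+* AnRing p A U where
  toFun f := ⟨f.coeff, fun t ht => f.convergesAt t (h ht)⟩
  map_one' := rfl
  map_mul' _ _ := rfl
  map_zero' := rfl
  map_add' _ _ := rfl

end AnRing

/-! ### Extension of scalars for left modules over noncommutative rings -/

section ExtendScalars

variable {R S : Type*} [Ring R] [Ring S] (φ : R →+* S) (M : Type*) [AddCommGroup M] [Module R M]

/-- The relations `1 ⊗ (m + m') = 1 ⊗ m + 1 ⊗ m'` and `1 ⊗ r m = φ r ⊗ m` of `S ⊗_R M`, as a left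
`S`-submodule of the free left `S`-module on the symbols `1 ⊗ m`. -/
noncomputable def extendScalarsRel : Submodule S (M →₀ S) :=
  Submodule.span S
    ({x | ∃ m m' : M, x = Finsupp.single (m + m') 1 - Finsupp.single m 1 - Finsupp.single m' 1} ∪
      {x | ∃ (r : R) (m : M), x = Finsupp.single (r • m) 1 - Finsupp.single m (φ r)})

/-- The left `S`-module `S ⊗_R M`, for a left `R`-module `M`, where `S` is an `(S, R)`-bimodule
through `φ : R →+* S`. -/
abbrev ExtendScalars : Type _ := (M →₀ S) ⧸ extendScalarsRel φ M

variable {M}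

/-- The `S`-linear map `S ⊗_R M → N`, `s ⊗ m ↦ s • g m`, induced by a `φ`-semilinear `g : M → N`. -/
noncomputable def ExtendScalars.lift {N : Type*} [AddCommGroup N] [Module S N]
    (g : M →ₛₗ[φ] N) : ExtendScalars φ M →ₗ[S] N :=
  (extendScalarsRel φ M).liftQ (Finsupp.linearCombination S g) (by
    refine Submodule.span_le.2 ?_
    rintro x (⟨m, m', rfl⟩ | ⟨r, m, rfl⟩) <;>
      simp [Finsupp.linearCombination_single])

end ExtendScalars

/-! ### Coherent sheaves on the half-open annulus and their global sections -/

/-- A radius is rational if it is a rational number or `∞`. -/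
def IsRationalRadius (t : ℝ≥0∞) : Prop := t = ⊤ ∨ ∃ q : ℚ, t = ENNReal.ofReal q

/-- A closed interval `[s, r] ⊆ (0, r₀]` with `s` a positive rational number and `r` a rational
number or `∞`. -/
structure ClosedInterval (r₀ : ℝ≥0∞) where
  s : ℝ≥0∞
  r : ℝ≥0∞
  s_pos : 0 < s
  s_ne_top : s ≠ ⊤
  s_le_r : s ≤ r
  r_le : r ≤ r₀
  s_rational : IsRationalRadius s
  r_rational : IsRationalRadius r

namespace ClosedInterval

variable {r₀ : ℝ≥0∞}

/-- The closed interval as a set of radii. -/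
def region (J : ClosedInterval r₀) : Region :=
  ⟨Set.Icc J.s J.r, J.s, ⟨le_refl _, J.s_le_r⟩, J.s_ne_top⟩

/-- Containment of intervals, `[s'', r''] ⊆ [s', r']`, i.e. `s' ≤ s'' ≤ r'' ≤ r'`. -/
instance : LE (ClosedInterval r₀) := ⟨fun J'' J' => J'.s ≤ J''.s ∧ J''.r ≤ J'.r⟩

theorem region_subset {J'' J' : ClosedInterval r₀} (h : J'' ≤ J') :
    J''.region.carrier ⊆ J'.region.carrier := Set.Icc_subset_Icc h.1 h.2

theorem le_rfl' (J : ClosedInterval r₀) : J ≤ J := ⟨le_refl _, le_refl _⟩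

theorem le_trans' {J''' J'' J' : ClosedInterval r₀} (h : J''' ≤ J'') (h' : J'' ≤ J') : J''' ≤ J' :=
  ⟨h'.1.trans h.1, h.2.trans h'.2⟩

end ClosedInterval

/-- The half-open interval `(0, r₀]`, for `r₀ > 0`, as a set of radii. -/
def fullRegion (r₀ : ℝ≥0∞) (h : 0 < r₀) : Region :=
  ⟨Set.Ioc 0 r₀, min r₀ 1, ⟨lt_min h one_pos, min_le_left _ _⟩,
    ((min_le_right _ _).trans_lt ENNReal.one_lt_top).ne⟩

theorem region_subset_full {r₀ : ℝ≥0∞} (h : 0 < r₀) (J : ClosedInterval r₀) :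
    J.region.carrier ⊆ (fullRegion r₀ h).carrier :=
  fun _ ht => ⟨J.s_pos.trans_le ht.1, ht.2.trans J.r_le⟩

section Sheaf

variable (p : ℕ) [Fact p.Prime] (A : Type u) [NormedRing A] [IsUltrametricDist A] [CompleteSpace A]

/-- The ring of analytic functions with coefficients in `A` on the closed annulus given by `J`. -/
abbrev IntervalRing {r₀ : ℝ≥0∞} (J : ClosedInterval r₀) : Type _ := AnRing p A J.region

/-- The ring of analytic functions with coefficients in `A` on the half-open annulus `(0, r₀]`. -/
abbrev FullRing (r₀ : ℝ≥0∞) (h : 0 < r₀) : Type _ := AnRing p A (fullRegion r₀ h)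

/-- A coherent sheaf of left modules over the ring of analytic functions on `(0, r₀]`: a family of
finitely generated left modules over the rings of the closed intervals `[s, r] ⊆ (0, r₀]`, with
isomorphisms (induced by restriction maps) from the base changes of each member to the members for
smaller intervals, compatible with one another (cocycle condition). -/
structure CoherentSheaf (r₀ : ℝ≥0∞) where
  obj : ClosedInterval r₀ → Type v
  [addCommGroup : ∀ J, AddCommGroup (obj J)]
  [module : ∀ J, Module (IntervalRing p A J) (obj J)]
  finite : ∀ J, Module.Finite (IntervalRing p A J) (obj J)
  res : ∀ {J'' J' : ClosedInterval r₀} (h : J'' ≤ J'),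
    obj J' →ₛₗ[AnRing.restrict (p := p) (A := A) (ClosedInterval.region_subset h)] obj J''
  res_self : ∀ (J : ClosedInterval r₀) (x : obj J), res J.le_rfl' x = x
  res_res : ∀ {J''' J'' J' : ClosedInterval r₀} (h : J''' ≤ J'') (h' : J'' ≤ J') (x : obj J'),
    res h (res h' x) = res (ClosedInterval.le_trans' h h') x
  baseChange : ∀ {J'' J' : ClosedInterval r₀} (h : J'' ≤ J'), Function.Bijective
    (ExtendScalars.lift (AnRing.restrict (p := p) (A := A) (ClosedInterval.region_subset h))
      (res h))

attribute [instance] CoherentSheaf.addCommGroup CoherentSheaf.module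

variable {p A} {r₀ : ℝ≥0∞}

namespace CoherentSheaf

variable (M : CoherentSheaf.{u, v} p A r₀)

/-- The compatible families `(x_[s, r₀])_s`, `0 < s ≤ r₀`. -/
def globalAddSubgroup : AddSubgroup (∀ J : {J : ClosedInterval r₀ // J.r = r₀}, M.obj J.1) where
  carrier := {x | ∀ (J'' J' : {J : ClosedInterval r₀ // J.r = r₀}) (h : J''.1 ≤ J'.1),
      M.res h (x J') = x J''}
  zero_mem' := fun _ _ _ => by simp
  add_mem' := fun hx hy J'' J' h => by
    rw [Pi.add_apply, Pi.add_apply, map_add, hx J'' J' h, hy J'' J' h]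
  neg_mem' := fun hx J'' J' h => by
    rw [Pi.neg_apply, Pi.neg_apply, map_neg, hx J'' J' h]

/-- The global section of a coherent sheaf: the inverse limit of the `M_[s, r₀]` as `s → 0⁺`. -/
abbrev GlobalSection : Type _ := M.globalAddSubgroup

/-- The global section is a left module over the ring of analytic functions on `(0, r₀]`, which acts
on each `M_[s, r₀]` through restriction to `[s, r₀]`. -/
noncomputable instance (h₀ : 0 < r₀) : Module (FullRing p A r₀ h₀) M.GlobalSection where
  smul c x := ⟨fun J => AnRing.restrict (region_subset_full h₀ J.1) c • x.1 J, fun J'' J' h => by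
    rw [map_smulₛₗ, x.2 J'' J' h]; rfl⟩
  one_smul x := Subtype.ext (funext fun J => by
    change AnRing.restrict (region_subset_full h₀ J.1) 1 • x.1 J = x.1 J
    rw [map_one, one_smul])
  mul_smul c d x := Subtype.ext (funext fun J => by
    change AnRing.restrict (region_subset_full h₀ J.1) (c * d) • x.1 J =
      AnRing.restrict (region_subset_full h₀ J.1) c •
        AnRing.restrict (region_subset_full h₀ J.1) d • x.1 J
    rw [map_mul, mul_smul])
  smul_zero c := Subtype.ext (funext fun J => smul_zero _)
  smul_add c x y := Subtype.ext (funext fun J => smul_add _ _ _)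
  add_smul c d x := Subtype.ext (funext fun J => by
    change AnRing.restrict (region_subset_full h₀ J.1) (c + d) • x.1 J =
      AnRing.restrict (region_subset_full h₀ J.1) c • x.1 J +
        AnRing.restrict (region_subset_full h₀ J.1) d • x.1 J
    rw [map_add, add_smul])
  zero_smul x := Subtype.ext (funext fun J => by
    change AnRing.restrict (region_subset_full h₀ J.1) 0 • x.1 J = 0
    rw [map_zero, zero_smul])

end CoherentSheaf

end Sheaf

/-! ### Admissible coverings and uniform finiteness -/

/-- A set of closed intervals covers `(0, r₀]`. -/
def Covers {r₀ : ℝ≥0∞} (𝒰 : Set (ClosedInterval r₀)) : Prop :=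
  ∀ t : ℝ≥0∞, 0 < t → t ≤ r₀ → ∃ J ∈ 𝒰, t ∈ Set.Icc J.s J.r

/-- A set of closed intervals is locally finite in `(0, r₀]`. -/
def IsLocallyFinite {r₀ : ℝ≥0∞} (𝒱 : Set (ClosedInterval r₀)) : Prop :=
  ∀ t : ℝ≥0∞, 0 < t → t ≤ r₀ → ∃ W ∈ 𝓝 t, {J ∈ 𝒱 | (Set.Icc J.s J.r ∩ W).Nonempty}.Finite

/-- An admissible covering of `(0, r₀]`: a covering by closed intervals with nonempty interiors
which admits a locally finite refinement (by closed intervals). -/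
structure IsAdmissibleCovering {r₀ : ℝ≥0∞} (𝒰 : Set (ClosedInterval r₀)) : Prop where
  covers : Covers 𝒰
  nonempty_interior : ∀ J ∈ 𝒰, J.s < J.r
  refinement : ∃ 𝒱 : Set (ClosedInterval r₀),
    Covers 𝒱 ∧ (∀ J ∈ 𝒱, ∃ K ∈ 𝒰, J ≤ K) ∧ IsLocallyFinite 𝒱

/-- A left module is `n`-finitely generated if it can be generated by `n` elements. -/
def IsFinGenBy (R : Type*) [Ring R] (M : Type*) [AddCommGroup M] [Module R M] (n : ℕ) : Prop :=
  ∃ e : Fin n → M, Submodule.span R (Set.range e) = ⊤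

/-- A left module is `(m, n)`-finitely presented if there is an exact sequence
`R ^ m → R ^ n → M → 0` of left modules. -/
def IsFinPresBy (R : Type*) [Ring R] (M : Type*) [AddCommGroup M] [Module R M] (m n : ℕ) : Prop :=
  ∃ (f : (Fin m → R) →ₗ[R] (Fin n → R)) (g : (Fin n → R) →ₗ[R] M),
    Function.Exact f g ∧ Function.Surjective g

namespace CoherentSheaf

variable {p : ℕ} [Fact p.Prime] {A : Type u} [NormedRing A] [IsUltrametricDist A] [CompleteSpace A]
  {r₀ : ℝ≥0∞} (M : CoherentSheaf.{u, v} p A r₀)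

/-- Uniformly finitely generated: for some positive integer `n` and some admissible covering, all
members of the sheaf on the intervals of the covering are `n`-finitely generated. -/
def IsUniformlyFinGen : Prop :=
  ∃ n : ℕ, 0 < n ∧ ∃ 𝒰 : Set (ClosedInterval r₀), IsAdmissibleCovering 𝒰 ∧
    ∀ J ∈ 𝒰, IsFinGenBy (IntervalRing p A J) (M.obj J) n

/-- Uniformly finitely presented: for some positive integers `m`, `n` and some admissible covering,
all members of the sheaf on the intervals of the covering are `(m, n)`-finitely presented. -/
def IsUniformlyFinPres : Prop :=
  ∃ m n : ℕ, 0 < m ∧ 0 < n ∧ ∃ 𝒰 : Set (ClosedInterval r₀), IsAdmissibleCovering 𝒰 ∧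
    ∀ J ∈ 𝒰, IsFinPresBy (IntervalRing p A J) (M.obj J) m n

end CoherentSheaf

end RelRobba

namespace RelRobba

set_option linter.unusedSectionVars false

/-! ### Finitely generated modules over noetherian Banach rings -/

/-! The ring of each closed annulus is a noetherian Banach ring. Its finitely generated modules
therefore carry a complete norm, canonical up to equivalence: submodules of free modules are closed
(`isClosed_submodule`), restriction maps are continuous, and generating is an open condition on
`n`-tuples (`isOpen_span_eq_top`). Truncating Laurent series shows that sections over `[s, r₀]` are
approximated by sections over larger `[s', r₀]`, so the Mittag-Leffler principle
`exists_compatible_of_dense` makes global sections dense (`exists_globalSection_near`).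

If `M` is finitely generated, density and openness show that its generators generate every member of
the sheaf. Conversely, a locally finite refinement contains a chain in which only consecutive
intervals meet (`exists_chain`), so its even members are disjoint, and so are its odd ones. Over a
disjoint sequence, `n` global sections generating on all of its members are built by successive
approximation: a correction `c T ^ N y` can be negligible on the part already treated, where `|T|`
is smaller, and dominant on the next interval (`exists_near_generators`). The resulting `2n`
sections generate on each member of the chain, hence on each `[s, r₀]` by gluing
(`span_eq_top_of_union`), and then they generate `M` by a second Mittag-Leffler argument, on
coefficient vectors (`span_globalSection_eq_top`).

Gluing and flatness rest on one device. Moving one end of an annulus turns its ring `R` into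
convergent power series over `R` in a central variable `X`, modulo `X - T` or `1 - T X`
(`IsExpansion`). This gives flatness of restriction (`IsExpansion.flat`), and comparing the two
expansions at a common radius gives gluing (`mem_of_mem_span_of_mem_span`).

For finite presentation, flatness makes the relations between everywhere generating global sections
a coherent sheaf `kerSheaf`, whose global section is the module of relations over `(0, r₀]`.
Schanuel's argument bounds its number of generators uniformly on the covering, and the statement on
finite generation applies to it. -/

theorem norm_fintype_linearCombination_le {R P : Type*} [NormedRing R] [NormedAddCommGroup P] [Module R P]
    (hs : ∀ (r : R) (x : P), ‖r • x‖ ≤ ‖r‖ * ‖x‖) {ι : Type*} [Fintype ι] (a : ι → R) (g : ι → P) :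
    ‖∑ i, a i • g i‖ ≤ ‖a‖ * ∑ i, ‖g i‖ := by
  rw [Finset.mul_sum]
  refine (norm_sum_le _ _).trans (Finset.sum_le_sum fun i _ => (hs _ _).trans ?_)
  exact mul_le_mul_of_nonneg_right (norm_le_pi_norm a i) (norm_nonneg _)

section Banach

variable {R : Type*} [NormedRing R] [CompleteSpace R]

/-- Generators which are expressed through elements `y j` up to a small matrix lie in the span of
the `y j`. -/
theorem mem_span_of_eq_add_small {P : Type*} [AddCommGroup P] [Module R P] {ι : Type*} [Fintype ι]
    {q y : ι → P} {m : ι → ι → R} (hm : ∀ j k, ‖m j k‖ * (Fintype.card ι + 1) ≤ 1)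
    (h : ∀ j, q j = y j + ∑ k, m j k • q k) (j : ι) : q j ∈ Submodule.span R (Set.range y) := by
  classical
  -- For the `ℓ^∞` operator norm, the largest row sum, entries at most `1 / (card ι + 1)` give `‖B‖
  -- < 1`. So `1 - B` is invertible by the Neumann series, and `y = (1 - B) q` can be solved for
  -- `q`.
  let i1 : NormedRing (Matrix ι ι R) := Matrix.linftyOpNormedRing
  have i2 : @CompleteSpace (Matrix ι ι R) i1.toMetricSpace.toUniformSpace :=
    (inferInstance : @CompleteSpace (ι → ι → R) _)
  set B : Matrix ι ι R := Matrix.of m with hB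
  have hc : (0 : ℝ) < Fintype.card ι + 1 := by positivity
  have hlt : ‖B‖ < 1 := by
    have hle : ‖B‖ ≤ (Fintype.card ι : ℝ) / (Fintype.card ι + 1) := by
      rw [Matrix.linfty_opNorm_def]
      have h0 : (0 : ℝ) ≤ (Fintype.card ι : ℝ) / (Fintype.card ι + 1) := by positivity
      rw [← Real.coe_toNNReal _ h0, NNReal.coe_le_coe]
      refine Finset.sup_le fun i _ => ?_
      rw [← NNReal.coe_le_coe, Real.coe_toNNReal _ h0, NNReal.coe_sum]
      calc ∑ j, ((‖B i j‖₊ : NNReal) : ℝ) ≤ ∑ _j : ι, 1 / ((Fintype.card ι : ℝ) + 1) := by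
            refine Finset.sum_le_sum fun j _ => ?_
            rw [le_div_iff₀ hc]
            exact hm i j
        _ = _ := by simp [div_eq_mul_inv]
    refine hle.trans_lt ?_
    rw [div_lt_one hc]
    linarith
  obtain ⟨V, hV⟩ := isUnit_one_sub_of_norm_lt_one hlt
  have hy : ∀ j, y j = ∑ k, (1 - B) j k • q k := by
    intro j
    rw [eq_comm]
    have : ∑ k, (1 - B) j k • q k = q j - ∑ k, m j k • q k := by
      simp [Matrix.sub_apply, sub_smul, Finset.sum_sub_distrib, Matrix.one_apply, hB]
    rw [this, h j]
    simp
  have hinv : (↑V⁻¹ : Matrix ι ι R) * (1 - B) = 1 := by rw [← hV]; simp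
  have key : q j = ∑ i, (↑V⁻¹ : Matrix ι ι R) j i • y i := by
    simp_rw [hy, Finset.smul_sum, smul_smul]
    rw [Finset.sum_comm]
    simp_rw [← Finset.sum_smul]
    have : ∀ k, ∑ i, (↑V⁻¹ : Matrix ι ι R) j i * (1 - B) i k = (1 : Matrix ι ι R) j k := by
      intro k
      rw [← Matrix.mul_apply, hinv]
    simp_rw [this, Matrix.one_apply]
    simp
  rw [key]
  exact Submodule.sum_mem _ fun i _ =>
    Submodule.smul_mem _ _ (Submodule.subset_span (Set.mem_range_self i))

/-- This is the open mapping theorem for `R ^ ι → K`; closedness makes `K` complete. The field `𝕜`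
serves only to phrase the theorem for Banach spaces. -/
theorem exists_lift_norm_le_of_isClosed (𝕜 : Type*) [NontriviallyNormedField 𝕜] [NormedSpace 𝕜 R]
    [IsScalarTower 𝕜 R R] {n : ℕ} {K : Submodule R (Fin n → R)}
    (hK : IsClosed (K : Set (Fin n → R))) {ι : Type*} [Fintype ι] (g : ι → Fin n → R)
    (hg : Submodule.span R (Set.range g) = K) :
    ∃ C > 0, ∀ y ∈ K, ∃ a : ι → R, ∑ i, a i • g i = y ∧ ‖a‖ ≤ C * ‖y‖ := by
  let f : (ι → R) →ₗ[R] K := (Fintype.linearCombination R g).codRestrict K fun a => by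
    rw [← hg, Fintype.linearCombination_apply]
    exact Submodule.sum_mem _ fun i _ =>
      Submodule.smul_mem _ _ (Submodule.subset_span (Set.mem_range_self i))
  have hf : Function.Surjective f := by
    rintro ⟨y, hy⟩
    rw [← hg, ← Fintype.range_linearCombination] at hy
    obtain ⟨a, ha⟩ := hy
    exact ⟨a, Subtype.ext ha⟩
  let F : (ι → R) →L[𝕜] K := (f.restrictScalars 𝕜).mkContinuous (∑ i, ‖g i‖) fun a => by
    rw [mul_comm]
    have := norm_fintype_linearCombination_le (R := R) (P := Fin n → R)
      (fun r x => norm_smul_le r x) a g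
    simpa [f, Fintype.linearCombination_apply] using this
  have : CompleteSpace K := hK.completeSpace_coe
  obtain ⟨C, hC, h⟩ := F.exists_preimage_norm_le hf
  refine ⟨C, hC, fun y hy => ?_⟩
  obtain ⟨a, ha, ha'⟩ := h ⟨y, hy⟩
  refine ⟨a, ?_, ha'⟩
  have := congrArg Subtype.val ha
  simpa [F, f, Fintype.linearCombination_apply] using this

variable [IsNoetherianRing R]

/-- The closure `L` of `K` is finitely generated, so the open mapping theorem controls coefficients
in its generators. Approximating these generators by elements of `K` and inverting a matrix close to
`1` shows that they already lie in `K`. -/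
theorem isClosed_submodule (𝕜 : Type*) [NontriviallyNormedField 𝕜] [NormedSpace 𝕜 R]
    [IsScalarTower 𝕜 R R] {n : ℕ} (K : Submodule R (Fin n → R)) :
    IsClosed (K : Set (Fin n → R)) := by
  let L := K.topologicalClosure
  have hL : IsClosed (L : Set (Fin n → R)) := K.isClosed_topologicalClosure
  obtain ⟨l, g, hg⟩ := Submodule.fg_iff_exists_fin_generating_family.1
    (IsNoetherian.noetherian L)
  obtain ⟨C, hC, h⟩ := exists_lift_norm_le_of_isClosed 𝕜 hL g hg
  have hgL : ∀ i, g i ∈ L := fun i => hg ▸ Submodule.subset_span (Set.mem_range_self i)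
  -- With this precision the error has coefficients at most `C / ((l + 1) C) = 1 / (l + 1)`, as
  -- `mem_span_of_eq_add_small` requires.
  have hd : ∀ i, ∃ x ∈ K, ‖g i - x‖ < 1 / ((l + 1) * C) := by
    intro i
    have : g i ∈ closure (K : Set (Fin n → R)) := hgL i
    obtain ⟨x, hx, hx'⟩ := Metric.mem_closure_iff.1 this (1 / ((l + 1) * C)) (by positivity)
    exact ⟨x, hx, by rwa [dist_eq_norm] at hx'⟩
  choose x hxK hx using hd
  choose m hm hm' using fun i => h (g i - x i) (L.sub_mem (hgL i) (K.le_topologicalClosure (hxK i)))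
  have hin : ∀ i, g i ∈ Submodule.span R (Set.range x) := by
    refine mem_span_of_eq_add_small (m := m) (fun j k => ?_) fun j => by rw [hm]; abel
    have h1 : ‖m j k‖ ≤ C * (1 / ((l + 1) * C)) :=
      (norm_le_pi_norm _ k).trans ((hm' j).trans (mul_le_mul_of_nonneg_left (hx j).le hC.le))
    have h2 : C * (1 / ((l + 1) * C)) * (l + 1) = 1 := by
      have : (l : ℝ) + 1 ≠ 0 := by positivity
      field_simp
    rw [Fintype.card_fin]
    refine le_of_le_of_eq ?_ h2
    exact mul_le_mul_of_nonneg_right h1 (by positivity)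
  have hLK : L ≤ K := by
    rw [← hg, Submodule.span_le]
    rintro _ ⟨i, rfl⟩
    refine Submodule.span_le.2 ?_ (hin i)
    rintro _ ⟨j, rfl⟩
    exact hxK j
  have : K = L := le_antisymm K.le_topologicalClosure hLK
  rw [this]
  exact hL

theorem exists_lift_norm_le (𝕜 : Type*) [NontriviallyNormedField 𝕜] [NormedSpace 𝕜 R]
    [IsScalarTower 𝕜 R R] {n : ℕ} {K : Submodule R (Fin n → R)} {ι : Type*} [Fintype ι]
    (g : ι → Fin n → R) (hg : Submodule.span R (Set.range g) = K) :
    ∃ C > 0, ∀ y ∈ K, ∃ a : ι → R, ∑ i, a i • g i = y ∧ ‖a‖ ≤ C * ‖y‖ :=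
  exists_lift_norm_le_of_isClosed 𝕜 (isClosed_submodule 𝕜 K) g hg

end Banach

/-- A finitely generated normed module with the topology of a quotient of a free module. -/
class FinBanachModule (R N : Type*) [NormedRing R] [NormedAddCommGroup N] [Module R N] : Prop where
  norm_smul_le' : ∀ (r : R) (x : N), ‖r • x‖ ≤ ‖r‖ * ‖x‖
  complete : CompleteSpace N
  exists_lift : ∃ (n : ℕ) (g : Fin n → N) (C : ℝ), 0 < C ∧
    ∀ x, ∃ a : Fin n → R, ∑ i, a i • g i = x ∧ ‖a‖ ≤ C * ‖x‖

/-! ### Canonical norms on finitely generated modules. -/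

section FinNormed

variable (𝕜 R N : Type*) [NontriviallyNormedField 𝕜] [NormedRing R] [CompleteSpace R]
  [NormedSpace 𝕜 R] [IsScalarTower 𝕜 R R] [IsNoetherianRing R] [AddCommGroup N] [Module R N]
  [Module.Finite R N]

theorem exists_equiv_quotient : ∃ (n : ℕ) (K : Submodule R (Fin n → R)),
    Nonempty (N ≃ₗ[R] ((Fin n → R) ⧸ K)) := by
  obtain ⟨n, f, hf⟩ := Module.Finite.exists_fin' R N
  exact ⟨n, LinearMap.ker f, ⟨(f.quotKerEquivOfSurjective hf).symm⟩⟩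

/-- The number of generators in a chosen presentation. -/
noncomputable def presRank : ℕ := (exists_equiv_quotient R N).choose

/-- The relations in a chosen presentation. -/
noncomputable def presKer : Submodule R (Fin (presRank R N) → R) :=
  (exists_equiv_quotient R N).choose_spec.choose

/-- A chosen presentation. -/
noncomputable def presEquiv : N ≃ₗ[R] ((Fin (presRank R N) → R) ⧸ presKer R N) :=
  (exists_equiv_quotient R N).choose_spec.choose_spec.some

/-- The quotient norm on `(Fin n → R) ⧸ K`. -/
@[reducible] noncomputable def presNormed :
    NormedAddCommGroup ((Fin (presRank R N) → R) ⧸ presKer R N) :=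
  haveI := isClosed_submodule 𝕜 (presKer R N)
  Submodule.Quotient.normedAddCommGroup (presKer R N)

/-- The canonical norm (up to equivalence) of a finitely generated module over a noetherian Banach
ring. -/
@[reducible] noncomputable def finNormed : NormedAddCommGroup N :=
  letI := presNormed 𝕜 R N
  NormedAddCommGroup.induced N ((Fin (presRank R N) → R) ⧸ presKer R N) (presEquiv R N)
    (presEquiv R N).injective

theorem finBanachModule_finNormed :
    letI := finNormed 𝕜 R N
    FinBanachModule R N := by
  let i1 := presNormed 𝕜 R N
  let i2 := finNormed 𝕜 R N
  have hnorm : ∀ x : N, ‖x‖ = ‖presEquiv R N x‖ := fun _ => rfl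
  have hlift : ∀ x : N, ∀ ε > 0, ∃ a : Fin (presRank R N) → R,
      (presKer R N).mkQ a = presEquiv R N x ∧ ‖a‖ < ‖x‖ + ε := fun x ε hε => by
    rw [hnorm]
    exact Submodule.Quotient.norm_mk_lt (presEquiv R N x) hε
  have hmk : ∀ a : Fin (presRank R N) → R, ‖(presEquiv R N).symm ((presKer R N).mkQ a)‖ ≤ ‖a‖ := by
    intro a
    rw [hnorm, LinearEquiv.apply_symm_apply]
    exact Submodule.Quotient.norm_mk_le _ a
  constructor
  · intro r x
    refine le_of_forall_pos_le_add fun ε hε => ?_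
    obtain ⟨a, ha, ha'⟩ := hlift x (ε / (‖r‖ + 1)) (by positivity)
    have : r • x = (presEquiv R N).symm ((presKer R N).mkQ (r • a)) := by
      rw [map_smul, ha, map_smul, LinearEquiv.symm_apply_apply]
    rw [this]
    calc _ ≤ ‖r • a‖ := hmk _
      _ ≤ ‖r‖ * ‖a‖ := norm_smul_le _ _
      _ ≤ ‖r‖ * (‖x‖ + ε / (‖r‖ + 1)) := mul_le_mul_of_nonneg_left ha'.le (norm_nonneg _)
      _ = ‖r‖ * ‖x‖ + ‖r‖ / (‖r‖ + 1) * ε := by ring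
      _ ≤ _ := by
        have : ‖r‖ / (‖r‖ + 1) ≤ 1 := by
          rw [div_le_one (by positivity)]
          linarith
        nlinarith
  · have hi : Isometry (presEquiv R N) := fun _ _ => rfl
    have hc : CompleteSpace ((Fin (presRank R N) → R) ⧸ presKer R N) :=
      Submodule.Quotient.completeSpace (presKer R N)
    rw [completeSpace_iff_isComplete_range hi.isUniformInducing, (presEquiv R N).surjective.range_eq]
    exact isComplete_univ
  -- The quotient norm is an infimum which need not be attained. Allowing an excess of `‖x‖` itself,
  -- for `x ≠ 0`, produces the constant `2`.
  · refine ⟨presRank R N, fun i => (presEquiv R N).symm ((presKer R N).mkQ (Pi.single i 1)), 2,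
      two_pos, fun x => ?_⟩
    have hsum : ∀ a : Fin (presRank R N) → R,
        ∑ i, a i • (presEquiv R N).symm ((presKer R N).mkQ (Pi.single i 1)) =
          (presEquiv R N).symm ((presKer R N).mkQ a) := by
      intro a
      simp_rw [← map_smul, ← map_sum]
      congr 2
      ext j
      simp [Finset.sum_apply, Pi.single_apply]
    rcases eq_or_ne x 0 with rfl | hx
    · exact ⟨0, by simp, by simp⟩
    · obtain ⟨a, ha, ha'⟩ := hlift x ‖x‖ (norm_pos_iff.2 hx)
      refine ⟨a, ?_, by linarith⟩
      rw [hsum, ha, LinearEquiv.symm_apply_apply]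

end FinNormed

section FinBanachModule

variable {R N : Type*} [NormedRing R] [NormedAddCommGroup N] [Module R N] [FinBanachModule R N]

/-- The distinguished generators have fixed expressions in `g`; substituting them costs only a
constant factor. -/
theorem exists_lift_of_span_eq_top {ι : Type*} [Fintype ι] (g : ι → N)
    (hg : Submodule.span R (Set.range g) = ⊤) :
    ∃ C > 0, ∀ x : N, ∃ a : ι → R, ∑ i, a i • g i = x ∧ ‖a‖ ≤ C * ‖x‖ := by
  obtain ⟨n, f, C, hC, h⟩ := FinBanachModule.exists_lift (R := R) (N := N)
  have : ∀ j, ∃ b : ι → R, ∑ i, b i • g i = f j := by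
    intro j
    have : f j ∈ Submodule.span R (Set.range g) := hg ▸ Submodule.mem_top
    rw [← Fintype.range_linearCombination] at this
    obtain ⟨b, hb⟩ := this
    exact ⟨b, by rw [← hb, Fintype.linearCombination_apply]⟩
  choose b hb using this
  refine ⟨C * (∑ j, ‖b j‖ + 1), by positivity, fun x => ?_⟩
  obtain ⟨a, ha, ha'⟩ := h x
  refine ⟨fun i => ∑ j, a j * b j i, ?_, ?_⟩
  · simp_rw [Finset.sum_smul, mul_smul]
    rw [Finset.sum_comm]
    simp_rw [← Finset.smul_sum, hb, ha]
  · refine (pi_norm_le_iff_of_nonneg (by positivity)).2 fun i => ?_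
    calc ‖∑ j, a j * b j i‖ ≤ ∑ j, ‖a‖ * ‖b j‖ := by
          refine (norm_sum_le _ _).trans (Finset.sum_le_sum fun j _ => (norm_mul_le _ _).trans ?_)
          gcongr
          · exact norm_le_pi_norm a j
          · exact norm_le_pi_norm (b j) i
      _ = ‖a‖ * ∑ j, ‖b j‖ := by rw [Finset.mul_sum]
      _ ≤ C * ‖x‖ * (∑ j, ‖b j‖ + 1) := by
          gcongr
          linarith
      _ = _ := by ring

theorem continuous_sum_smul {ι : Type*} [Fintype ι] (g : ι → N) :
    Continuous fun a : ι → R => ∑ i, a i • g i := by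
  have : (fun a : ι → R => ∑ i, a i • g i) =
      (Fintype.linearCombination R g).toAddMonoidHom := by
    ext a
    simp [Fintype.linearCombination_apply]
  rw [this]
  refine AddMonoidHomClass.continuous_of_bound _ (∑ i, ‖g i‖) fun a => ?_
  rw [mul_comm, ← this]
  exact norm_fintype_linearCombination_le FinBanachModule.norm_smul_le' a g

/-- Bounded lifts to a free module reduce the estimate to finitely many values of `f`. In particular
the restriction maps of a sheaf are continuous for the canonical norms. -/
theorem continuous_of_semilinear {S P : Type*} [NormedRing S] [NormedAddCommGroup P] [Module S P]
    [FinBanachModule S P] {φ : R →+* S} (hφ : ∀ r, ‖φ r‖ ≤ ‖r‖) (f : N →ₛₗ[φ] P) :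
    Continuous f := by
  obtain ⟨n, g, C, hC, h⟩ := FinBanachModule.exists_lift (R := R) (N := N)
  refine AddMonoidHomClass.continuous_of_bound f (C * ∑ i, ‖f (g i)‖) fun x => ?_
  obtain ⟨a, ha, ha'⟩ := h x
  have : f x = ∑ i, φ (a i) • f (g i) := by
    rw [← ha, map_sum]
    simp
  rw [this]
  refine (norm_fintype_linearCombination_le FinBanachModule.norm_smul_le' (fun i => φ (a i))
    (fun i => f (g i))).trans ?_
  have h1 : ‖fun i => φ (a i)‖ ≤ ‖a‖ :=
    (pi_norm_le_iff_of_nonneg (norm_nonneg _)).2 fun i => (hφ _).trans (norm_le_pi_norm a i)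
  calc _ ≤ (C * ‖x‖) * ∑ i, ‖f (g i)‖ := by
        gcongr
        exact h1.trans ha'
    _ = _ := by ring

/-- A small change of the generators is expressed through the old ones by a small matrix, which
`mem_span_of_eq_add_small` absorbs. -/
theorem isOpen_span_eq_top [CompleteSpace R] (n : ℕ) :
    IsOpen {g : Fin n → N | Submodule.span R (Set.range g) = ⊤} := by
  rw [Metric.isOpen_iff]
  intro g hg
  obtain ⟨C, hC, h⟩ := exists_lift_of_span_eq_top g hg
  refine ⟨1 / ((n + 1) * C), by positivity, fun y hy => ?_⟩
  rw [Metric.mem_ball, dist_comm, dist_eq_norm] at hy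
  choose m hm hm' using fun j => h (g j - y j)
  have hin := mem_span_of_eq_add_small (q := g) (y := y) (m := m) (fun j k => by
    have h1 : ‖m j k‖ ≤ C * (1 / ((n + 1) * C)) :=
      (norm_le_pi_norm _ k).trans ((hm' j).trans (mul_le_mul_of_nonneg_left
        ((norm_le_pi_norm (g - y) j).trans hy.le) hC.le))
    have h2 : C * (1 / ((n + 1) * C)) * (n + 1) = 1 := by
      have : (n : ℝ) + 1 ≠ 0 := by positivity
      field_simp
    rw [Fintype.card_fin]
    refine le_of_le_of_eq ?_ h2
    exact mul_le_mul_of_nonneg_right h1 (by positivity)) fun j => by rw [hm]; abel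
  refine top_unique (hg.symm.le.trans (Submodule.span_le.2 ?_))
  rintro _ ⟨j, rfl⟩
  exact hin j

end FinBanachModule

/-! ### Inverse systems of complete metric spaces -/

/-- A Mittag-Leffler principle: an inverse sequence of complete metric spaces has a compatible family
in given open sets, provided each open set is approximated by the next one. -/
theorem exists_compatible_of_dense {X : ℕ → Type*} [∀ k, MetricSpace (X k)]
    [∀ k, CompleteSpace (X k)] (f : ∀ {j k : ℕ}, j ≤ k → X k → X j)
    (hf : ∀ {j k : ℕ} (h : j ≤ k), Continuous (f h)) (hself : ∀ k (x : X k), f le_rfl x = x)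
    (hcomp : ∀ {i j k : ℕ} (h : i ≤ j) (h' : j ≤ k) (x : X k), f h (f h' x) = f (h.trans h') x)
    (G : ∀ k, Set (X k)) (hG : ∀ k, IsOpen (G k)) (h0 : (G 0).Nonempty)
    (hd : ∀ k, ∀ x ∈ G k, ∀ ε > 0, ∃ y ∈ G (k + 1), dist (f k.le_succ y) x < ε) :
    ∃ x : ∀ k, X k, (∀ k, x k ∈ G k) ∧ ∀ {j k : ℕ} (h : j ≤ k), f h (x k) = x j := by
  -- A good ball at level `k` stays inside `G k`, and its images at all levels `j ≤ k` have radius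
  -- less than `(1 / 2) ^ k`. Building this into the choice of the radius makes the images of the
  -- centres Cauchy without any Lipschitz bound on the maps.
  let Good : ∀ k, X k × ℝ → Prop := fun k z => 0 < z.2 ∧
    ∀ y ∈ Metric.closedBall z.1 z.2, y ∈ G k ∧
      ∀ j (h : j ≤ k), dist (f h y) (f h z.1) < (1 / 2) ^ k
  have hgood : ∀ k, ∀ z ∈ G k, ∀ U ∈ 𝓝 z, ∃ δ, Good k (z, δ) ∧ Metric.closedBall z δ ⊆ U := by
    intro k z hz U hU
    have h1 : ∀ᶠ y in 𝓝 z, ∀ j ∈ Finset.range (k + 1), ∀ h : j ≤ k,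
        dist (f h y) (f h z) < (1 / 2) ^ k := by
      rw [Filter.eventually_all_finset]
      intro j _
      by_cases h : j ≤ k
      · have := ((hf h).tendsto z).eventually (Metric.ball_mem_nhds (f h z)
          (by positivity : (0 : ℝ) < (1 / 2) ^ k))
        exact this.mono fun y hy _ => hy
      · exact Eventually.of_forall fun y h' => absurd h' h
    have h2 := (h1.and ((hG k).mem_nhds hz)).and hU
    obtain ⟨δ, hδ, hδ'⟩ := Metric.nhds_basis_closedBall.eventually_iff.1 h2
    refine ⟨δ, ⟨hδ, fun y hy => ⟨(hδ' hy).1.2, fun j h => (hδ' hy).1.1 j ?_ h⟩⟩, fun y hy => (hδ' hy).2⟩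
    simpa using Nat.lt_succ_of_le h
  have hstep : ∀ k (z : {z // Good k z}), ∃ z' : {z // Good (k + 1) z},
      ∀ y ∈ Metric.closedBall z'.1.1 z'.1.2, f k.le_succ y ∈ Metric.closedBall z.1.1 z.1.2 := by
    rintro k ⟨⟨z, δ⟩, hz⟩
    have hzG : z ∈ G k := (hz.2 z (Metric.mem_closedBall_self hz.1.le)).1
    obtain ⟨z', hz', hd'⟩ := hd k z hzG δ hz.1
    obtain ⟨δ', hg, hU⟩ := hgood (k + 1) z' hz' (f k.le_succ ⁻¹' Metric.ball z δ)
      ((hf _).continuousAt (Metric.isOpen_ball.mem_nhds hd'))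
    exact ⟨⟨(z', δ'), hg⟩, fun y hy => Metric.ball_subset_closedBall (hU hy)⟩
  obtain ⟨z₀, hz₀⟩ := h0
  obtain ⟨δ₀, hg₀, -⟩ := hgood 0 z₀ hz₀ Set.univ Filter.univ_mem
  choose step hs using hstep
  let z : ∀ k, {z // Good k z} := fun k => Nat.rec ⟨(z₀, δ₀), hg₀⟩ (fun k w => step k w) k
  have hz : ∀ k, z (k + 1) = step k (z k) := fun _ => rfl
  let B : ∀ k, Set (X k) := fun k => Metric.closedBall (z k).1.1 (z k).1.2
  have hB : ∀ {k l : ℕ} (h : k ≤ l), ∀ y ∈ B l, f h y ∈ B k := by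
    intro k l h
    induction l, h using Nat.le_induction with
    | base => intro y hy; rwa [hself]
    | succ l h ih =>
      intro y hy
      rw [← hcomp h l.le_succ]
      exact ih _ (hs l (z l) y (by rw [← hz]; exact hy))
  have hcen : ∀ k, (z k).1.1 ∈ B k := fun k => Metric.mem_closedBall_self (z k).2.1.le
  have hdist : ∀ {j k l : ℕ} (h : j ≤ k) (h' : k ≤ l),
      dist (f (h.trans h') (z l).1.1) (f h (z k).1.1) < (1 / 2) ^ k := by
    intro j k l h h'
    rw [← hcomp h h']
    exact ((z k).2.2 _ (hB h' _ (hcen l))).2 j h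
  have hlim : ∀ j, ∃ x, Tendsto (fun i => f (Nat.le_add_right j i) (z (j + i)).1.1) atTop (𝓝 x) := by
    intro j
    refine cauchySeq_tendsto_of_complete ?_
    refine cauchySeq_of_le_geometric (1 / 2) ((1 / 2) ^ j) (by norm_num) fun i => ?_
    have h3 := hdist (Nat.le_add_right j i) (Nat.le_succ (j + i))
    rw [dist_comm, ← pow_add]
    exact h3.le
  choose x hx using hlim
  -- The balls are closed, so the limit stays in them and hence in the open set `G k`.
  have hxB : ∀ k, x k ∈ B k := fun k =>
    Metric.isClosed_closedBall.mem_of_tendsto (hx k)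
      (Eventually.of_forall fun i => hB (Nat.le_add_right k i) _ (hcen (k + i)))
  refine ⟨x, fun k => ((z k).2.2 _ (hxB k)).1, fun {j k} h => ?_⟩
  obtain ⟨d, rfl⟩ := Nat.exists_eq_add_of_le h
  refine tendsto_nhds_unique (((hf h).tendsto _).comp (hx (j + d))) ?_
  have := (hx j).comp (tendsto_add_atTop_nat d)
  refine this.congr fun i => ?_
  simp only [Function.comp, hcomp]
  have : ∀ (a b : ℕ) (ha : j ≤ a) (hb : j ≤ b), a = b → f ha (z a).1.1 = f hb (z b).1.1 := by
    rintro a b ha hb rfl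
    rfl
  exact this _ _ _ _ (by omega)

/-! ### Kernels of presentations -/

/-- This is Schanuel's argument. With lifts `α` and `β` between the two free covers, `k = β (α k) +
(k - β (α k))`, and `α k` lies in the range of `f` when `q k = 0`. The bound `m + N` depends only on
the sizes, which makes it uniform over a covering. -/
theorem isFinGenBy_ker_of_isFinPresBy {R P : Type*} [Ring R] [AddCommGroup P] [Module R P]
    {m n N : ℕ} (h : IsFinPresBy R P m n) (q : (Fin N → R) →ₗ[R] P) (hq : Function.Surjective q) :
    IsFinGenBy R (LinearMap.ker q) (m + N) := by
  classical
  obtain ⟨f, g, hfg, hg⟩ := h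
  obtain ⟨α, hα⟩ := Module.projective_lifting_property g q hg
  obtain ⟨β, hβ⟩ := Module.projective_lifting_property q g hq
  have hα' : ∀ x, g (α x) = q x := fun x => LinearMap.congr_fun hα x
  have hβ' : ∀ x, q (β x) = g x := fun x => LinearMap.congr_fun hβ x
  refine ⟨Fin.append (fun i => ⟨β (f (Pi.single i 1)), ?_⟩)
    (fun i => ⟨Pi.single i 1 - β (α (Pi.single i 1)), ?_⟩), ?_⟩
  · rw [LinearMap.mem_ker, hβ', hfg.apply_apply_eq_zero]
  · rw [LinearMap.mem_ker, map_sub, hβ', hα', sub_self]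
  · refine top_unique ?_
    rintro ⟨k, hk⟩ -
    obtain ⟨c, hc⟩ := (hfg (α k)).1 (by rw [hα']; exact hk)
    have e1 : β (α k) = ∑ i, c i • β (f (Pi.single i 1)) := by
      simp_rw [← hc, ← map_smul, ← map_sum]
      congr 2
      ext j
      simp [Pi.single_apply]
    have e2 : k - β (α k) = ∑ i, k i • (Pi.single i 1 - β (α (Pi.single i 1))) := by
      have hk' : k = ∑ i, k i • (Pi.single i 1 : Fin N → R) := by
        ext j
        simp [Pi.single_apply]
      simp_rw [smul_sub, ← map_smul, Finset.sum_sub_distrib, ← map_sum, ← hk']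
    have : (⟨k, hk⟩ : LinearMap.ker q) = (∑ i, c i • ⟨β (f (Pi.single i 1)), by
          rw [LinearMap.mem_ker, hβ', hfg.apply_apply_eq_zero]⟩) +
        ∑ i, k i • ⟨Pi.single i 1 - β (α (Pi.single i 1)), by
          rw [LinearMap.mem_ker, map_sub, hβ', hα', sub_self]⟩ := by
      refine Subtype.ext ?_
      simp only [Submodule.coe_add, Submodule.coe_sum, Submodule.coe_smul]
      rw [← e1, ← e2]
      abel
    rw [this]
    refine Submodule.add_mem _ (Submodule.sum_mem _ fun i _ => Submodule.smul_mem _ _ ?_)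
      (Submodule.sum_mem _ fun i _ => Submodule.smul_mem _ _ ?_)
    · exact Submodule.subset_span ⟨Fin.castAdd N i, by simp⟩
    · exact Submodule.subset_span ⟨Fin.natAdd m i, by simp⟩

/-! ### Expansions in powers of a central element -/

theorem hasSum_of_eq {α X : Type*} [AddCommMonoid X] [TopologicalSpace X] {f g : α → X} {a b : X}
    (h : HasSum f a) (hfg : ∀ i, g i = f i) (hab : a = b) : HasSum g b :=
  hab ▸ (funext hfg : g = f) ▸ h

/-- A sequence with `‖f i‖ * lam ^ i → 0`. -/
def IsNullSeq (lam : ℝ) {V : Type*} [Norm V] (f : ℕ → V) : Prop :=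
  Tendsto (fun i => ‖f i‖ * lam ^ i) atTop (𝓝 0)

namespace IsNullSeq

variable {lam : ℝ} {V W : Type*} [SeminormedAddCommGroup V] [SeminormedAddCommGroup W]

theorem of_le (hl : 0 < lam) {f : ℕ → V} (hf : IsNullSeq lam f) {g : ℕ → W} {C : ℝ}
    (h : ∀ i, ‖g i‖ ≤ C * ‖f i‖) : IsNullSeq lam g := by
  have h1 := Tendsto.const_mul C hf
  rw [mul_zero] at h1
  refine squeeze_zero (fun i => by positivity) (fun i => ?_) h1
  rw [← mul_assoc]
  exact mul_le_mul_of_nonneg_right (h i) (by positivity)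

theorem zero : IsNullSeq lam (fun _ => 0 : ℕ → V) := by simp [IsNullSeq]

theorem add (hl : 0 < lam) {f g : ℕ → V} (hf : IsNullSeq lam f) (hg : IsNullSeq lam g) :
    IsNullSeq lam (fun i => f i + g i) := by
  have h1 := Tendsto.add hf hg
  rw [add_zero] at h1
  refine squeeze_zero (fun i => by positivity) (fun i => ?_) h1
  rw [← add_mul]
  exact mul_le_mul_of_nonneg_right (norm_add_le _ _) (by positivity)

theorem sub (hl : 0 < lam) {f g : ℕ → V} (hf : IsNullSeq lam f) (hg : IsNullSeq lam g) :
    IsNullSeq lam (fun i => f i - g i) := by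
  simp_rw [sub_eq_add_neg]
  exact hf.add hl (hg.of_le hl (C := 1) fun i => by simp)

theorem sum (hl : 0 < lam) {ι : Type*} (s : Finset ι) {f : ι → ℕ → V}
    (hf : ∀ j ∈ s, IsNullSeq lam (f j)) : IsNullSeq lam (fun i => ∑ j ∈ s, f j i) := by
  classical
  induction s using Finset.induction_on with
  | empty => simpa using zero (V := V)
  | insert a s ha ih =>
    simp_rw [Finset.sum_insert ha]
    exact (hf a (by simp)).add hl (ih fun j hj => hf j (by simp [hj]))

theorem succ_iff (hl : 0 < lam) {f : ℕ → V} :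
    IsNullSeq lam (fun i => f (i + 1)) ↔ IsNullSeq lam f := by
  have key : (fun i => ‖f (i + 1)‖ * lam ^ (i + 1)) =
      fun i => lam * (‖f (i + 1)‖ * lam ^ i) := by
    funext i
    ring
  refine Iff.trans ?_ (tendsto_add_atTop_iff_nat (f := fun i => ‖f i‖ * lam ^ i) 1)
  rw [key]
  constructor
  · intro h
    simpa using Tendsto.const_mul lam h
  · intro h
    have := Tendsto.const_mul lam⁻¹ h
    refine this.congr' (Eventually.of_forall fun i => ?_) |>.trans (by simp)
    simp only [← mul_assoc, inv_mul_cancel₀ hl.ne', one_mul]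

theorem add_iff (hl : 0 < lam) {f : ℕ → V} (k : ℕ) :
    IsNullSeq lam (fun i => f (i + k)) ↔ IsNullSeq lam f := by
  induction k with
  | zero => rfl
  | succ k ih =>
    rw [← ih, ← succ_iff hl (f := fun i => f (i + k))]
    refine iff_of_eq (congrArg _ (funext fun i => congrArg f (by omega)))

theorem pi_iff (hl : 0 < lam) {ι : Type*} [Fintype ι] {f : ℕ → ι → V} :
    IsNullSeq lam f ↔ ∀ j, IsNullSeq lam (fun i => f i j) := by
  constructor
  · intro h j
    exact h.of_le hl (C := 1) fun i => by rw [one_mul]; exact norm_le_pi_norm _ j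
  · intro h
    have h1 := tendsto_finsetSum Finset.univ fun j _ => h j
    simp only [Finset.sum_const_zero] at h1
    refine squeeze_zero (fun i => by positivity) (fun i => ?_) h1
    rw [← Finset.sum_mul]
    refine mul_le_mul_of_nonneg_right ?_ (by positivity)
    refine (pi_norm_le_iff_of_nonneg (by positivity)).2 fun j => ?_
    exact Finset.single_le_sum (f := fun j => ‖f i j‖) (fun _ _ => norm_nonneg _)
      (Finset.mem_univ j)

end IsNullSeq

/-- Multiplication of a power series `∑ b i X ^ i` by `x + y X`. -/
def linearMulSeq {R P : Type*} [Ring R] [AddCommGroup P] [Module R P] (x y : R) (b : ℕ → P) : ℕ → P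
  | 0 => x • b 0
  | i + 1 => x • b (i + 1) + y • b i

theorem IsNullSeq.linearMulSeq {R V : Type*} [NormedRing R] [NormedAddCommGroup V] [Module R V]
    [IsBoundedSMul R V] {lam : ℝ} (hl : 0 < lam) {x y : R} {b : ℕ → V} (hb : IsNullSeq lam b) :
    IsNullSeq lam (linearMulSeq x y b) := by
  rw [← IsNullSeq.succ_iff hl]
  exact (((IsNullSeq.succ_iff hl).2 hb).of_le hl fun i => norm_smul_le x _).add hl
    (hb.of_le hl fun i => norm_smul_le y _)

/-- The image in `R' ^ n` of a vector in `R ^ n`. -/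
abbrev mapVec {R R' : Type*} [Ring R] [Ring R'] (ρ : R →+* R') {ι : Type*} (v : ι → R) : ι → R' :=
  fun l => ρ (v l)

/-- Relations over `R'` between vectors in `R ^ n` are generated by the relations over `R`. -/
def FlatHom {R R' : Type*} [Ring R] [Ring R'] (ρ : R →+* R') : Prop :=
  ∀ (m n : ℕ) (v : Fin m → Fin n → R) (a : Fin m → R'), ∑ i, a i • mapVec ρ (v i) = 0 →
    a ∈ Submodule.span R' (mapVec ρ '' {b : Fin m → R | ∑ i, b i • v i = 0})

theorem FlatHom.comp {R R' R'' : Type*} [Ring R] [Ring R'] [Ring R''] {ρ : R →+* R'}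
    {σ : R' →+* R''} (hσ : FlatHom σ) (hρ : FlatHom ρ) : FlatHom (σ.comp ρ) := by
  intro m n v a ha
  refine Submodule.span_le.2 ?_ (hσ m n (fun i => mapVec ρ (v i)) a ha)
  rintro _ ⟨b, hb, rfl⟩
  have hb' := hρ m n v b hb
  refine Submodule.span_induction (p := fun b _ => mapVec σ b ∈ Submodule.span R''
    (mapVec (σ.comp ρ) '' {b : Fin m → R | ∑ i, b i • v i = 0})) ?_ ?_ ?_ ?_ hb'
  · rintro _ ⟨c, hc, rfl⟩
    exact Submodule.subset_span ⟨c, hc, rfl⟩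
  · convert Submodule.zero_mem _ using 1
    funext l
    exact map_zero σ
  · intro b c _ _ hb hc
    convert Submodule.add_mem _ hb hc using 1
    funext l
    exact map_add σ _ _
  · intro r b _ hb
    convert Submodule.smul_mem _ (σ r) hb using 1
    funext l
    exact map_mul σ _ _

/-- Every element of `R'` is a sum `∑ ρ (f i) τ ^ i` with `‖f i‖ * lam ^ i → 0`, and the kernel of
this evaluation consists of the multiples of `x + y X`. -/
structure IsExpansion {R R' : Type*} [NormedRing R] [NormedRing R'] (ρ : R →+* R') (τ : R')
    (lam : ℝ) (x y : R) : Prop where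
  lam_pos : 0 < lam
  comm_tau : ∀ r, τ * r = r * τ
  rel : ρ x + ρ y * τ = 0
  summable : ∀ f : ℕ → R, IsNullSeq lam f → Summable fun i => ρ (f i) * τ ^ i
  surj : ∀ a, ∃ f : ℕ → R, IsNullSeq lam f ∧ HasSum (fun i => ρ (f i) * τ ^ i) a
  ker : ∀ f : ℕ → R, IsNullSeq lam f → HasSum (fun i => ρ (f i) * τ ^ i) 0 →
    ∃ b : ℕ → R, IsNullSeq lam b ∧ f = linearMulSeq x y b

namespace IsExpansion

variable {R R' : Type*} [NormedRing R] [NormedRing R'] {ρ : R →+* R'} {τ : R'}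
    {lam : ℝ} {x y : R} (E : IsExpansion ρ τ lam x y)

include E

theorem hasSum_comb {ι : Type*} (s : Finset ι) {c : ι → ℕ → R} {t : ι → R'}
    (hc : ∀ j, HasSum (fun i => ρ (c j i) * τ ^ i) (t j)) (w : ι → R) :
    HasSum (fun i => ρ (∑ j ∈ s, c j i * w j) * τ ^ i) (∑ j ∈ s, t j * ρ (w j)) := by
  have := hasSum_sum (s := s) fun j _ => (hc j).mul_right (ρ (w j))
  refine hasSum_of_eq this (fun i => ?_) rfl
  have hcomm : ∀ r, τ ^ i * r = r * τ ^ i := fun r => (Commute.pow_left (E.comm_tau r) i).eq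
  rw [map_sum, Finset.sum_mul]
  refine Finset.sum_congr rfl fun j _ => ?_
  rw [map_mul, mul_assoc, mul_assoc, hcomm]

/-- Since `τ` is central, the value is `(ρ x + ρ y * τ)` times the value of `b`, which vanishes by
`rel`. -/
theorem hasSum_linearMulSeq {b : ℕ → R} (hb : IsNullSeq lam b) :
    HasSum (fun i => ρ (linearMulSeq x y b i) * τ ^ i) 0 := by
  obtain ⟨t, ht⟩ := E.summable b hb
  have h1 := ht.mul_left (ρ x)
  have h2 := (ht.mul_left (ρ y)).mul_right τ
  have h3 : HasSum (fun i => ρ x * (ρ (b (i + 1)) * τ ^ (i + 1)))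
      (ρ x * t - ρ x * (ρ (b 0) * τ ^ 0)) := by
    have := (hasSum_nat_add_iff' 1).2 h1
    simpa using this
  rw [← hasSum_nat_add_iff' 1]
  refine hasSum_of_eq ((h3.add h2)) (fun i => ?_) ?_
  · simp only [linearMulSeq, smul_eq_mul, map_add, map_mul, add_mul, pow_succ, mul_assoc]
  · have : ρ y * t * τ = ρ y * τ * t := by rw [mul_assoc, mul_assoc, E.comm_tau]
    rw [this, sub_add_eq_add_sub, ← add_mul, E.rel]
    simp [linearMulSeq]

theorem ker_vec {n : ℕ} (f : ℕ → Fin n → R) (hf : IsNullSeq lam f)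
    (h : ∀ l, HasSum (fun i => ρ (f i l) * τ ^ i) 0) :
    ∃ b : ℕ → Fin n → R, IsNullSeq lam b ∧ f = linearMulSeq x y b := by
  rw [IsNullSeq.pi_iff E.lam_pos] at hf
  choose b hb hfb using fun l => E.ker (fun i => f i l) (hf l) (h l)
  refine ⟨fun i l => b l i, (IsNullSeq.pi_iff E.lam_pos).2 hb, ?_⟩
  funext i l
  have := congrFun (hfb l) i
  rw [this]
  cases i <;> rfl

/-- Expanding the coefficients of `ρ x₀` in terms of `K` gives a series, equal to `x₀` modulo `K`,
whose value is `0`; hence it is a multiple of `x + y X`. The sequence `c` is a convergent solution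
of `(x + y X) c = x₀` modulo `K`. -/
theorem exists_null_of_mem_span {n : ℕ} (K : Submodule R (Fin n → R)) (x₀ : Fin n → R)
    (h : mapVec ρ x₀ ∈ Submodule.span R' (mapVec ρ '' (K : Set (Fin n → R)))) :
    ∃ c : ℕ → Fin n → R, IsNullSeq lam c ∧
      linearMulSeq x y c 0 - x₀ ∈ K ∧ ∀ i, linearMulSeq x y c (i + 1) ∈ K := by
  obtain ⟨l, r, g, hg⟩ := Submodule.mem_span_set'.1 h
  choose k hk hkg using fun i => (g i).2
  choose f hf hfr using fun i => E.surj (r i)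
  let F : ℕ → Fin n → R := fun i => (if i = 0 then x₀ else 0) - ∑ j, f j i • k j
  have hF : IsNullSeq lam F := by
    refine IsNullSeq.sub E.lam_pos ?_ (IsNullSeq.sum E.lam_pos _ fun j _ =>
      (hf j).of_le E.lam_pos (C := ‖k j‖) fun i => by
        rw [mul_comm]; exact norm_smul_le _ _)
    rw [← IsNullSeq.succ_iff E.lam_pos]
    simpa using IsNullSeq.zero
  obtain ⟨c, hc, hFc⟩ := E.ker_vec F hF fun t => by
    have h1 := E.hasSum_comb Finset.univ hfr fun j => k j t
    have h2 : HasSum (fun i => ρ ((if i = 0 then x₀ else 0 : Fin n → R) t) * τ ^ i) (ρ (x₀ t)) := by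
      have := hasSum_single (f := fun i => ρ ((if i = 0 then x₀ else 0 : Fin n → R) t) * τ ^ i) 0
        fun i hi => by simp [hi]
      simpa using this
    refine hasSum_of_eq ((h2.sub h1)) (fun i => ?_) ?_
    · simp [F, sub_mul]
    · have := congrFun hg t
      simp only [Finset.sum_apply, Pi.smul_apply, smul_eq_mul, ← hkg] at this
      exact sub_eq_zero.2 this.symm
  have hK : ∀ i, ∑ j, f j i • k j ∈ K := fun i =>
    Submodule.sum_mem _ fun j _ => Submodule.smul_mem _ _ (hk j)
  refine ⟨c, hc, ?_, fun i => ?_⟩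
  · rw [← hFc]
    simpa [F] using hK 0
  · rw [← hFc]
    simpa [F] using hK (i + 1)

/-- Expand the relation `a` as a series `f`. Its combination with the `v j` has value `0`, so it is
`(x + y X) b`, and `hinj` puts the `b i` in the span of the `v j`. Lifting `b` to `e` with bounded
norm and replacing `f` by `f - (x + y X) e` keeps the value `a` but makes every coefficient a
relation over `R`. Bounded coordinates in finitely many relations then sum to the required
expression. -/
theorem flat [CompleteSpace R] [IsNoetherianRing R] (𝕜 : Type*) [NontriviallyNormedField 𝕜]
    [NormedSpace 𝕜 R] [IsScalarTower 𝕜 R R]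
    (hinj : ∀ (n : ℕ) (K : Submodule R (Fin n → R)) (b : ℕ → Fin n → R),
      (∀ i, linearMulSeq x y b i ∈ K) → ∀ i, b i ∈ K) : FlatHom ρ := by
  intro m n v a ha
  choose f hf hfa using fun i => E.surj (a i)
  obtain ⟨b, hb, hFb⟩ := E.ker_vec (fun i => ∑ j, f j i • v j)
    (IsNullSeq.sum E.lam_pos _ fun j _ => (hf j).of_le E.lam_pos (C := ‖v j‖) fun i => by
        rw [mul_comm]; exact norm_smul_le _ _) fun t => by
    have h1 := E.hasSum_comb Finset.univ hfa fun j => v j t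
    refine hasSum_of_eq (h1) (fun i => ?_) ?_
    · simp
    · simpa using congrFun ha t
  have hbK := hinj n (Submodule.span R (Set.range v)) b fun i => by
    rw [← hFb]
    exact Submodule.sum_mem _ fun j _ =>
      Submodule.smul_mem _ _ (Submodule.subset_span (Set.mem_range_self j))
  obtain ⟨C, hC, hlift⟩ := exists_lift_norm_le 𝕜 v rfl
  choose e he he' using fun i => hlift (b i) (hbK i)
  have hen : IsNullSeq lam e := hb.of_le E.lam_pos he'
  let f' : ℕ → Fin m → R := fun i => (fun j => f j i) - linearMulSeq x y e i
  have hf' : IsNullSeq lam f' := by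
    refine IsNullSeq.sub E.lam_pos ((IsNullSeq.pi_iff E.lam_pos).2 hf) ?_
    exact hen.linearMulSeq E.lam_pos
  have hsum : ∀ i, ∑ j, (linearMulSeq x y e i) j • v j = linearMulSeq x y b i := by
    intro i
    cases i with
    | zero => simp [linearMulSeq, mul_smul, ← Finset.smul_sum, he]
    | succ i => simp [linearMulSeq, add_smul, mul_smul, ← Finset.smul_sum, he, Finset.sum_add_distrib]
  let K : Submodule R (Fin m → R) := LinearMap.ker (Fintype.linearCombination R v)
  have hmemK : ∀ c, c ∈ K ↔ ∑ i, c i • v i = 0 := fun c => by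
    rw [LinearMap.mem_ker, Fintype.linearCombination_apply]
  have hf'K : ∀ i, f' i ∈ K := by
    intro i
    rw [hmemK]
    simp only [f', Pi.sub_apply, sub_smul, Finset.sum_sub_distrib, hsum]
    rw [← hFb, sub_self]
  have hf'a : ∀ j, HasSum (fun i => ρ (f' i j) * τ ^ i) (a j) := by
    intro j
    have h1 := E.hasSum_linearMulSeq (b := fun i => e i j)
      ((IsNullSeq.pi_iff E.lam_pos).1 hen j)
    refine hasSum_of_eq (((hfa j).sub h1)) (fun i => ?_) (sub_zero _)
    rw [← sub_mul, ← map_sub]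
    cases i <;> rfl
  obtain ⟨l, g, hg⟩ := Submodule.fg_iff_exists_fin_generating_family.1 (IsNoetherian.noetherian K)
  obtain ⟨C', hC', hlift'⟩ := exists_lift_norm_le 𝕜 g hg
  choose c hc hc' using fun i => hlift' (f' i) (hf'K i)
  have hcn := (IsNullSeq.pi_iff E.lam_pos).1 (hf'.of_le E.lam_pos hc')
  choose s hs using fun j => E.summable _ (hcn j)
  have key : a = ∑ j, s j • mapVec ρ (g j) := by
    funext t
    refine (hf'a t).unique ?_
    have h1 := E.hasSum_comb Finset.univ hs fun j => g j t
    refine hasSum_of_eq (h1) (fun i => ?_) (by simp [mapVec])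
    rw [← hc i]
    simp
  rw [key]
  refine Submodule.sum_mem _ fun j _ => Submodule.smul_mem _ _ (Submodule.subset_span ⟨g j, ?_, rfl⟩)
  exact (hmemK _).1 (hg ▸ Submodule.subset_span (Set.mem_range_self j))

end IsExpansion

/-! ### Injectivity of `1 + y X` and `X - T` on power series modulo a submodule. -/

section Injectivity

variable {R V : Type*} [Ring R] [AddCommGroup V] [Module R V]

theorem mem_of_linearMulSeq_one_mem (y : R) (K : Submodule R V) (b : ℕ → V)
    (h : ∀ i, linearMulSeq 1 y b i ∈ K) (i : ℕ) : b i ∈ K := by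
  induction i with
  | zero => simpa [linearMulSeq] using h 0
  | succ i ih =>
    have := K.sub_mem (h (i + 1)) (K.smul_mem y ih)
    simpa [linearMulSeq] using this

/-- Modulo `K` one has `T b 0 = 0` and `b i = T b (i + 1)`, so `b i` is killed by `T ^ (i + 1)` and
also equals `T ^ k b (i + k)` for every `k`. By the noetherian property a single power `T ^ k` kills
all `T`-power torsion modulo `K`. -/
theorem mem_of_linearMulSeq_neg_mem [IsNoetherian R V] {T : R} (hT : ∀ r, T * r = r * T)
    (K : Submodule R V) (b : ℕ → V) (h : ∀ i, linearMulSeq (-T) 1 b i ∈ K) (i : ℕ) : b i ∈ K := by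
  have hTp : ∀ k r, T ^ k * r = r * T ^ k := fun k r => (Commute.pow_left (hT r) k).eq
  let L : ℕ →o Submodule R V :=
    { toFun := fun k =>
        { carrier := {v | T ^ k • v ∈ K}
          add_mem' := fun {u w} hu hw => by
            simp only [Set.mem_ofPred_eq] at hu hw ⊢
            rw [smul_add]
            exact K.add_mem hu hw
          zero_mem' := by simp
          smul_mem' := fun r v hv => by
            simp only [Set.mem_ofPred_eq] at hv ⊢
            rw [smul_smul, hTp, mul_smul]
            exact K.smul_mem r hv }
      monotone' := monotone_nat_of_le_succ fun k v hv => by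
        change T ^ (k + 1) • v ∈ K
        rw [pow_succ', mul_smul]
        exact K.smul_mem T hv }
  have hL : ∀ k v, v ∈ L k ↔ T ^ k • v ∈ K := fun _ _ => Iff.rfl
  obtain ⟨k, hk⟩ := monotone_stabilizes_iff_noetherian.2 ‹IsNoetherian R V› L
  have h0 : T • b 0 ∈ K := by simpa [linearMulSeq] using h 0
  have h1 : ∀ i, b i - T • b (i + 1) ∈ K := fun i => by
    have := h (i + 1)
    simp only [linearMulSeq, neg_smul, one_smul] at this
    rwa [neg_add_eq_sub] at this
  have h2 : ∀ i, T ^ (i + 1) • b i ∈ K := by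
    intro i
    induction i with
    | zero => simpa using h0
    | succ i ih =>
      have := K.sub_mem ih (K.smul_mem (T ^ (i + 1)) (h1 i))
      rw [← smul_sub, sub_sub_cancel, smul_smul, ← pow_succ] at this
      exact this
  have h3 : ∀ j, b i - T ^ j • b (i + j) ∈ K := by
    intro j
    induction j with
    | zero => simp
    | succ j ih =>
      have := K.add_mem ih (K.smul_mem (T ^ j) (h1 (i + j)))
      rwa [smul_sub, smul_smul, ← pow_succ, sub_add_sub_cancel] at this
  have h4 : T ^ k • b (i + k) ∈ K := by
    rw [← hL, hk (i + k + 1) (by omega), hL]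
    exact h2 _
  have := K.add_mem (h3 k) h4
  rwa [sub_add_cancel] at this

end Injectivity

/-- A vector which lies in a submodule over both parts of the annulus lies in it over the whole
annulus. -/
theorem mem_of_mem_span_of_mem_span {R R₁ R₂ : Type*} [NormedRing R] [NormedRing R₁]
    [NormedRing R₂] [CompleteSpace R] [IsNoetherianRing R] (𝕜 : Type*) [NontriviallyNormedField 𝕜]
    [NormedSpace 𝕜 R] [IsScalarTower 𝕜 R R] {ρ₁ : R →+* R₁} {ρ₂ : R →+* R₂} {τ₁ : R₁} {τ₂ : R₂}
    {lam : ℝ} {T : R} (hT : ∀ r, T * r = r * T)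
    (E₁ : IsExpansion ρ₁ τ₁ lam⁻¹ 1 (-T)) (E₂ : IsExpansion ρ₂ τ₂ lam (-T) 1)
    {n : ℕ} (K : Submodule R (Fin n → R)) (x : Fin n → R)
    (h₁ : mapVec ρ₁ x ∈ Submodule.span R₁ (mapVec ρ₁ '' (K : Set (Fin n → R))))
    (h₂ : mapVec ρ₂ x ∈ Submodule.span R₂ (mapVec ρ₂ '' (K : Set (Fin n → R)))) : x ∈ K := by
  have hl := E₂.lam_pos
  have hl' := E₁.lam_pos
  have hTp : ∀ k r, T ^ k * r = r * T ^ k := fun k r => (Commute.pow_left (hT r) k).eq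
  -- Modulo `K`, the sequence `c` represents `T ^ i x` and `d` represents a choice of `T ^ (-i) x`,
  -- both of controlled size. These are what vanishing of `x` modulo `K` over each of the two
  -- smaller rings yields.
  let S₁ : (Fin n → R) → Prop := fun x =>
    ∃ c : ℕ → Fin n → R, IsNullSeq lam⁻¹ c ∧ ∀ i, c i - T ^ i • x ∈ K
  let S₂ : (Fin n → R) → Prop := fun x =>
    ∃ d : ℕ → Fin n → R, IsNullSeq lam d ∧ d 0 - x ∈ K ∧ ∀ i, d i - T • d (i + 1) ∈ K
  have hx₁ : S₁ x := by
    obtain ⟨c, hc, h0, hi⟩ := E₁.exists_null_of_mem_span K x h₁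
    refine ⟨c, hc, fun i => ?_⟩
    induction i with
    | zero => simpa [linearMulSeq] using h0
    | succ i ih =>
      have := K.add_mem (hi i) (K.smul_mem T ih)
      simp only [linearMulSeq, one_smul, neg_smul, smul_sub, smul_smul, ← pow_succ'] at this
      convert this using 1
      abel
  have hx₂ : S₂ x := by
    obtain ⟨c, hc, h0, hi⟩ := E₂.exists_null_of_mem_span K x h₂
    refine ⟨fun i => Nat.casesOn i x fun i => -c i, ?_, by simp, fun i => ?_⟩
    · rw [← IsNullSeq.succ_iff hl]
      exact hc.of_le hl (C := 1) fun i => by simp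
    · cases i with
      | zero =>
        have := K.neg_mem h0
        simp only [linearMulSeq, neg_smul] at this
        convert this using 1
        change x - T • -c 0 = _
        rw [smul_neg]
        abel
      | succ i =>
        have := K.neg_mem (hi i)
        simp only [linearMulSeq, neg_smul, one_smul] at this
        convert this using 1
        change -c i - T • -c (i + 1) = _
        rw [smul_neg]
        abel
  -- All vectors with both properties form a submodule containing `K`. It is finitely generated,
  -- which allows a perturbation argument to prove `Q ≤ K` at once.
  let Q : Submodule R (Fin n → R) :=
    { carrier := {x | S₁ x ∧ S₂ x}
      zero_mem' := ⟨⟨_, .zero, by simp⟩, _, .zero, by simp, by simp⟩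
      add_mem' := by
        rintro u w ⟨⟨c, hc, hc'⟩, d, hd, hd0, hd'⟩ ⟨⟨c₂, hc₂, hc₂'⟩, d₂, hd₂, hd0₂, hd₂'⟩
        refine ⟨⟨fun i => c i + c₂ i, hc.add hl' hc₂, fun i => ?_⟩, fun i => d i + d₂ i,
          hd.add hl hd₂, ?_, fun i => ?_⟩
        · rw [smul_add, add_sub_add_comm]
          exact K.add_mem (hc' i) (hc₂' i)
        · rw [add_sub_add_comm]
          exact K.add_mem hd0 hd0₂
        · rw [smul_add, add_sub_add_comm]
          exact K.add_mem (hd' i) (hd₂' i)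
      smul_mem' := by
        rintro r u ⟨⟨c, hc, hc'⟩, d, hd, hd0, hd'⟩
        refine ⟨⟨fun i => r • c i, hc.of_le hl' fun i => norm_smul_le r _, fun i => ?_⟩,
          fun i => r • d i, hd.of_le hl fun i => norm_smul_le r _, ?_, fun i => ?_⟩
        · rw [smul_smul, hTp, mul_smul, ← smul_sub]
          exact K.smul_mem _ (hc' i)
        · rw [← smul_sub]
          exact K.smul_mem _ hd0
        · rw [smul_smul, hT, mul_smul, ← smul_sub]
          exact K.smul_mem _ (hd' i) }
  have hQ : ∀ u, u ∈ Q ↔ S₁ u ∧ S₂ u := fun _ => Iff.rfl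
  have hKQ : K ≤ Q := fun u hu => ⟨⟨_, .zero, fun i => by
    simpa using K.smul_mem (T ^ i) hu⟩, _, .zero, by simpa using hu, by simp⟩
  -- `Q` is stable under the chosen divisions by `T ^ i`. Modulo `K`, `T ^ j d i` equals `T ^ (j -
  -- i) u` for `j ≥ i`, so a shift of `c` serves as its growth sequence; the finitely many earlier
  -- terms do not affect convergence.
  have hdQ : ∀ u, S₁ u → ∀ d : ℕ → Fin n → R, IsNullSeq lam d → d 0 - u ∈ K →
      (∀ i, d i - T • d (i + 1) ∈ K) → ∀ i, T ^ i • d i - u ∈ K ∧ d i ∈ Q := by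
    rintro u ⟨c, hc, hc'⟩ d hd hd0 hd' i
    have h5 : T ^ i • d i - u ∈ K := by
      induction i with
      | zero => simpa using hd0
      | succ i ih =>
        have := K.sub_mem ih (K.smul_mem (T ^ i) (hd' i))
        rw [smul_sub, smul_smul, ← pow_succ] at this
        convert this using 1
        abel
    refine ⟨h5, ⟨fun j => if j < i then T ^ j • d i else c (j - i), ?_, fun j => ?_⟩,
      fun j => d (j + i), (IsNullSeq.add_iff hl i).2 hd, by simp, fun j => ?_⟩
    · rw [← IsNullSeq.add_iff hl' i]
      simpa using hc
    · by_cases hj : j < i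
      · simp [hj]
      · obtain ⟨k, rfl⟩ := Nat.exists_eq_add_of_le (not_lt.1 hj)
        have := K.sub_mem (hc' k) (K.smul_mem (T ^ k) h5)
        rw [smul_sub, smul_smul, ← pow_add, sub_sub_sub_cancel_right, add_comm k i] at this
        simpa using this
    · have := hd' (j + i)
      rwa [show j + i + 1 = j + 1 + i by omega] at this
  obtain ⟨l, q, hq⟩ := Submodule.fg_iff_exists_fin_generating_family.1 (IsNoetherian.noetherian Q)
  obtain ⟨C, hC, hlift⟩ := exists_lift_norm_le 𝕜 q hq
  have hqQ : ∀ j, q j ∈ Q := fun j => hq ▸ Submodule.subset_span (Set.mem_range_self j)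
  choose c hc hc' using fun j => (hqQ j).1
  choose d hd hd0 hd' using fun j => (hqQ j).2
  have hdm := fun j => hdQ (q j) (hqQ j).1 (d j) (hd j) (hd0 j) (hd' j)
  have hcQ : ∀ j i, c j i ∈ Q := fun j i => by
    have := Q.add_mem (hKQ (hc' j i)) (Q.smul_mem (T ^ i) (hqQ j))
    rwa [sub_add_cancel] at this
  choose a ha ha' using fun j i => hlift (c j i) (hcQ j i)
  choose b hb hb' using fun j i => hlift (d j i) (hdm j i).2
  -- The entries below are sums of `l` products, each at most `(C δ) ^ 2`, and must be at most `1 /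
  -- (l + 1)`.
  obtain ⟨δ, hδ, hδ'⟩ : ∃ δ > 0, l * (C * δ * (C * δ)) * ((l : ℝ) + 1) ≤ 1 := by
    refine ⟨1 / (C * (l + 1)), by positivity, ?_⟩
    have h6 : C * (1 / (C * ((l : ℝ) + 1))) = 1 / (l + 1) := by field_simp
    rw [h6]
    have h7 : (l : ℝ) * (1 / (l + 1) * (1 / (l + 1))) * (l + 1) = l / (l + 1) := by field_simp
    rw [h7, div_le_one (by positivity)]
    linarith
  obtain ⟨i, hi⟩ : ∃ i, ∀ j, ‖c j i‖ * lam⁻¹ ^ i ≤ δ ∧ ‖d j i‖ * lam ^ i ≤ δ := by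
    have h8 : ∀ᶠ i in atTop, ∀ j, ‖c j i‖ * lam⁻¹ ^ i ≤ δ ∧ ‖d j i‖ * lam ^ i ≤ δ := by
      rw [eventually_all]
      exact fun j => ((hc j).eventually_le_const hδ).and ((hd j).eventually_le_const hδ)
    exact h8.exists
  have hli : lam⁻¹ ^ i * lam ^ i = 1 := by
    rw [← mul_pow, inv_mul_cancel₀ hl.ne', one_pow]
  have hsmall : ∀ j k, ‖∑ t, b j i t * a t i k‖ * ((Fintype.card (Fin l) : ℝ) + 1) ≤ 1 := by
    intro j k
    rw [Fintype.card_fin]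
    refine le_trans (mul_le_mul_of_nonneg_right ?_ (by positivity)) hδ'
    have h9 : ∀ t, ‖b j i t * a t i k‖ ≤ C * δ * (C * δ) := by
      intro t
      have e1 : ‖b j i t‖ * lam ^ i ≤ C * δ := by
        calc _ ≤ C * ‖d j i‖ * lam ^ i := by
              gcongr
              exact (norm_le_pi_norm _ t).trans (hb' j i)
          _ = C * (‖d j i‖ * lam ^ i) := by ring
          _ ≤ _ := by gcongr; exact (hi j).2
      have e2 : ‖a t i k‖ * lam⁻¹ ^ i ≤ C * δ := by
        calc _ ≤ C * ‖c t i‖ * lam⁻¹ ^ i := by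
              gcongr
              exact (norm_le_pi_norm _ k).trans (ha' t i)
          _ = C * (‖c t i‖ * lam⁻¹ ^ i) := by ring
          _ ≤ _ := by gcongr; exact (hi t).1
      calc _ ≤ ‖b j i t‖ * ‖a t i k‖ := norm_mul_le _ _
        _ = (‖b j i t‖ * lam ^ i) * (‖a t i k‖ * lam⁻¹ ^ i) := by
            linear_combination (-(‖b j i t‖ * ‖a t i k‖)) * hli
        _ ≤ _ := mul_le_mul e1 e2 (by positivity) (by positivity)
    refine (norm_sum_le _ _).trans ((Finset.sum_le_sum fun t _ => h9 t).trans ?_)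
    simp
  -- Modulo `K`, `q j = T ^ i d j i`. Writing `d j i` in the `q t` and then replacing `T ^ i q t` by
  -- `c t i` expresses `q j` through the `q k`. The factors `lam ^ i` and `lam⁻¹ ^ i` cancel in the
  -- product, so its matrix is small.
  have hin : ∀ j, q j - ∑ k, (∑ t, b j i t * a t i k) • q k ∈ K := by
    intro j
    have e1 : ∑ k, (∑ t, b j i t * a t i k) • q k = ∑ t, b j i t • c t i := by
      simp_rw [Finset.sum_smul, mul_smul]
      rw [Finset.sum_comm]
      simp_rw [← Finset.smul_sum, ha]
    have e2 : T ^ i • d j i = ∑ t, b j i t • T ^ i • q t := by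
      conv_lhs => rw [← hb j i]
      rw [Finset.smul_sum]
      refine Finset.sum_congr rfl fun t _ => ?_
      rw [smul_smul, smul_smul, hTp]
    have e3 : T ^ i • d j i - ∑ t, b j i t • c t i ∈ K := by
      rw [e2, ← Finset.sum_sub_distrib]
      refine K.sum_mem fun t _ => ?_
      rw [← smul_sub]
      refine K.smul_mem _ ?_
      rw [← neg_sub]
      exact K.neg_mem (hc' t i)
    rw [e1]
    have := K.sub_mem e3 (hdm j i).1
    rwa [sub_sub_sub_cancel_left] at this
  have hfin := mem_span_of_eq_add_small (q := q)
    (y := fun j => q j - ∑ k, (∑ t, b j i t * a t i k) • q k) hsmall fun j => by abel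
  have hQK : Q ≤ K := by
    rw [← hq, Submodule.span_le]
    rintro _ ⟨j, rfl⟩
    refine Submodule.span_le.2 ?_ (hfin j)
    rintro _ ⟨k, rfl⟩
    exact hin k
  exact hQK ⟨hx₁, hx₂⟩

/-! ### The Banach ring of analytic functions on a closed annulus -/

section Weight

variable {p : ℕ} [hp : Fact p.Prime]

theorem absT_lt {s t : ℝ≥0∞} (h : s < t) (ht : t ≠ ⊤) : absT p t < absT p s := by
  have h1 : (1 : ℝ) < p := by exact_mod_cast hp.out.one_lt
  refine Real.rpow_lt_rpow_of_exponent_lt h1 (neg_lt_neg ?_)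
  exact div_lt_div_of_pos_right ((ENNReal.toReal_lt_toReal h.ne_top ht).2 h) (by linarith)

theorem absT_le {s t : ℝ≥0∞} (h : s ≤ t) (ht : t ≠ ⊤) : absT p t ≤ absT p s := by
  rcases h.eq_or_lt with rfl | h
  · exact le_rfl
  · exact (absT_lt h ht).le

variable {r₀ : ℝ≥0∞}

/-- The right end of an interval, or the left end if the right end is infinite. -/
noncomputable def ClosedInterval.upper (J : ClosedInterval r₀) : ℝ≥0∞ :=
  open Classical in if J.r = ⊤ then J.s else J.r

theorem ClosedInterval.upper_eq {J : ClosedInterval r₀} (h : J.r ≠ ⊤) : J.upper = J.r := if_neg h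

theorem ClosedInterval.upper_ne_top (J : ClosedInterval r₀) : J.upper ≠ ⊤ := by
  rw [ClosedInterval.upper]
  split_ifs with h
  exacts [J.s_ne_top, h]

theorem ClosedInterval.s_le_upper (J : ClosedInterval r₀) : J.s ≤ J.upper := by
  rw [ClosedInterval.upper]
  split_ifs with h
  exacts [le_rfl, J.s_le_r]

theorem ClosedInterval.upper_mem (J : ClosedInterval r₀) : J.upper ∈ J.region.carrier := by
  refine ⟨J.s_le_upper, ?_⟩
  rw [ClosedInterval.upper]
  split_ifs with h
  exacts [J.s_le_r, le_rfl]

theorem ClosedInterval.s_mem (J : ClosedInterval r₀) : J.s ∈ J.region.carrier := ⟨le_rfl, J.s_le_r⟩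

theorem absT_upper_le (J : ClosedInterval r₀) : absT p J.upper ≤ absT p J.s :=
  absT_le J.s_le_upper J.upper_ne_top

variable (p) in
/-- The maximum of `|T| ^ n` at the two ends of an interval. -/
noncomputable def weight (J : ClosedInterval r₀) (n : ℤ) : ℝ :=
  max (absT p J.s ^ n) (absT p J.upper ^ n)

theorem weight_pos (J : ClosedInterval r₀) (n : ℤ) : 0 < weight p J n :=
  lt_max_of_lt_left (zpow_pos (absT_pos _) _)

theorem zpow_le_zpow_left_of_neg {a b : ℝ} (ha : 0 < a) (hab : a ≤ b) {n : ℤ} (hn : n ≤ 0) :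
    b ^ n ≤ a ^ n := by
  obtain ⟨m, rfl⟩ := Int.exists_eq_neg_ofNat hn
  rw [zpow_neg, zpow_neg, zpow_natCast, zpow_natCast]
  exact inv_anti₀ (pow_pos ha _) (pow_le_pow_left₀ ha.le hab _)

theorem weight_of_nonneg (J : ClosedInterval r₀) {n : ℤ} (hn : 0 ≤ n) :
    weight p J n = absT p J.s ^ n :=
  max_eq_left (zpow_le_zpow_left₀ hn (absT_pos _).le (absT_upper_le J))

theorem weight_of_nonpos (J : ClosedInterval r₀) {n : ℤ} (hn : n ≤ 0) :
    weight p J n = absT p J.upper ^ n :=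
  max_eq_right (zpow_le_zpow_left_of_neg (absT_pos _) (absT_upper_le J) hn)

theorem weight_zero (J : ClosedInterval r₀) : weight p J 0 = 1 := by simp [weight]

theorem weight_add_le (J : ClosedInterval r₀) (m n : ℤ) :
    weight p J (m + n) ≤ weight p J m * weight p J n := by
  refine max_le ?_ ?_
  · rw [zpow_add₀ (absT_pos _).ne']
    exact mul_le_mul (le_max_left _ _) (le_max_left _ _) (zpow_pos (absT_pos _) _).le
      (weight_pos J m).le
  · rw [zpow_add₀ (absT_pos _).ne']
    exact mul_le_mul (le_max_right _ _) (le_max_right _ _) (zpow_pos (absT_pos _) _).le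
      (weight_pos J m).le

/-- When `J'.r = ⊤` the weight of `J'` at `n < 0` is taken at its left end, and monotonicity may
fail. The coefficients concerned vanish, so these `n` can be excluded. -/
theorem weight_le_weight {J'' J' : ClosedInterval r₀} (h : J'' ≤ J') {n : ℤ}
    (hn : 0 ≤ n ∨ J'.r ≠ ⊤) : weight p J'' n ≤ weight p J' n := by
  rcases le_total 0 n with h0 | h0
  · rw [weight_of_nonneg _ h0, weight_of_nonneg _ h0]
    exact zpow_le_zpow_left₀ h0 (absT_pos _).le (absT_le h.1 J''.s_ne_top)
  · rcases hn with hn | hn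
    · obtain rfl := le_antisymm h0 hn
      simp [weight_zero]
    · have hn'' : J''.r ≠ ⊤ := (h.2.trans_lt hn.lt_top).ne
      rw [weight_of_nonpos _ h0, weight_of_nonpos _ h0, ClosedInterval.upper_eq hn,
        ClosedInterval.upper_eq hn'']
      exact zpow_le_zpow_left_of_neg (absT_pos _) (absT_le h.2 hn) h0

theorem zpow_le_weight (J : ClosedInterval r₀) {t : ℝ≥0∞} (ht : t ∈ J.region.carrier) (ht' : t ≠ ⊤)
    {n : ℤ} (hn : 0 ≤ n ∨ J.r ≠ ⊤) : absT p t ^ n ≤ weight p J n := by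
  rcases le_total 0 n with h0 | h0
  · rw [weight_of_nonneg _ h0]
    exact zpow_le_zpow_left₀ h0 (absT_pos _).le (absT_le ht.1 ht')
  · rcases hn with hn | hn
    · obtain rfl := le_antisymm h0 hn
      simp [weight_zero]
    · rw [weight_of_nonpos _ h0, ClosedInterval.upper_eq hn]
      exact zpow_le_zpow_left_of_neg (absT_pos _) (absT_le ht.2 hn) h0

end Weight

namespace AnRing

section Coeff

variable {p : ℕ} [hp : Fact p.Prime] {A : Type*} [NormedRing A] {r₀ : ℝ≥0∞} {J : ClosedInterval r₀}

theorem tendsto_coeff (f : IntervalRing p A J) :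
    Tendsto (fun n => ‖f.coeff n‖ * weight p J n) cofinite (𝓝 0) := by
  have h1 := ((f.convergesAt _ J.s_mem).1 J.s_ne_top).add
    ((f.convergesAt _ J.upper_mem).1 J.upper_ne_top)
  rw [add_zero] at h1
  refine squeeze_zero (fun n => mul_nonneg (norm_nonneg _) (weight_pos J n).le) (fun n => ?_) h1
  rw [← mul_add]
  refine mul_le_mul_of_nonneg_left ?_ (norm_nonneg _)
  exact max_le_add_of_nonneg (zpow_pos (absT_pos _) n).le (zpow_pos (absT_pos _) n).le

theorem coeff_eq_zero (f : IntervalRing p A J) (h : J.r = ⊤) {n : ℤ} (hn : n < 0) :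
    f.coeff n = 0 :=
  (f.convergesAt J.r ⟨J.s_le_r, le_rfl⟩).2 h n hn

variable (J) in
/-- An element of the ring of the annulus, from its coefficients. -/
def ofCoeff (c : ℤ → A) (h : Tendsto (fun n => ‖c n‖ * weight p J n) cofinite (𝓝 0))
    (h' : J.r = ⊤ → ∀ n < 0, c n = 0) : IntervalRing p A J where
  coeff := c
  convergesAt t ht := by
    refine ⟨fun ht' => ?_, fun ht' => h' (top_unique (ht' ▸ ht.2))⟩
    refine squeeze_zero (fun n => mul_nonneg (norm_nonneg _) (zpow_pos (absT_pos _) n).le)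
      (fun n => ?_) h
    by_cases hn : 0 ≤ n ∨ J.r ≠ ⊤
    · exact mul_le_mul_of_nonneg_left (zpow_le_weight J ht ht' hn) (norm_nonneg _)
    · push Not at hn
      simp [h' hn.2 n hn.1]

theorem tendsto_of_finite {c : ℤ → A} (F : Set ℤ) (hF : F.Finite) (hc : ∀ n ∉ F, c n = 0) :
    Tendsto (fun n => ‖c n‖ * weight p J n) cofinite (𝓝 0) := by
  refine tendsto_nhds_of_eventually_eq ?_
  rw [eventually_cofinite]
  refine hF.subset fun n hn => ?_
  by_contra h0
  exact hn (by simp [hc n h0])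

variable (J) in
/-- The monomial `a T ^ n`. -/
noncomputable def mono (n : ℤ) (a : A) (h : J.r = ⊤ → 0 ≤ n) : IntervalRing p A J :=
  ofCoeff J (Pi.single n a) (tendsto_of_finite {n} (Set.finite_singleton n)
    fun _ hm => Pi.single_eq_of_ne hm _) fun ht _ hm =>
      Pi.single_eq_of_ne (hm.trans_le (h ht)).ne _

/-- The supremum of the Gauss norms over the annulus. -/
noncomputable def supNorm (f : IntervalRing p A J) : ℝ := ⨆ n, ‖f.coeff n‖ * weight p J n

theorem coeff_mul_weight_le_supNorm (f : IntervalRing p A J) (n : ℤ) :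
    ‖f.coeff n‖ * weight p J n ≤ supNorm f :=
  le_ciSup (f.tendsto_coeff.bddAbove_range_of_cofinite) n

theorem supNorm_le {f : IntervalRing p A J} {C : ℝ} (h : ∀ n, ‖f.coeff n‖ * weight p J n ≤ C) :
    supNorm f ≤ C := ciSup_le h

theorem supNorm_nonneg (f : IntervalRing p A J) : 0 ≤ supNorm f :=
  (mul_nonneg (norm_nonneg _) (weight_pos J 0).le).trans (coeff_mul_weight_le_supNorm f 0)

end Coeff

/-! ### Completeness, monomials and density of Laurent polynomials. -/

section Normed

variable {p : ℕ} [hp : Fact p.Prime] {A : Type*} [NormedRing A] [IsUltrametricDist A]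
  [CompleteSpace A] {r₀ : ℝ≥0∞} {J : ClosedInterval r₀}

/-- The supremum norm as a ring norm. -/
noncomputable def ringNorm (J : ClosedInterval r₀) : RingNorm (IntervalRing p A J) where
  toFun := supNorm
  map_zero' := le_antisymm (supNorm_le fun n => by simp) (supNorm_nonneg _)
  add_le' f g := supNorm_le fun n => by
    calc _ ≤ (‖f.coeff n‖ + ‖g.coeff n‖) * weight p J n :=
          mul_le_mul_of_nonneg_right (norm_add_le _ _) (weight_pos J n).le
      _ ≤ _ := by
        rw [add_mul]
        exact add_le_add (coeff_mul_weight_le_supNorm f n) (coeff_mul_weight_le_supNorm g n)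
  neg' f := by simp [supNorm]
  mul_le' f g := supNorm_le fun n => by
    rw [← le_div_iff₀ (weight_pos J n)]
    refine (IsUltrametricDist.norm_tsum_le _).trans (ciSup_le fun k => ?_)
    rw [le_div_iff₀ (weight_pos J n)]
    calc ‖f.coeff k * g.coeff (n - k)‖ * weight p J n
        ≤ (‖f.coeff k‖ * ‖g.coeff (n - k)‖) * (weight p J k * weight p J (n - k)) := by
          refine mul_le_mul (norm_mul_le _ _) ?_ (weight_pos J n).le (by positivity)
          have := weight_add_le (p := p) J k (n - k)
          rwa [add_sub_cancel] at this
      _ = (‖f.coeff k‖ * weight p J k) * (‖g.coeff (n - k)‖ * weight p J (n - k)) := by ring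
      _ ≤ _ := mul_le_mul (coeff_mul_weight_le_supNorm f k) (coeff_mul_weight_le_supNorm g _)
          (mul_nonneg (norm_nonneg _) (weight_pos J _).le) (supNorm_nonneg f)
  eq_zero_of_map_eq_zero' f h := AnRing.ext <| funext fun n => by
    have := coeff_mul_weight_le_supNorm f n
    rw [show supNorm f = 0 from h] at this
    have h2 : ‖f.coeff n‖ ≤ 0 := by
      by_contra hc
      push Not at hc
      exact absurd this (not_le.2 (mul_pos hc (weight_pos J n)))
    simpa using h2

noncomputable instance : NormedRing (IntervalRing p A J) := (ringNorm J).toNormedRing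

theorem coeff_mul_weight_le (f : IntervalRing p A J) (n : ℤ) :
    ‖f.coeff n‖ * weight p J n ≤ ‖f‖ := coeff_mul_weight_le_supNorm f n

theorem norm_le {f : IntervalRing p A J} {C : ℝ} (h : ∀ n, ‖f.coeff n‖ * weight p J n ≤ C) :
    ‖f‖ ≤ C := supNorm_le h

@[simp] theorem coeff_sub (f g : IntervalRing p A J) : (f - g).coeff = f.coeff - g.coeff := by
  rw [sub_eq_add_neg, coeff_add, coeff_neg, sub_eq_add_neg]

instance : IsUltrametricDist (IntervalRing p A J) :=
  IsUltrametricDist.isUltrametricDist_of_isNonarchimedean_norm fun f g => norm_le fun n => by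
    rcases le_max_iff.1 (IsUltrametricDist.norm_add_le_max (f.coeff n) (g.coeff n)) with h | h
    · exact le_max_of_le_left ((mul_le_mul_of_nonneg_right h (weight_pos J n).le).trans
        (coeff_mul_weight_le f n))
    · exact le_max_of_le_right ((mul_le_mul_of_nonneg_right h (weight_pos J n).le).trans
        (coeff_mul_weight_le g n))

/-- The coefficients as additive maps. -/
def coeffHom (J : ClosedInterval r₀) (n : ℤ) : IntervalRing p A J →+ A where
  toFun f := f.coeff n
  map_zero' := rfl
  map_add' _ _ := rfl

theorem norm_coeff_le (f : IntervalRing p A J) (n : ℤ) :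
    ‖f.coeff n‖ ≤ (weight p J n)⁻¹ * ‖f‖ := by
  rw [inv_mul_eq_div, le_div_iff₀ (weight_pos J n)]
  exact coeff_mul_weight_le f n

theorem continuous_coeffHom (n : ℤ) : Continuous (coeffHom (p := p) (A := A) J n) :=
  AddMonoidHomClass.continuous_of_bound _ _ fun f => norm_coeff_le f n

theorem hasSum_coeff {ι : Type*} {f : ι → IntervalRing p A J} {a : IntervalRing p A J}
    (h : HasSum f a) (n : ℤ) : HasSum (fun i => (f i).coeff n) (a.coeff n) :=
  h.map (coeffHom J n) (continuous_coeffHom n)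

instance : CompleteSpace (IntervalRing p A J) := by
  refine Metric.complete_of_cauchySeq_tendsto fun f hf => ?_
  have hlim : ∀ n, ∃ c, Tendsto (fun k => (f k).coeff n) atTop (𝓝 c) := fun n =>
    cauchySeq_tendsto_of_complete
      (hf.map (AddMonoidHomClass.lipschitz_of_bound (coeffHom (p := p) (A := A) J n) _ fun g =>
        norm_coeff_le g n).uniformContinuous)
  choose c hc using hlim
  have hb : ∀ ε > 0, ∃ N, ∀ k ≥ N, ∀ n, ‖(f k).coeff n - c n‖ * weight p J n ≤ ε := by
    intro ε hε
    obtain ⟨N, hN⟩ := Metric.cauchySeq_iff.1 hf ε hε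
    refine ⟨N, fun k hk n => ?_⟩
    have h1 : Tendsto (fun l => ‖(f k).coeff n - (f l).coeff n‖ * weight p J n) atTop
        (𝓝 (‖(f k).coeff n - c n‖ * weight p J n)) :=
      ((tendsto_const_nhds.sub (hc n)).norm).mul_const _
    refine le_of_tendsto h1 ((eventually_ge_atTop N).mono fun l hl => ?_)
    have h2 := hN k hk l hl
    rw [dist_eq_norm] at h2
    have h3 := coeff_mul_weight_le (f k - f l) n
    rw [coeff_sub] at h3
    exact h3.trans h2.le
  have ht : Tendsto (fun n => ‖c n‖ * weight p J n) cofinite (𝓝 0) := by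
    rw [Metric.tendsto_nhds]
    intro ε hε
    obtain ⟨N, hN⟩ := hb (ε / 3) (by positivity)
    have h1 := Metric.tendsto_nhds.1 (f N).tendsto_coeff (ε / 3) (by positivity)
    refine h1.mono fun n hn => ?_
    have h0 := (weight_pos (p := p) J n).le
    rw [dist_zero_right, Real.norm_of_nonneg (by positivity)] at hn ⊢
    have h2 := hN N le_rfl n
    have h3 : ‖c n‖ ≤ ‖(f N).coeff n‖ + ‖(f N).coeff n - c n‖ := by
      have := norm_sub_le ((f N).coeff n) ((f N).coeff n - c n)
      rwa [sub_sub_cancel] at this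
    have h4 := mul_le_mul_of_nonneg_right h3 h0
    rw [add_mul] at h4
    linarith
  refine ⟨ofCoeff J c ht fun h n hn => ?_, ?_⟩
  · refine tendsto_nhds_unique (hc n) (tendsto_nhds_of_eventually_eq (Eventually.of_forall fun k => ?_))
    exact coeff_eq_zero _ h hn
  · rw [Metric.tendsto_atTop]
    intro ε hε
    obtain ⟨N, hN⟩ := hb (ε / 2) (by positivity)
    refine ⟨N, fun k hk => ?_⟩
    rw [dist_eq_norm]
    refine lt_of_le_of_lt (norm_le fun n => ?_) (half_lt_self hε)
    rw [coeff_sub]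
    exact hN k hk n

@[simp] theorem coeff_mono (n : ℤ) (a : A) (h : J.r = ⊤ → 0 ≤ n) :
    (mono (p := p) J n a h).coeff = Pi.single n a := rfl

theorem coeff_mono_mul (n : ℤ) (a : A) (h : J.r = ⊤ → 0 ≤ n) (f : IntervalRing p A J) (m : ℤ) :
    (mono J n a h * f).coeff m = a * f.coeff (m - n) := by
  rw [coeff_mul, convolve, tsum_eq_single n fun k hk => by simp [Pi.single_eq_of_ne hk]]
  simp

theorem coeff_mul_mono (n : ℤ) (a : A) (h : J.r = ⊤ → 0 ≤ n) (f : IntervalRing p A J) (m : ℤ) :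
    (f * mono J n a h).coeff m = f.coeff (m - n) * a := by
  rw [coeff_mul, convolve, tsum_eq_single (m - n) fun k hk => by
    rw [coeff_mono, Pi.single_eq_of_ne (by omega), mul_zero]]
  simp

theorem norm_mono_le (n : ℤ) (a : A) (h : J.r = ⊤ → 0 ≤ n) :
    ‖mono (p := p) J n a h‖ ≤ ‖a‖ * weight p J n := norm_le fun m => by
  rcases eq_or_ne m n with rfl | hm
  · simp
  · rw [coeff_mono, Pi.single_eq_of_ne hm, norm_zero, zero_mul]
    exact mul_nonneg (norm_nonneg _) (weight_pos J n).le

theorem mono_mul_mono (m n : ℤ) (a b : A) (hm : J.r = ⊤ → 0 ≤ m) (hn : J.r = ⊤ → 0 ≤ n) :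
    mono (p := p) J m a hm * mono J n b hn =
      mono J (m + n) (a * b) fun h => add_nonneg (hm h) (hn h) := by
  ext k
  rw [coeff_mono_mul, coeff_mono, coeff_mono]
  by_cases hk : k = m + n
  · subst hk
    simp
  · rw [Pi.single_eq_of_ne hk, Pi.single_eq_of_ne (by omega), mul_zero]

theorem mono_one_pow (n : ℤ) (h : J.r = ⊤ → 0 ≤ n) (i : ℕ) :
    mono (p := p) J n (1 : A) h ^ i = mono J (i * n) 1 fun ht => mul_nonneg (by simp) (h ht) := by
  induction i with
  | zero => ext k; simp
  | succ i ih =>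
    rw [pow_succ, ih, mono_mul_mono]
    ext k
    simp [add_mul]

theorem mono_one_comm (n : ℤ) (h : J.r = ⊤ → 0 ≤ n) (f : IntervalRing p A J) :
    mono J n 1 h * f = f * mono J n 1 h := by
  ext k
  rw [coeff_mono_mul, coeff_mul_mono, one_mul, mul_one]

theorem norm_restrict_le {J'' J' : ClosedInterval r₀} (h : J'' ≤ J') (f : IntervalRing p A J') :
    ‖(restrict (ClosedInterval.region_subset h) f : IntervalRing p A J'')‖ ≤ ‖f‖ := by
  refine norm_le fun n => ?_
  by_cases hn : 0 ≤ n ∨ J'.r ≠ ⊤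
  · exact (mul_le_mul_of_nonneg_left (weight_le_weight h hn) (norm_nonneg _)).trans
      (coeff_mul_weight_le f n)
  · push Not at hn
    have : (restrict (ClosedInterval.region_subset h) f : IntervalRing p A J'').coeff n = 0 :=
      coeff_eq_zero f hn.2 hn.1
    rw [this, norm_zero, zero_mul]
    exact norm_nonneg _

theorem continuous_restrict {J'' J' : ClosedInterval r₀} (h : J'' ≤ J') :
    Continuous (restrict (p := p) (A := A) (ClosedInterval.region_subset h)) :=
  AddMonoidHomClass.continuous_of_bound (restrict (ClosedInterval.region_subset h)) 1 fun f => by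
    rw [one_mul]
    exact norm_restrict_le h f

/-- Elements are approximated by their truncations, which are Laurent polynomials. -/
theorem exists_truncation (f : IntervalRing p A J) {ε : ℝ} (hε : 0 < ε) :
    ∃ F : Finset ℤ, ∀ n ∉ F, ‖f.coeff n‖ * weight p J n ≤ ε := by
  have h1 := Metric.tendsto_nhds.1 f.tendsto_coeff ε hε
  rw [eventually_cofinite] at h1
  refine ⟨h1.toFinset, fun n hn => ?_⟩
  simp only [Set.Finite.mem_toFinset, Set.mem_ofPred_eq, not_not] at hn
  rw [dist_zero_right] at hn
  exact (le_abs_self _).trans hn.le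

/-- A truncation is a Laurent polynomial. The common right end ensures that it has no negative
powers when the larger annulus contains `T = 0`. -/
theorem exists_restrict_near {J'' J' : ClosedInterval r₀} (h : J'' ≤ J') (hr : J''.r = J'.r)
    (f : IntervalRing p A J'') {ε : ℝ} (hε : 0 < ε) : ∃ g : IntervalRing p A J',
      dist (restrict (ClosedInterval.region_subset h) g : IntervalRing p A J'') f < ε := by
  classical
  obtain ⟨F, hF⟩ := exists_truncation f (half_pos hε)
  refine ⟨ofCoeff J' (fun n => if n ∈ F then f.coeff n else 0)
    (tendsto_of_finite F F.finite_toSet fun n hn => if_neg hn) fun ht n hn => ?_, ?_⟩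
  · rw [coeff_eq_zero f (hr.trans ht) hn, ite_self]
  · rw [dist_comm, dist_eq_norm]
    refine lt_of_le_of_lt (norm_le fun n => ?_) (half_lt_self hε)
    rw [coeff_sub]
    change ‖f.coeff n - (if n ∈ F then f.coeff n else 0)‖ * _ ≤ _
    split_ifs with hn
    · simpa using (half_pos hε).le
    · simpa using hF n hn

/-- If the larger annulus contains `T = 0`, negative powers of `T` are not available there. A
truncation becomes available after multiplication by `T ^ N`, and every large `N` works, so that one
`N` can serve finitely many functions. -/
theorem exists_restrict_mul_near {J'' J' : ClosedInterval r₀} (h : J'' ≤ J') (hr : J''.r ≠ ⊤)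
    (f : IntervalRing p A J'') {ε : ℝ} (hε : 0 < ε) :
    ∃ N₀ : ℕ, ∀ N ≥ N₀, ∃ g : IntervalRing p A J',
      dist (mono J'' (-N) 1 (fun ht => absurd ht hr) *
        restrict (ClosedInterval.region_subset h) g : IntervalRing p A J'') f < ε := by
  classical
  obtain ⟨F, hF⟩ := exists_truncation f (half_pos hε)
  obtain ⟨N₀, hN₀⟩ : ∃ N₀ : ℕ, ∀ n ∈ F, -(N₀ : ℤ) ≤ n := by
    refine ⟨F.sup fun n => n.natAbs, fun n hn => ?_⟩
    have := Finset.le_sup (f := fun n : ℤ => n.natAbs) hn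
    omega
  refine ⟨N₀, fun N hN => ⟨ofCoeff J' (fun n => if n - N ∈ F then f.coeff (n - N) else 0)
    (tendsto_of_finite (F.image fun n => n + (N : ℤ)) (Finset.finite_toSet _) fun n hn =>
      if_neg fun hc => hn ?_) fun ht n hn => if_neg fun hc => ?_, ?_⟩⟩
  · exact Finset.mem_coe.2 (Finset.mem_image.2 ⟨_, hc, by ring⟩)
  · have := hN₀ _ hc
    omega
  · rw [dist_comm, dist_eq_norm]
    refine lt_of_le_of_lt (norm_le fun n => ?_) (half_lt_self hε)
    rw [coeff_sub, Pi.sub_apply, coeff_mono_mul, one_mul]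
    change ‖f.coeff n - (if n - -(N : ℤ) - N ∈ F then f.coeff (n - -(N : ℤ) - N) else 0)‖ * _ ≤ _
    rw [show n - -(N : ℤ) - N = n by ring]
    split_ifs with hn
    · simpa using (half_pos hε).le
    · simpa using hF n hn

end Normed

/-! ### The structure of a normed `ℚ_[p]`-space. -/

section Scalars

variable {p : ℕ} [hp : Fact p.Prime] {A : Type*} [NormedRing A] [NormedAlgebra ℚ_[p] A]
  [IsUltrametricDist A] [CompleteSpace A] {r₀ : ℝ≥0∞} {J : ClosedInterval r₀}

noncomputable instance : SMul ℚ_[p] (IntervalRing p A J) :=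
  ⟨fun c f => ofCoeff J (fun n => c • f.coeff n) (by
    have h1 := f.tendsto_coeff.const_mul ‖c‖
    rw [mul_zero] at h1
    refine h1.congr fun n => ?_
    rw [norm_smul, mul_assoc]) fun h n hn => by rw [coeff_eq_zero f h hn, smul_zero]⟩

theorem coeff_smul (c : ℚ_[p]) (f : IntervalRing p A J) (n : ℤ) :
    (c • f).coeff n = c • f.coeff n := rfl

noncomputable instance : Module ℚ_[p] (IntervalRing p A J) where
  one_smul _ := AnRing.ext (funext fun _ => one_smul _ _)
  mul_smul _ _ _ := AnRing.ext (funext fun _ => mul_smul _ _ _)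
  smul_zero _ := AnRing.ext (funext fun _ => smul_zero _)
  smul_add _ _ _ := AnRing.ext (funext fun _ => smul_add _ _ _)
  add_smul _ _ _ := AnRing.ext (funext fun _ => add_smul _ _ _)
  zero_smul _ := AnRing.ext (funext fun _ => zero_smul _ _)

noncomputable instance : NormedSpace ℚ_[p] (IntervalRing p A J) where
  norm_smul_le c f := norm_le fun n => by
    rw [coeff_smul, norm_smul, mul_assoc]
    exact mul_le_mul_of_nonneg_left (coeff_mul_weight_le f n) (norm_nonneg _)

instance : IsScalarTower ℚ_[p] (IntervalRing p A J) (IntervalRing p A J) where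
  smul_assoc c f g := AnRing.ext <| funext fun n => by
    simp only [smul_eq_mul, coeff_mul, convolve, coeff_smul, smul_mul_assoc]
    exact tsum_const_smul'' c

end Scalars

end AnRing

/-! ### Restriction to a smaller annulus -/

theorem exists_forall_mul_pow_le {η : ℕ → ℝ} (hη : Tendsto η atTop (𝓝 0)) {q : ℝ} (hq : 0 ≤ q)
    (hq' : q < 1) {ε : ℝ} (hε : 0 < ε) : ∃ i₀, ∀ j k, i₀ ≤ j + k → η j * q ^ k ≤ ε := by
  obtain ⟨M, hM⟩ := hη.bddAbove_range
  have hM' : ∀ j, η j ≤ |M| := fun j => (hM ⟨j, rfl⟩).trans (le_abs_self M)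
  obtain ⟨j₀, hj₀⟩ := eventually_atTop.1 (hη.eventually_le_const hε)
  have h1 := (tendsto_pow_atTop_nhds_zero_of_lt_one hq hq').const_mul |M|
  rw [mul_zero] at h1
  obtain ⟨k₀, hk₀⟩ := eventually_atTop.1 (h1.eventually_le_const hε)
  refine ⟨j₀ + k₀, fun j k hjk => ?_⟩
  have hqk : 0 ≤ q ^ k := pow_nonneg hq k
  rcases le_or_gt j₀ j with hj | hj
  · exact (mul_le_mul_of_nonneg_right (hj₀ j hj) hqk).trans
      (mul_le_of_le_one_right hε.le (pow_le_one₀ hq hq'.le))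
  · exact (mul_le_mul_of_nonneg_right (hM' j) hqk).trans (hk₀ k (by omega))

/-- When the total is `0`, an initial sum is minus a tail, and the ultrametric inequality bounds the
tail. This gives a second estimate for the quotients in the division arguments below. -/
theorem norm_sum_range_le_of_hasSum_zero {A : Type*} [NormedAddCommGroup A] [IsUltrametricDist A]
    {g : ℕ → A} (hg : HasSum g 0) {B : ℝ} (hB : 0 ≤ B) {i : ℕ} (h : ∀ j, i ≤ j → ‖g j‖ ≤ B) :
    ‖∑ j ∈ Finset.range i, g j‖ ≤ B := by
  have h1 : Tendsto (fun N => ‖∑ j ∈ Finset.range N, g j - ∑ j ∈ Finset.range i, g j‖) atTop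
      (𝓝 ‖(0 : A) - ∑ j ∈ Finset.range i, g j‖) := (hg.tendsto_sum_nat.sub_const _).norm
  rw [zero_sub, norm_neg] at h1
  refine le_of_tendsto h1 ((eventually_ge_atTop i).mono fun N hN => ?_)
  rw [← Finset.sum_Ico_eq_sub _ hN]
  exact IsUltrametricDist.norm_sum_le_of_forall_le_of_nonneg hB fun j hj =>
    h j (Finset.mem_Ico.1 hj).1

theorem isNullSeq_of_forall_le {lam : ℝ} (hl : 0 < lam) {V : Type*} [SeminormedAddCommGroup V]
    {f : ℕ → V} (h : ∀ ε > 0, ∃ i₀, ∀ i ≥ i₀, ‖f i‖ * lam ^ i ≤ ε) : IsNullSeq lam f := by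
  rw [IsNullSeq, Metric.tendsto_atTop]
  intro ε hε
  obtain ⟨i₀, hi₀⟩ := h (ε / 2) (half_pos hε)
  refine ⟨i₀, fun i hi => ?_⟩
  rw [dist_zero_right, Real.norm_of_nonneg (by positivity)]
  exact (hi₀ i hi).trans_lt (half_lt_self hε)

namespace AnRing

variable {p : ℕ} [hp : Fact p.Prime] {A : Type*} [NormedRing A] [IsUltrametricDist A]
  [CompleteSpace A] {r₀ : ℝ≥0∞} {J : ClosedInterval r₀}

theorem coeff_mul_zpow_s_le (f : IntervalRing p A J) (n : ℤ) :
    ‖f.coeff n‖ * absT p J.s ^ n ≤ ‖f‖ :=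
  (mul_le_mul_of_nonneg_left (le_max_left _ _) (norm_nonneg _)).trans (coeff_mul_weight_le f n)

theorem coeff_mul_zpow_upper_le (f : IntervalRing p A J) (n : ℤ) :
    ‖f.coeff n‖ * absT p J.upper ^ n ≤ ‖f‖ :=
  (mul_le_mul_of_nonneg_left (le_max_right _ _) (norm_nonneg _)).trans (coeff_mul_weight_le f n)

theorem tendsto_sum_shift (f : ℕ → IntervalRing p A J) (e : ℕ → ℤ) (s : Finset ℕ) :
    Tendsto (fun n => ‖∑ j ∈ s, (f j).coeff (n + e j)‖ * weight p J n) cofinite (𝓝 0) := by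
  have h1 : ∀ j, Tendsto (fun n => ‖(f j).coeff (n + e j)‖ * weight p J (n + e j) *
      weight p J (-e j)) cofinite (𝓝 0) := fun j => by
    have := ((f j).tendsto_coeff.comp (add_left_injective (e j)).tendsto_cofinite).mul_const
      (weight p J (-e j))
    simpa using this
  have h2 := tendsto_finsetSum s fun j _ => h1 j
  rw [Finset.sum_const_zero] at h2
  refine squeeze_zero (fun n => mul_nonneg (norm_nonneg _) (weight_pos J n).le) (fun n => ?_) h2
  refine (mul_le_mul_of_nonneg_right (norm_sum_le _ _) (weight_pos J n).le).trans ?_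
  rw [Finset.sum_mul]
  refine Finset.sum_le_sum fun j _ => ?_
  rw [mul_assoc]
  refine mul_le_mul_of_nonneg_left ?_ (norm_nonneg _)
  have := weight_add_le (p := p) J (n + e j) (-e j)
  rwa [add_neg_cancel_right] at this

theorem summable_of_norm_pow_le {J'' J' : ClosedInterval r₀} (h : J'' ≤ J') {τ : IntervalRing p A J''}
    {lam C : ℝ} (hτ : ∀ i, ‖τ ^ i‖ ≤ C * lam ^ i) (f : ℕ → IntervalRing p A J')
    (hf : IsNullSeq lam f) :
    Summable fun i => restrict (ClosedInterval.region_subset h) (f i) * τ ^ i := by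
  refine NonarchimedeanAddGroup.summable_of_tendsto_cofinite_zero ?_
  rw [Nat.cofinite_eq_atTop]
  have h1 := Tendsto.const_mul C hf
  rw [mul_zero] at h1
  refine squeeze_zero_norm (fun i => ?_) h1
  calc _ ≤ ‖(restrict (ClosedInterval.region_subset h) (f i) : IntervalRing p A J'')‖ * ‖τ ^ i‖ :=
        norm_mul_le _ _
    _ ≤ ‖f i‖ * (C * lam ^ i) :=
        mul_le_mul (norm_restrict_le h _) (hτ i) (norm_nonneg _) (norm_nonneg _)
    _ = _ := by ring

variable (p A) in
/-- The coordinate `T`. -/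
noncomputable abbrev var (J : ClosedInterval r₀) : IntervalRing p A J :=
  mono J 1 1 fun _ => zero_le_one

variable (p A) in
/-- The inverse of the coordinate `T` on an annulus which does not contain `T = 0`. -/
noncomputable abbrev varInv (J : ClosedInterval r₀) (h : J.r ≠ ⊤) : IntervalRing p A J :=
  mono J (-1) 1 fun h' => absurd h' h

theorem coeff_var_mul (f : IntervalRing p A J) (n : ℤ) :
    (var p A J * f).coeff n = f.coeff (n - 1) := by
  rw [coeff_mono_mul, one_mul]

theorem coeff_mul_var_pow (f : IntervalRing p A J) (i : ℕ) (n : ℤ) :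
    (f * var p A J ^ i).coeff n = f.coeff (n - i) := by
  rw [mono_one_pow, coeff_mul_mono, mul_one, mul_one]

theorem coeff_mul_varInv_pow (hJ : J.r ≠ ⊤) (f : IntervalRing p A J) (i : ℕ) (n : ℤ) :
    (f * varInv p A J hJ ^ i).coeff n = f.coeff (n + i) := by
  rw [mono_one_pow, coeff_mul_mono, mul_one, mul_neg_one, sub_neg_eq_add]

/-- Enlarging `s` allows more series in `T`, so the new ring consists of series in `X = T` over the
old one, and its relations are the multiples of `X - T`. The work lies in the convergence of the
quotient by `X - T`. -/
theorem isExpansion_of_s_lt {J'' J' : ClosedInterval r₀} (h : J'' ≤ J') (hr : J''.r = J'.r)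
    (hs : J'.s < J''.s) :
    IsExpansion (restrict (p := p) (A := A) (ClosedInterval.region_subset h)) (var p A J'')
      (absT p J''.s) (-var p A J') 1 := by
  have hρ : 0 < absT p J''.s := absT_pos _
  have hρs : 0 < absT p J'.s := absT_pos _
  have hlt : absT p J''.s < absT p J'.s := absT_lt hs J''.s_ne_top
  have hsum := summable_of_norm_pow_le (p := p) (A := A) h (τ := var p A J'') (C := ‖(1 : A)‖)
    fun i => by
      rw [mono_one_pow]
      refine (norm_mono_le _ _ _).trans_eq ?_
      rw [weight_of_nonneg _ (by positivity), mul_one, zpow_natCast]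
  refine ⟨hρ, mono_one_comm _ _, ?_, hsum, fun a => ?_, fun f hf H => ?_⟩
  · rw [map_neg, map_one, one_mul, neg_add_eq_zero]
    rfl
  -- All exponents `n ≤ 0` go into `f 0`, which converges on `J'` because the right ends agree. Each
  -- positive power contributes one constant coefficient.
  · let f : ℕ → IntervalRing p A J' := fun i => Nat.casesOn i
      (ofCoeff J' (fun n => if n ≤ 0 then a.coeff n else 0)
        (squeeze_zero (fun n => mul_nonneg (norm_nonneg _) (weight_pos J' n).le) (fun n => by
          split_ifs with hn
          · by_cases hn0 : J'.r = ⊤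
            · rcases hn.eq_or_lt with rfl | hn
              · simp [weight_zero]
              · simp [coeff_eq_zero a (hr.trans hn0) hn]
            · rw [weight_of_nonpos _ hn, weight_of_nonpos _ hn, ClosedInterval.upper_eq hn0,
                ClosedInterval.upper_eq (hr ▸ hn0), hr]
          · rw [norm_zero, zero_mul]
            exact mul_nonneg (norm_nonneg _) (weight_pos J'' n).le) a.tendsto_coeff)
        fun ht n hn => by rw [coeff_eq_zero a (hr.trans ht) hn, ite_self])
      fun i => mono J' 0 (a.coeff (i + 1)) fun _ => le_rfl
    have hf : IsNullSeq (absT p J''.s) f := by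
      rw [← IsNullSeq.succ_iff hρ]
      have h1 := (a.tendsto_coeff.comp (Nat.cast_injective (R := ℤ)).tendsto_cofinite)
      rw [Nat.cofinite_eq_atTop] at h1
      have h2 : IsNullSeq (absT p J''.s) fun i : ℕ => a.coeff i := by
        refine h1.congr fun i => ?_
        simp [weight_of_nonneg]
      refine ((IsNullSeq.succ_iff hρ).2 h2).of_le hρ (C := 1) fun i => ?_
      refine (norm_mono_le _ _ _).trans_eq ?_
      simp [weight_zero]
    obtain ⟨t, ht⟩ := hsum f hf
    refine ⟨f, hf, ?_⟩
    convert ht using 1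
    ext n
    refine HasSum.unique (f := fun i : ℕ => (f i).coeff (n - i)) ?_
      (hasSum_of_eq (hasSum_coeff ht n) (fun i => by rw [coeff_mul_var_pow]; rfl) rfl)
    rcases le_or_gt n 0 with hn | hn
    · refine hasSum_of_eq (hasSum_single (f := fun i : ℕ => (f i).coeff (n - i)) 0 fun i hi => ?_)
        (fun _ => rfl) ?_
      · obtain ⟨i, rfl⟩ := Nat.exists_eq_succ_of_ne_zero hi
        exact Pi.single_eq_of_ne (by push_cast; omega) _
      · change (if n - ((0 : ℕ) : ℤ) ≤ 0 then a.coeff (n - ((0 : ℕ) : ℤ)) else 0) = _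
        simp [hn]
    · obtain ⟨k, rfl⟩ : ∃ k : ℕ, n = k + 1 := ⟨(n - 1).toNat, by omega⟩
      refine hasSum_of_eq (hasSum_single (f := fun i : ℕ => (f i).coeff ((k : ℤ) + 1 - i)) (k + 1)
        fun i hi => ?_) (fun _ => rfl) ?_
      · cases i with
        | zero =>
          change (if (k : ℤ) + 1 - ((0 : ℕ) : ℤ) ≤ 0 then a.coeff ((k : ℤ) + 1 - ((0 : ℕ) : ℤ))
            else 0) = 0
          exact if_neg (by push_cast; omega)
        | succ i => exact Pi.single_eq_of_ne (by push_cast; omega) _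
      · change (Pi.single 0 (a.coeff (k + 1)) : ℤ → A) _ = _
        simp
  · have Hc : ∀ n, HasSum (fun i : ℕ => (f i).coeff (n - i)) 0 := fun n =>
      hasSum_of_eq (hasSum_coeff H n) (fun i => by rw [coeff_mul_var_pow]; rfl) rfl
    have Hc' : ∀ (i : ℕ) n, HasSum (fun j : ℕ => (f j).coeff (n + (1 + i - j))) 0 := fun i n =>
      hasSum_of_eq (Hc (n + 1 + i)) (fun j => by congr 1; ring) rfl
    -- Division by `X - T` gives `c i = -∑_{j ≤ i} f j T ^ (j - i - 1)`, written on coefficients to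
    -- avoid inverting `T`. As the series has value `0`, this is also the tail `∑_{j > i} f j T ^ (j
    -- - i - 1)`, which has no negative powers if `r = ∞`.
    let c : ℕ → IntervalRing p A J' := fun i => ofCoeff J'
      (fun n => -∑ j ∈ Finset.range (i + 1), (f j).coeff (n + (1 + i - j)))
      (by simpa using tendsto_sum_shift f (fun j => 1 + i - j) (Finset.range (i + 1)))
      fun ht n hn => by
        rw [neg_eq_zero, ← norm_le_zero_iff]
        refine norm_sum_range_le_of_hasSum_zero (Hc' i n) le_rfl fun j hj => ?_
        rw [coeff_eq_zero _ ht (by omega), norm_zero]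
    have hcc : ∀ i n, (c i).coeff n = -∑ j ∈ Finset.range (i + 1), (f j).coeff (n + (1 + i - j)) :=
      fun _ _ => rfl
    refine ⟨c, isNullSeq_of_forall_le hρ fun ε hε => ?_, ?_⟩
    · obtain ⟨i₁, hi₁⟩ := exists_forall_mul_pow_le hf (q := absT p J''.s / absT p J'.s)
        (by positivity) ((div_lt_one hρs).2 hlt) (ε := ε * absT p J'.s) (by positivity)
      obtain ⟨i₂, hi₂⟩ := eventually_atTop.1
        (Tendsto.eventually_le_const (u := ε * absT p J''.s) (by positivity) hf)
      refine ⟨max i₁ i₂, fun i hi => ?_⟩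
      rw [← le_div_iff₀ (by positivity)]
      refine norm_le fun n => ?_
      rw [hcc, norm_neg, ← le_div_iff₀ (weight_pos J' n)]
      have hB : 0 ≤ ε / absT p J''.s ^ i / weight p J' n :=
        div_nonneg (by positivity) (weight_pos J' n).le
      -- The weight at `n ≥ 0` is taken at `J'.s`, where `|T|` exceeds `|T|` at `J''.s`, so the
      -- finite sum gains a geometric factor. The weight at `n < 0` is taken at the right end, where
      -- the tail is the convenient form.
      by_cases hn : 0 ≤ n
      · refine IsUltrametricDist.norm_sum_le_of_forall_le_of_nonneg hB fun j hj => ?_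
        obtain ⟨k, rfl⟩ := Nat.exists_eq_add_of_le (Finset.mem_range_succ_iff.1 hj)
        rw [weight_of_nonneg _ hn, le_div_iff₀ (by positivity), le_div_iff₀ (by positivity)]
        have e1 := coeff_mul_zpow_s_le (f j) (n + (1 + k : ℕ))
        have e2 := hi₁ j k ((le_max_left _ _).trans hi)
        rw [show n + (1 + ((j + k : ℕ) : ℤ) - j) = n + (1 + k : ℕ) by push_cast; ring]
        rw [zpow_add₀ hρs.ne', zpow_natCast, pow_add, pow_one] at e1
        rw [div_pow, mul_div_assoc', div_le_iff₀ (by positivity)] at e2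
        refine le_of_mul_le_mul_right ?_ (show 0 < absT p J'.s * absT p J'.s ^ k by positivity)
        calc _ = (‖(f j).coeff (n + (1 + k : ℕ))‖ * (absT p J'.s ^ n *
              (absT p J'.s * absT p J'.s ^ k))) * (absT p J''.s ^ j * absT p J''.s ^ k) := by
              rw [pow_add]; ring
          _ ≤ ‖f j‖ * (absT p J''.s ^ j * absT p J''.s ^ k) :=
              mul_le_mul_of_nonneg_right e1 (by positivity)
          _ = ‖f j‖ * absT p J''.s ^ j * absT p J''.s ^ k := by ring
          _ ≤ _ := e2
          _ = _ := by ring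
      · push Not at hn
        refine norm_sum_range_le_of_hasSum_zero (Hc' i n) hB fun j hj => ?_
        by_cases ht : J'.r = ⊤
        · rw [coeff_eq_zero _ ht (by omega), norm_zero]
          exact hB
        obtain ⟨k, rfl⟩ := Nat.exists_eq_add_of_le hj
        have hρu : 0 < absT p J'.upper := absT_pos _
        have hle : absT p J'.upper ≤ absT p J''.s := by
          rw [ClosedInterval.upper_eq ht]
          exact absT_le (hr ▸ J''.s_le_r) ht
        rw [weight_of_nonpos _ hn.le, le_div_iff₀ (by positivity), le_div_iff₀ (by positivity)]
        have e1 := coeff_mul_zpow_upper_le (f (i + 1 + k)) (n - (k : ℕ))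
        have e2 := hi₂ (i + 1 + k) ((le_max_right _ _).trans (hi.trans (by omega)))
        rw [show n + (1 + (i : ℤ) - ((i + 1 + k : ℕ) : ℤ)) = n - (k : ℕ) by push_cast; ring]
        rw [zpow_sub₀ hρu.ne', zpow_natCast, mul_div_assoc', div_le_iff₀ (by positivity)] at e1
        refine le_of_mul_le_mul_right ?_ hρ
        calc _ ≤ ‖f (i + 1 + k)‖ * absT p J''.s ^ k * absT p J''.s ^ i * absT p J''.s := by
              refine mul_le_mul_of_nonneg_right (mul_le_mul_of_nonneg_right (e1.trans ?_)
                (by positivity)) hρ.le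
              gcongr
          _ = ‖f (i + 1 + k)‖ * absT p J''.s ^ (i + 1 + k) := by ring
          _ ≤ _ := e2
    · funext i
      ext n
      cases i with
      | zero =>
        change _ = ((-var p A J') * c 0).coeff n
        rw [neg_mul, coeff_neg, Pi.neg_apply, coeff_var_mul, hcc]
        simp
      | succ i =>
        change _ = ((-var p A J') * c (i + 1) + 1 * c i).coeff n
        rw [neg_mul, one_mul, coeff_add, Pi.add_apply, coeff_neg, Pi.neg_apply, coeff_var_mul, hcc,
          hcc, Finset.sum_range_succ _ (i + 1), neg_neg]
        have e1 : ∀ j : ℕ, n - 1 + (1 + ((i + 1 : ℕ) : ℤ) - j) = n + (1 + i - j) := fun j => by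
          push_cast; ring
        simp only [e1]
        rw [show n + (1 + (i : ℤ) - ((i + 1 : ℕ) : ℤ)) = n by push_cast; ring]
        abel

/-- Lowering `r` allows more series in `X = T⁻¹`, with relations the multiples of `1 - T X`. This
form makes sense also when the larger annulus contains `T = 0` and `T` is not invertible there. -/
theorem isExpansion_of_r_lt {J'' J' : ClosedInterval r₀} (h : J'' ≤ J') (hs : J''.s = J'.s)
    (hr : J''.r < J'.r) :
    IsExpansion (restrict (p := p) (A := A) (ClosedInterval.region_subset h))
      (varInv p A J'' hr.ne_top) (absT p J''.r)⁻¹ 1 (-var p A J') := by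
  have hrt := hr.ne_top
  have hρ : 0 < absT p J''.r := absT_pos _
  have hl : 0 < (absT p J''.r)⁻¹ := inv_pos.2 hρ
  have hρs : 0 < absT p J'.s := absT_pos _
  have hwt : ∀ i : ℕ, weight p J'' (-i) = (absT p J''.r)⁻¹ ^ i := fun i => by
    rw [weight_of_nonpos _ (by simp), ClosedInterval.upper_eq hrt, zpow_neg, zpow_natCast, inv_pow]
  have hsum := summable_of_norm_pow_le (p := p) (A := A) h (τ := varInv p A J'' hrt)
    (C := ‖(1 : A)‖) fun i => by
      rw [mono_one_pow]
      refine (norm_mono_le _ _ _).trans_eq ?_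
      rw [mul_neg_one, hwt]
  refine ⟨hl, mono_one_comm _ _, ?_, hsum, fun a => ?_, fun f hf H => ?_⟩
  · rw [map_neg, map_one, neg_mul, ← sub_eq_add_neg, sub_eq_zero]
    have : restrict (ClosedInterval.region_subset h) (var p A J') = var p A J'' := rfl
    rw [this, mono_mul_mono]
    ext n
    simp
  · let f : ℕ → IntervalRing p A J' := fun i => Nat.casesOn i
      (ofCoeff J' (fun n => if 0 ≤ n then a.coeff n else 0)
        (squeeze_zero (fun n => mul_nonneg (norm_nonneg _) (weight_pos J' n).le) (fun n => by
          split_ifs with hn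
          · rw [weight_of_nonneg _ hn, weight_of_nonneg _ hn, hs]
          · rw [norm_zero, zero_mul]
            exact mul_nonneg (norm_nonneg _) (weight_pos J'' n).le) a.tendsto_coeff)
        fun ht n hn => if_neg (by omega))
      fun i => mono J' 0 (a.coeff (-(i + 1))) fun _ => le_rfl
    have hf : IsNullSeq (absT p J''.r)⁻¹ f := by
      rw [← IsNullSeq.succ_iff hl]
      have h1 := (a.tendsto_coeff.comp
        (neg_injective.comp (Nat.cast_injective (R := ℤ))).tendsto_cofinite)
      rw [Nat.cofinite_eq_atTop] at h1
      have h2 : IsNullSeq (absT p J''.r)⁻¹ fun i : ℕ => a.coeff (-i) := by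
        refine h1.congr fun i => ?_
        simp only [Function.comp, hwt]
      refine ((IsNullSeq.succ_iff hl).2 h2).of_le hl (C := 1) fun i => ?_
      refine (norm_mono_le _ _ _).trans_eq ?_
      simp [weight_zero]
    obtain ⟨t, ht⟩ := hsum f hf
    refine ⟨f, hf, ?_⟩
    convert ht using 1
    ext n
    refine HasSum.unique (f := fun i : ℕ => (f i).coeff (n + i)) ?_
      (hasSum_of_eq (hasSum_coeff ht n) (fun i => by rw [coeff_mul_varInv_pow]; rfl) rfl)
    rcases le_or_gt 0 n with hn | hn
    · refine hasSum_of_eq (hasSum_single (f := fun i : ℕ => (f i).coeff (n + i)) 0 fun i hi => ?_)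
        (fun _ => rfl) ?_
      · obtain ⟨i, rfl⟩ := Nat.exists_eq_succ_of_ne_zero hi
        exact Pi.single_eq_of_ne (by push_cast; omega) _
      · change (if 0 ≤ n + ((0 : ℕ) : ℤ) then a.coeff (n + ((0 : ℕ) : ℤ)) else 0) = _
        simp [hn]
    · obtain ⟨k, rfl⟩ : ∃ k : ℕ, n = -(k + 1) := ⟨(-n - 1).toNat, by omega⟩
      refine hasSum_of_eq (hasSum_single (f := fun i : ℕ => (f i).coeff (-((k : ℤ) + 1) + i)) (k + 1)
        fun i hi => ?_) (fun _ => rfl) ?_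
      · cases i with
        | zero =>
          change (if 0 ≤ -((k : ℤ) + 1) + ((0 : ℕ) : ℤ) then
            a.coeff (-((k : ℤ) + 1) + ((0 : ℕ) : ℤ)) else 0) = 0
          exact if_neg (by push_cast; omega)
        | succ i => exact Pi.single_eq_of_ne (by push_cast; omega) _
      · change (Pi.single 0 (a.coeff (-((k : ℤ) + 1))) : ℤ → A) _ = _
        simp
  · have Hc : ∀ n, HasSum (fun i : ℕ => (f i).coeff (n + i)) 0 := fun n =>
      hasSum_of_eq (hasSum_coeff H n) (fun i => by rw [coeff_mul_varInv_pow]; rfl) rfl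
    have Hc' : ∀ (i : ℕ) n, HasSum (fun j : ℕ => (f j).coeff (n + (j - i))) 0 := fun i n =>
      hasSum_of_eq (Hc (n - i)) (fun j => by congr 1; ring) rfl
    -- Division by `1 - T X`, whose constant term is `1`: the quotient is `c i = ∑_{j ≤ i} T ^ (i -
    -- j) f j`.
    let c : ℕ → IntervalRing p A J' := fun i => Nat.rec (f 0) (fun i d => f (i + 1) + var p A J' * d) i
    have hc0 : c 0 = f 0 := rfl
    have hcs : ∀ i, c (i + 1) = f (i + 1) + var p A J' * c i := fun _ => rfl
    have hcc : ∀ i n, (c i).coeff n = ∑ j ∈ Finset.range (i + 1), (f j).coeff (n + (j - i)) := by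
      intro i
      induction i with
      | zero => intro n; simp [hc0]
      | succ i ih =>
        intro n
        rw [hcs, coeff_add, Pi.add_apply, coeff_var_mul, ih, Finset.sum_range_succ _ (i + 1),
          sub_self, add_zero, add_comm]
        congr 1
        refine Finset.sum_congr rfl fun j _ => ?_
        congr 1
        push_cast
        ring
    refine ⟨c, isNullSeq_of_forall_le hl fun ε hε => ?_, ?_⟩
    · obtain ⟨i₁, hi₁⟩ : ∃ i₁, J'.r ≠ ⊤ → ∀ j k, i₁ ≤ j + k →
          ‖f j‖ * (absT p J''.r)⁻¹ ^ j * (absT p J'.r / absT p J''.r) ^ k ≤ ε := by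
        by_cases ht : J'.r = ⊤
        · exact ⟨0, fun h => absurd ht h⟩
        · have hρu : 0 < absT p J'.r := absT_pos _
          obtain ⟨i₁, hi₁⟩ := exists_forall_mul_pow_le hf (q := absT p J'.r / absT p J''.r)
            (by positivity) ((div_lt_one hρ).2 (absT_lt hr ht)) hε
          exact ⟨i₁, fun _ => hi₁⟩
      obtain ⟨i₂, hi₂⟩ := eventually_atTop.1 (Tendsto.eventually_le_const hε hf)
      refine ⟨max i₁ i₂, fun i hi => ?_⟩
      rw [← le_div_iff₀ (by positivity)]
      refine norm_le fun n => ?_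
      rw [hcc, ← le_div_iff₀ (weight_pos J' n)]
      have hB : 0 ≤ ε / (absT p J''.r)⁻¹ ^ i / weight p J' n :=
        div_nonneg (by positivity) (weight_pos J' n).le
      -- The roles are exchanged: at `n ≥ 0` the tail is estimated at the left end, and at `n < 0`
      -- the finite sum gains a geometric factor at the right end.
      by_cases hn : 0 ≤ n
      · refine norm_sum_range_le_of_hasSum_zero (Hc' i n) hB fun j hj => ?_
        obtain ⟨k, rfl⟩ := Nat.exists_eq_add_of_le ((Nat.le_succ i).trans hj)
        have hle : absT p J''.r ≤ absT p J'.s := absT_le (hs ▸ J''.s_le_r) hrt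
        rw [weight_of_nonneg _ hn, le_div_iff₀ (by positivity), le_div_iff₀ (by positivity)]
        have e1 := coeff_mul_zpow_s_le (f (i + k)) (n + (k : ℕ))
        have e2 := hi₂ (i + k) ((le_max_right _ _).trans (hi.trans (by omega)))
        rw [show n + (((i + k : ℕ) : ℤ) - i) = n + (k : ℕ) by push_cast; ring]
        rw [zpow_add₀ hρs.ne', zpow_natCast] at e1
        refine le_trans ?_ e2
        calc _ = ‖(f (i + k)).coeff (n + (k : ℕ))‖ * (absT p J'.s ^ n * absT p J''.r ^ k) *
                (absT p J''.r)⁻¹ ^ (i + k) := by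
              rw [pow_add, inv_pow _ k]
              field_simp
          _ ≤ ‖(f (i + k)).coeff (n + (k : ℕ))‖ * (absT p J'.s ^ n * absT p J'.s ^ k) *
                (absT p J''.r)⁻¹ ^ (i + k) := by gcongr
          _ ≤ _ := by gcongr
      · push Not at hn
        refine IsUltrametricDist.norm_sum_le_of_forall_le_of_nonneg hB fun j hj => ?_
        obtain ⟨k, rfl⟩ := Nat.exists_eq_add_of_le (Finset.mem_range_succ_iff.1 hj)
        by_cases ht : J'.r = ⊤
        · rw [coeff_eq_zero _ ht (by omega), norm_zero]
          exact hB
        have hρu : 0 < absT p J'.r := absT_pos _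
        rw [weight_of_nonpos _ hn.le, ClosedInterval.upper_eq ht, le_div_iff₀ (by positivity),
          le_div_iff₀ (by positivity)]
        have e1 := coeff_mul_zpow_upper_le (f j) (n - (k : ℕ))
        have e2 := hi₁ ht j k ((le_max_left _ _).trans hi)
        rw [show n + ((j : ℤ) - ((j + k : ℕ) : ℤ)) = n - (k : ℕ) by push_cast; ring]
        rw [ClosedInterval.upper_eq ht, zpow_sub₀ hρu.ne', zpow_natCast, mul_div_assoc',
          div_le_iff₀ (by positivity)] at e1
        refine le_trans ?_ e2
        calc _ ≤ ‖f j‖ * absT p J'.r ^ k * (absT p J''.r)⁻¹ ^ (j + k) := by gcongr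
          _ = _ := by rw [pow_add, div_pow, inv_pow _ k]; field_simp
    · funext i
      cases i with
      | zero =>
        change _ = 1 * c 0
        rw [one_mul, hc0]
      | succ i =>
        change _ = 1 * c (i + 1) + -var p A J' * c i
        rw [hcs]
        noncomm_ring

variable [NormedAlgebra ℚ_[p] A] [∀ J : ClosedInterval r₀, IsNoetherianRing (IntervalRing p A J)]

/-- Restriction factors through `[J''.s, J'.r]`, so that only one end moves at a time. -/
theorem flatHom_restrict {J'' J' : ClosedInterval r₀} (h : J'' ≤ J') :
    FlatHom (restrict (p := p) (A := A) (ClosedInterval.region_subset h)) := by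
  have hid : ∀ (J : ClosedInterval r₀) (h : J ≤ J),
      FlatHom (restrict (p := p) (A := A) (ClosedInterval.region_subset h)) :=
    fun J h m n v a ha => Submodule.subset_span ⟨a, ha, rfl⟩
  let I : ClosedInterval r₀ := ⟨J''.s, J'.r, J''.s_pos, J''.s_ne_top, J''.s_le_r.trans h.2, J'.r_le,
    J''.s_rational, J'.r_rational⟩
  have h1 : J'' ≤ I := ⟨le_rfl, h.2⟩
  have h2 : I ≤ J' := ⟨h.1, le_rfl⟩
  have f1 : FlatHom (restrict (p := p) (A := A) (ClosedInterval.region_subset h1)) := by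
    rcases h1.2.eq_or_lt with h3 | h3
    · have : J'' = I := by
        cases J''
        simp only [I] at h3 ⊢
        congr
      revert h1
      rw [← this]
      exact hid J''
    · exact (isExpansion_of_r_lt h1 rfl h3).flat ℚ_[p] fun n K b hb =>
        mem_of_linearMulSeq_one_mem _ K b hb
  have f2 : FlatHom (restrict (p := p) (A := A) (ClosedInterval.region_subset h2)) := by
    rcases h2.1.eq_or_lt with h3 | h3
    · have : J' = I := by
        cases J'
        simp only [I] at h3 ⊢
        congr
      revert h2
      rw [← this]
      exact hid J'
    · exact (isExpansion_of_s_lt h2 rfl h3).flat ℚ_[p] fun n K b hb =>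
        mem_of_linearMulSeq_neg_mem (mono_one_comm _ _) K b hb
  exact f1.comp f2

/-- A vector which lies in a submodule over two annuli lies in it over their union. -/
theorem mem_of_mem_span_restrict {J J₁ J₂ : ClosedInterval r₀} (h₁ : J₁ ≤ J) (h₂ : J₂ ≤ J)
    (hs : J₁.s = J.s) (hr : J₂.r = J.r) (h12 : J₁.r = J₂.s) {n : ℕ}
    (K : Submodule (IntervalRing p A J) (Fin n → IntervalRing p A J)) (x : Fin n → IntervalRing p A J)
    (hx₁ : mapVec (restrict (ClosedInterval.region_subset h₁)) x ∈ Submodule.span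
      (IntervalRing p A J₁) (mapVec (restrict (ClosedInterval.region_subset h₁)) ''
        (K : Set (Fin n → IntervalRing p A J))))
    (hx₂ : mapVec (restrict (ClosedInterval.region_subset h₂)) x ∈ Submodule.span
      (IntervalRing p A J₂) (mapVec (restrict (ClosedInterval.region_subset h₂)) ''
        (K : Set (Fin n → IntervalRing p A J)))) : x ∈ K := by
  have hself : ∀ (I : ClosedInterval r₀) (h : I ≤ J), I = J →
      mapVec (restrict (ClosedInterval.region_subset h)) x ∈ Submodule.span
      (IntervalRing p A I) (mapVec (restrict (ClosedInterval.region_subset h)) ''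
        (K : Set (Fin n → IntervalRing p A J))) → x ∈ K := by
    rintro I h rfl hx
    have : Submodule.span (IntervalRing p A I) (mapVec (restrict (ClosedInterval.region_subset h)) ''
        (K : Set (Fin n → IntervalRing p A I))) ≤ K := by
      rw [Submodule.span_le]
      rintro _ ⟨k, hk, rfl⟩
      exact hk
    exact this hx
  rcases h₁.2.eq_or_lt with h3 | h3
  · refine hself J₁ h₁ ?_ hx₁
    cases J
    cases J₁
    simp only at hs h3
    subst hs h3
    rfl
  rcases h₂.1.eq_or_lt with h4 | h4
  · refine hself J₂ h₂ ?_ hx₂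
    cases J
    cases J₂
    simp only at hr h4
    subst hr h4
    rfl
  have E₁ := isExpansion_of_r_lt (p := p) (A := A) h₁ hs h3
  have E₂ := isExpansion_of_s_lt (p := p) (A := A) h₂ hr h4
  -- The two annuli meet at one radius; this is what makes the growth rates of the two expansions
  -- inverse to each other.
  rw [← h12] at E₂
  exact mem_of_mem_span_of_mem_span ℚ_[p] (mono_one_comm _ _) E₁ E₂ K x hx₁ hx₂

end AnRing

/-! ### Right exactness of extension of scalars -/

section ExtendScalars

variable {R S : Type*} [Ring R] [Ring S] {φ : R →+* S} {M N : Type*} [AddCommGroup M] [Module R M]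
  [AddCommGroup N] [Module S N]

theorem mapVec_add {ι : Type*} (b c : ι → R) : mapVec φ (b + c) = mapVec φ b + mapVec φ c :=
  funext fun _ => map_add φ _ _

theorem mapVec_sub {ι : Type*} (b c : ι → R) : mapVec φ (b - c) = mapVec φ b - mapVec φ c :=
  funext fun _ => map_sub φ _ _

theorem mapVec_smul {ι : Type*} (r : R) (b : ι → R) : mapVec φ (r • b) = φ r • mapVec φ b :=
  funext fun _ => map_mul φ _ _

theorem exists_sum_eq_of_span_eq_top {ι : Type*} [Fintype ι] {e : ι → M}
    (he : Submodule.span R (Set.range e) = ⊤) (x : M) : ∃ b : ι → R, ∑ i, b i • e i = x := by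
  have : x ∈ Submodule.span R (Set.range e) := he ▸ Submodule.mem_top
  rw [← Fintype.range_linearCombination] at this
  obtain ⟨b, hb⟩ := this
  exact ⟨b, by rw [← hb, Fintype.linearCombination_apply]⟩

theorem map_sum_smul {ι : Type*} (s : Finset ι) (g : M →ₛₗ[φ] N) (b : ι → R) (e : ι → M) :
    g (∑ i ∈ s, b i • e i) = ∑ i ∈ s, mapVec φ b i • g (e i) := by
  rw [map_sum]
  exact Finset.sum_congr rfl fun i _ => map_smulₛₗ g _ _

theorem ExtendScalars.lift_mk_single (g : M →ₛₗ[φ] N) (m : M) (s : S) :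
    ExtendScalars.lift φ g (Submodule.Quotient.mk (Finsupp.single m s)) = s • g m :=
  (Submodule.liftQ_apply _ _ _).trans (by simp)

variable (φ M) in
/-- The map `m ↦ 1 ⊗ m`. -/
noncomputable def ExtendScalars.incl : M →ₛₗ[φ] ExtendScalars φ M where
  toFun m := Submodule.Quotient.mk (Finsupp.single m 1)
  map_add' m m' := by
    rw [← Submodule.Quotient.mk_add, Submodule.Quotient.eq, ← sub_sub]
    exact Submodule.subset_span (Or.inl ⟨m, m', rfl⟩)
  map_smul' r m := by
    rw [← Submodule.Quotient.mk_smul, Submodule.Quotient.eq, Finsupp.smul_single, smul_eq_mul,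
      mul_one]
    exact Submodule.subset_span (Or.inr ⟨r, m, rfl⟩)

theorem ExtendScalars.lift_incl (g : M →ₛₗ[φ] N) (m : M) :
    ExtendScalars.lift φ g (ExtendScalars.incl φ M m) = g m :=
  (ExtendScalars.lift_mk_single g m 1).trans (one_smul _ _)

theorem ExtendScalars.span_range_incl :
    Submodule.span S (Set.range (ExtendScalars.incl φ M)) = ⊤ := by
  refine top_unique fun z _ => ?_
  induction z using Submodule.Quotient.induction_on with
  | H z =>
    induction z using Finsupp.induction_linear with
    | zero => exact Submodule.zero_mem _
    | add a b ha hb => exact Submodule.add_mem _ (ha trivial) (hb trivial)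
    | single m s =>
      have : (Submodule.Quotient.mk (Finsupp.single m s) : ExtendScalars φ M) =
          s • ExtendScalars.incl φ M m := by
        change _ = s • Submodule.Quotient.mk (Finsupp.single m 1)
        rw [← Submodule.Quotient.mk_smul, Finsupp.smul_single, smul_eq_mul, mul_one]
      rw [this]
      exact Submodule.smul_mem _ _ (Submodule.subset_span ⟨m, rfl⟩)

theorem span_semilinear_range_eq_top {ι : Type*} [Fintype ι] {g : M →ₛₗ[φ] N}
    (hg : Submodule.span S (Set.range g) = ⊤) {e : ι → M}
    (he : Submodule.span R (Set.range e) = ⊤) :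
    Submodule.span S (Set.range fun i => g (e i)) = ⊤ := by
  refine top_unique (hg.symm.le.trans (Submodule.span_le.2 ?_))
  rintro _ ⟨m, rfl⟩
  obtain ⟨b, rfl⟩ := exists_sum_eq_of_span_eq_top he m
  rw [map_sum_smul]
  exact Submodule.sum_mem _ fun i _ => Submodule.smul_mem _ _ (Submodule.subset_span ⟨i, rfl⟩)

theorem span_range_eq_top_of_lift_surjective {g : M →ₛₗ[φ] N}
    (h : Function.Surjective (ExtendScalars.lift φ g)) : Submodule.span S (Set.range g) = ⊤ := by
  rw [← LinearMap.range_eq_top, ← Submodule.map_top, ← ExtendScalars.span_range_incl,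
    Submodule.map_span, ← Set.range_comp] at h
  rw [← h]
  congr 2
  funext m
  exact (ExtendScalars.lift_incl g m).symm

/-- Coefficient vectors modulo the relations `W` coming from `R` define a semilinear map from `M`
sending `e i` to the `i`-th unit vector. Its extension to `S ⊗ M` sends `∑ a i ⊗ e i`, which is `0`
by injectivity, to the class of `a`. -/
theorem mem_span_relations_of_lift_injective {g : M →ₛₗ[φ] N}
    (h : Function.Injective (ExtendScalars.lift φ g)) {ι : Type*} [Fintype ι] {e : ι → M}
    (he : Submodule.span R (Set.range e) = ⊤) {a : ι → S} (ha : ∑ i, a i • g (e i) = 0) :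
    a ∈ Submodule.span S (mapVec φ '' {b : ι → R | ∑ i, b i • e i = 0}) := by
  classical
  set W := Submodule.span S (mapVec φ '' {b : ι → R | ∑ i, b i • e i = 0}) with hW
  choose l hl using exists_sum_eq_of_span_eq_top he
  have hrel : ∀ b c : ι → R, ∑ i, b i • e i = ∑ i, c i • e i →
      (Submodule.Quotient.mk (mapVec φ b) : (ι → S) ⧸ W) = Submodule.Quotient.mk (mapVec φ c) := by
    intro b c hbc
    rw [Submodule.Quotient.eq, ← mapVec_sub]
    refine Submodule.subset_span ⟨b - c, ?_, rfl⟩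
    simp [sub_smul, Finset.sum_sub_distrib, hbc]
  let k : M →ₛₗ[φ] (ι → S) ⧸ W :=
    { toFun := fun m => Submodule.Quotient.mk (mapVec φ (l m))
      map_add' := fun m m' => by
        rw [← Submodule.Quotient.mk_add, ← mapVec_add]
        refine hrel _ _ ?_
        simp [hl, add_smul, Finset.sum_add_distrib]
      map_smul' := fun r m => by
        rw [← Submodule.Quotient.mk_smul, ← mapVec_smul]
        refine hrel _ _ ?_
        simp [hl, mul_smul, ← Finset.smul_sum] }
  have hk : ∀ i, k (e i) = Submodule.Quotient.mk (Pi.single i 1) := by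
    intro i
    have : k (e i) = Submodule.Quotient.mk (mapVec φ (Pi.single i 1)) := hrel _ _ (by simp [hl, Pi.single_apply])
    rw [this]
    congr 1
    funext j
    simp [mapVec, Pi.single_apply, apply_ite φ]
  have hz : ∑ i, a i • ExtendScalars.incl φ M (e i) = 0 := by
    apply h
    rw [map_sum, map_zero, ← ha]
    exact Finset.sum_congr rfl fun i _ => by rw [map_smul, ExtendScalars.lift_incl]
  have h1 := congrArg (ExtendScalars.lift φ k) hz
  rw [map_sum, map_zero] at h1
  simp_rw [map_smul, ExtendScalars.lift_incl, hk, ← Submodule.Quotient.mk_smul] at h1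
  have h2 : (Submodule.Quotient.mk a : (ι → S) ⧸ W) = 0 := by
    rw [← h1, ← Submodule.mkQ_apply]
    simp_rw [← Submodule.mkQ_apply, ← map_sum]
    congr 1
    funext j
    simp [Pi.single_apply]
  exact (Submodule.Quotient.mk_eq_zero W).1 h2

theorem lift_bijective_of_relations {g : M →ₛₗ[φ] N} (hg : Submodule.span S (Set.range g) = ⊤)
    {ι : Type*} [Fintype ι] {e : ι → M} (he : Submodule.span R (Set.range e) = ⊤)
    (h : ∀ a : ι → S, ∑ i, a i • g (e i) = 0 →
      a ∈ Submodule.span S (mapVec φ '' {b : ι → R | ∑ i, b i • e i = 0})) :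
    Function.Bijective (ExtendScalars.lift φ g) := by
  constructor
  · rw [← LinearMap.ker_eq_bot, LinearMap.ker_eq_bot']
    intro z hz
    obtain ⟨a, rfl⟩ := exists_sum_eq_of_span_eq_top
      (span_semilinear_range_eq_top ExtendScalars.span_range_incl he) z
    rw [map_sum] at hz
    simp_rw [map_smul, ExtendScalars.lift_incl] at hz
    refine Submodule.span_induction
      (p := fun a _ => ∑ i, a i • ExtendScalars.incl φ M (e i) = 0) ?_ ?_ ?_ ?_ (h a hz)
    · rintro _ ⟨b, hb, rfl⟩
      rw [← map_sum_smul, hb, map_zero]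
    · simp
    · intro a b _ _ ha hb
      simp [add_smul, Finset.sum_add_distrib, ha, hb]
    · intro r a _ ha
      simp [mul_smul, ← Finset.smul_sum, ha]
  · rw [← LinearMap.range_eq_top, ← top_le_iff, ← hg, Submodule.span_le]
    rintro _ ⟨m, rfl⟩
    exact ⟨_, ExtendScalars.lift_incl g m⟩

end ExtendScalars

/-! ### Coherent sheaves: topology and generation -/

namespace CoherentSheaf

variable {p : ℕ} [hp : Fact p.Prime] {A : Type u} [NormedRing A] [IsUltrametricDist A]
  [CompleteSpace A] {r₀ : ℝ≥0∞} (M : CoherentSheaf.{u, v} p A r₀)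

theorem span_range_res {J'' J' : ClosedInterval r₀} (h : J'' ≤ J') :
    Submodule.span (IntervalRing p A J'') (Set.range (M.res h)) = ⊤ :=
  span_range_eq_top_of_lift_surjective (M.baseChange h).2

theorem span_res_eq_top {J'' J' : ClosedInterval r₀} (h : J'' ≤ J') {ι : Type*} [Fintype ι]
    {e : ι → M.obj J'} (he : Submodule.span (IntervalRing p A J') (Set.range e) = ⊤) :
    Submodule.span (IntervalRing p A J'') (Set.range fun i => M.res h (e i)) = ⊤ :=
  span_semilinear_range_eq_top (M.span_range_res h) he

theorem mem_span_relations {J'' J' : ClosedInterval r₀} (h : J'' ≤ J') {ι : Type*} [Fintype ι]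
    {e : ι → M.obj J'} (he : Submodule.span (IntervalRing p A J') (Set.range e) = ⊤)
    {a : ι → IntervalRing p A J''} (ha : ∑ i, a i • M.res h (e i) = 0) :
    a ∈ Submodule.span (IntervalRing p A J'') (mapVec (AnRing.restrict
      (ClosedInterval.region_subset h)) '' {b : ι → IntervalRing p A J' | ∑ i, b i • e i = 0}) :=
  mem_span_relations_of_lift_injective (M.baseChange h).1 he ha

theorem exists_generators (J : ClosedInterval r₀) :
    ∃ (n : ℕ) (e : Fin n → M.obj J), Submodule.span (IntervalRing p A J) (Set.range e) = ⊤ := by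
  have := M.finite J
  exact Module.Finite.exists_fin

variable [NormedAlgebra ℚ_[p] A] [∀ J : ClosedInterval r₀, IsNoetherianRing (IntervalRing p A J)]

noncomputable instance (J : ClosedInterval r₀) : NormedAddCommGroup (M.obj J) :=
  haveI := M.finite J
  finNormed ℚ_[p] (IntervalRing p A J) (M.obj J)

instance (J : ClosedInterval r₀) : FinBanachModule (IntervalRing p A J) (M.obj J) :=
  haveI := M.finite J
  finBanachModule_finNormed ℚ_[p] (IntervalRing p A J) (M.obj J)

instance (J : ClosedInterval r₀) : CompleteSpace (M.obj J) :=
  FinBanachModule.complete (IntervalRing p A J)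

theorem continuous_res {J'' J' : ClosedInterval r₀} (h : J'' ≤ J') : Continuous (M.res h) :=
  continuous_of_semilinear (fun r => AnRing.norm_restrict_le h r) (M.res h)

/-- Vectors over the smaller annulus are approximated by vectors over the larger one, if both have
the same outer end. -/
theorem exists_mapVec_near {J'' J' : ClosedInterval r₀} (h : J'' ≤ J') (hr : J''.r = J'.r)
    {ι : Type*} [Fintype ι] (a : ι → IntervalRing p A J'') {ε : ℝ} (hε : 0 < ε) :
    ∃ b : ι → IntervalRing p A J',
      dist (mapVec (AnRing.restrict (ClosedInterval.region_subset h)) b) a < ε := by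
  choose b hb using fun i => AnRing.exists_restrict_near h hr (a i) hε
  exact ⟨b, (dist_pi_lt_iff hε).2 hb⟩

theorem exists_res_near {J'' J' : ClosedInterval r₀} (h : J'' ≤ J') (hr : J''.r = J'.r)
    (x : M.obj J'') {ε : ℝ} (hε : 0 < ε) : ∃ y : M.obj J', dist (M.res h y) x < ε := by
  obtain ⟨n, e, he⟩ := M.exists_generators J'
  obtain ⟨a, rfl⟩ := exists_sum_eq_of_span_eq_top (M.span_res_eq_top h he) x
  have hc := continuous_sum_smul (R := IntervalRing p A J'') (fun i => M.res h (e i))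
  obtain ⟨δ, hδ, hδ'⟩ := Metric.continuousAt_iff.1 hc.continuousAt ε hε
  obtain ⟨b, hb⟩ := exists_mapVec_near h hr a hδ
  refine ⟨∑ i, b i • e i, ?_⟩
  rw [map_sum_smul]
  exact hδ' hb

/-- Sections which generate on two annuli generate on their union. -/
theorem span_eq_top_of_union {J J₁ J₂ : ClosedInterval r₀} (h₁ : J₁ ≤ J) (h₂ : J₂ ≤ J)
    (hs : J₁.s = J.s) (hr : J₂.r = J.r) (h12 : J₁.r = J₂.s) {ι : Type*} [Fintype ι] (x : ι → M.obj J)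
    (hx₁ : Submodule.span (IntervalRing p A J₁) (Set.range fun i => M.res h₁ (x i)) = ⊤)
    (hx₂ : Submodule.span (IntervalRing p A J₂) (Set.range fun i => M.res h₂ (x i)) = ⊤) :
    Submodule.span (IntervalRing p A J) (Set.range x) = ⊤ := by
  obtain ⟨n, e, he⟩ := M.exists_generators J
  choose b hb using fun j => exists_sum_eq_of_span_eq_top he (x j)
  -- In terms of the generators `e`, the claim is that each unit vector lies in `K`. Over `J₁` and
  -- `J₂` this holds because the `x j` generate there and the relations between the restricted `e i`
  -- come from `J`.
  let K : Submodule (IntervalRing p A J) (Fin n → IntervalRing p A J) :=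
    (Submodule.span (IntervalRing p A J) (Set.range x)).comap
      (Fintype.linearCombination (IntervalRing p A J) e)
  have hmemK : ∀ c, c ∈ K ↔ ∑ i, c i • e i ∈ Submodule.span (IntervalRing p A J) (Set.range x) :=
    fun c => by rw [Submodule.mem_comap, Fintype.linearCombination_apply]
  have hbK : ∀ j, b j ∈ K := fun j => by
    rw [hmemK, hb]
    exact Submodule.subset_span ⟨j, rfl⟩
  have key : ∀ (I : ClosedInterval r₀) (h : I ≤ J),
      Submodule.span (IntervalRing p A I) (Set.range fun i => M.res h (x i)) = ⊤ → ∀ i,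
      mapVec (AnRing.restrict (ClosedInterval.region_subset h))
        (Pi.single i 1 : Fin n → IntervalRing p A J) ∈ Submodule.span (IntervalRing p A I)
        (mapVec (AnRing.restrict (ClosedInterval.region_subset h)) ''
          (K : Set (Fin n → IntervalRing p A J))) := by
    intro I h hx i
    set φ := AnRing.restrict (p := p) (A := A) (ClosedInterval.region_subset h)
    obtain ⟨c, hc⟩ := exists_sum_eq_of_span_eq_top hx (M.res h (e i))
    have hrel := M.mem_span_relations h he
      (a := mapVec φ (Pi.single i 1) - ∑ j, c j • mapVec φ (b j)) (by
        simp only [Pi.sub_apply, sub_smul, Finset.sum_sub_distrib, ← map_sum_smul]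
        rw [sub_eq_zero]
        have e1 : ∑ k, (Pi.single i 1 : Fin n → IntervalRing p A J) k • e k = e i := by
          simp [Pi.single_apply]
        rw [e1, ← hc]
        simp_rw [← hb, map_sum_smul, Finset.smul_sum, Finset.sum_apply, Finset.sum_smul,
          Pi.smul_apply, smul_eq_mul, mul_smul]
        rw [Finset.sum_comm])
    have hle := Submodule.span_mono (R := IntervalRing p A I) (Set.image_mono (f := mapVec φ)
      (show {b : Fin n → IntervalRing p A J | ∑ i, b i • e i = 0} ⊆ K from fun c hc => by
        rw [SetLike.mem_coe, hmemK, hc]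
        exact Submodule.zero_mem _))
    have h3 : ∑ j, c j • mapVec φ (b j) ∈ Submodule.span (IntervalRing p A I) (mapVec φ ''
        (K : Set (Fin n → IntervalRing p A J))) :=
      Submodule.sum_mem _ fun j _ => Submodule.smul_mem _ _ (Submodule.subset_span ⟨_, hbK j, rfl⟩)
    have := Submodule.add_mem _ (hle hrel) h3
    rwa [sub_add_cancel] at this
  refine top_unique (he.symm.le.trans (Submodule.span_le.2 ?_))
  rintro _ ⟨i, rfl⟩
  have := AnRing.mem_of_mem_span_restrict h₁ h₂ hs hr h12 K (Pi.single i 1) (key J₁ h₁ hx₁ i)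
    (key J₂ h₂ hx₂ i)
  rw [hmemK] at this
  simpa [Pi.single_apply] using this

/-! ### Global sections -/

/-- The interval `[s, r₀]` with the left end of a given interval. -/
def _root_.RelRobba.ClosedInterval.extend (J : ClosedInterval r₀) (h : IsRationalRadius r₀) :
    ClosedInterval r₀ :=
  ⟨J.s, r₀, J.s_pos, J.s_ne_top, J.s_le_r.trans J.r_le, le_rfl, J.s_rational, h⟩

theorem _root_.RelRobba.ClosedInterval.le_extend (J : ClosedInterval r₀) (h : IsRationalRadius r₀) :
    J ≤ J.extend h := ⟨le_rfl, J.r_le⟩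

/-- A sequence of intervals `[s, r₀]` with `s → 0`. -/
structure IsExhausting (L : ℕ → ClosedInterval r₀) : Prop where
  r_eq : ∀ k, (L k).r = r₀
  mono : ∀ {j k}, j ≤ k → L j ≤ L k
  small : ∀ t : ℝ≥0∞, 0 < t → ∃ k, (L k).s ≤ t

theorem IsExhausting.exists_le {L : ℕ → ClosedInterval r₀} (hL : IsExhausting L)
    (J : ClosedInterval r₀) : ∃ k, J ≤ L k := by
  obtain ⟨k, hk⟩ := hL.small J.s J.s_pos
  exact ⟨k, hk, by rw [hL.r_eq]; exact J.r_le⟩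

theorem exists_isExhausting (J : ClosedInterval r₀) (hJ : J.r = r₀) :
    ∃ L : ℕ → ClosedInterval r₀, IsExhausting L ∧ L 0 = J := by
  obtain ⟨q, hq⟩ : ∃ q : ℚ, J.s = ENNReal.ofReal q := J.s_rational.resolve_left J.s_ne_top
  have hle : ∀ k : ℕ, J.s / (k + 1) ≤ J.s := fun k =>
    ENNReal.div_le_of_le_mul (le_mul_of_one_le_right' (by simp))
  refine ⟨fun k => ⟨J.s / (k + 1), J.r, ENNReal.div_pos J.s_pos.ne' (by finiteness),
    ENNReal.div_ne_top J.s_ne_top (by positivity), (hle k).trans J.s_le_r, J.r_le,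
    Or.inr ⟨q / (k + 1), ?_⟩, J.r_rational⟩, ⟨fun _ => hJ, fun {j k} hjk => ⟨?_, le_rfl⟩,
      fun t ht => ?_⟩, ?_⟩
  · rw [hq]
    push_cast
    rw [ENNReal.ofReal_div_of_pos (by positivity)]
    congr 1
    rw [ENNReal.ofReal_add (by positivity) zero_le_one]
    simp
  · change J.s / (k + 1) ≤ J.s / (j + 1)
    gcongr
  · have h1 : Tendsto (fun k : ℕ => J.s / ((k : ℝ≥0∞) + 1)) atTop (𝓝 0) := by
      have h2 : Tendsto (fun k : ℕ => J.s * ((k + 1 : ℕ) : ℝ≥0∞)⁻¹) atTop (𝓝 (J.s * 0)) :=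
        ENNReal.Tendsto.const_mul (ENNReal.tendsto_inv_nat_nhds_zero.comp (tendsto_add_atTop_nat 1))
          (Or.inr J.s_ne_top)
      rw [mul_zero] at h2
      refine h2.congr fun k => ?_
      rw [div_eq_mul_inv]
      push_cast
      rfl
    exact (h1.eventually_le_const ht).exists
  · cases J
    simp

/-- The value of a global section on `[s, r₀]`. -/
theorem globalSection_res (x : M.GlobalSection) {J'' J' : ClosedInterval r₀} (h'' : J''.r = r₀)
    (h' : J'.r = r₀) (h : J'' ≤ J') : M.res h (x.1 ⟨J', h'⟩) = x.1 ⟨J'', h''⟩ :=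
  x.2 ⟨J'', h''⟩ ⟨J', h'⟩ h

theorem exists_globalSection {L : ℕ → ClosedInterval r₀} (hL : IsExhausting L)
    (x : ∀ k, M.obj (L k)) (hx : ∀ {j k} (h : j ≤ k), M.res (hL.mono h) (x k) = x j) :
    ∃ y : M.GlobalSection, ∀ k, y.1 ⟨L k, hL.r_eq k⟩ = x k := by
  have hind : ∀ (J : ClosedInterval r₀) (j k : ℕ) (hj : J ≤ L j) (hk : J ≤ L k),
      M.res hj (x j) = M.res hk (x k) := by
    have : ∀ (J : ClosedInterval r₀) (j k : ℕ) (hj : J ≤ L j) (hk : J ≤ L k), j ≤ k →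
        M.res hj (x j) = M.res hk (x k) := fun J j k hj hk hjk => by
      rw [← hx hjk, M.res_res]
    intro J j k hj hk
    rcases le_total j k with h | h
    exacts [this J j k hj hk h, (this J k j hk hj h).symm]
  choose k hk using hL.exists_le
  refine ⟨⟨fun J => M.res (hk J.1) (x (k J.1)), fun J'' J' h => ?_⟩, fun j => ?_⟩
  · rw [M.res_res]
    exact hind _ _ _ _ _
  · change M.res (hk (L j)) (x (k (L j))) = x j
    rw [hind (L j) _ j _ (L j).le_rfl', M.res_self]

theorem globalSection_ext {L : ℕ → ClosedInterval r₀} (hL : IsExhausting L) {x y : M.GlobalSection}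
    (h : ∀ k, x.1 ⟨L k, hL.r_eq k⟩ = y.1 ⟨L k, hL.r_eq k⟩) : x = y := by
  refine Subtype.ext (funext fun J => ?_)
  obtain ⟨k, hk⟩ := hL.exists_le J.1
  rw [← x.2 J ⟨L k, hL.r_eq k⟩ hk, h k, y.2 J ⟨L k, hL.r_eq k⟩ hk]

theorem sum_smul_apply (h₀ : 0 < r₀) {ι : Type*} (s : Finset ι) (c : ι → FullRing p A r₀ h₀)
    (x : ι → M.GlobalSection) (J : {J : ClosedInterval r₀ // J.r = r₀}) :
    (∑ i ∈ s, c i • x i).1 J =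
      ∑ i ∈ s, AnRing.restrict (region_subset_full h₀ J.1) (c i) • (x i).1 J := by
  rw [AddSubgroup.val_finsetSum, Finset.sum_apply]
  rfl

/-- Elements of `Π_{[s, r₀]}` which agree under restriction come from an element on `(0, r₀]`. -/
theorem exists_fullRing (h₀ : 0 < r₀) {L : ℕ → ClosedInterval r₀} (hL : IsExhausting L)
    (c : ∀ k, IntervalRing p A (L k))
    (hc : ∀ {j k} (h : j ≤ k), AnRing.restrict (ClosedInterval.region_subset (hL.mono h)) (c k) = c j) :
    ∃ d : FullRing p A r₀ h₀, ∀ k, AnRing.restrict (region_subset_full h₀ (L k)) d = c k := by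
  have hcoeff : ∀ k, (c k).coeff = (c 0).coeff := fun k => by
    rw [← hc (Nat.zero_le k)]
    rfl
  refine ⟨⟨(c 0).coeff, fun t ht => ?_⟩, fun k => AnRing.ext (hcoeff k).symm⟩
  obtain ⟨k, hk⟩ := hL.small t ht.1
  rw [← hcoeff k]
  exact (c k).convergesAt t ⟨hk, by rw [hL.r_eq]; exact ht.2⟩

/-- Global sections are dense in the sections over `[s, r₀]`. -/
theorem exists_globalSection_near (J : ClosedInterval r₀) (hJ : J.r = r₀) (x : M.obj J)
    {ε : ℝ} (hε : 0 < ε) : ∃ y : M.GlobalSection, dist (y.1 ⟨J, hJ⟩) x < ε := by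
  obtain ⟨L, hL, rfl⟩ := exists_isExhausting J hJ
  obtain ⟨z, hz, hzc⟩ := exists_compatible_of_dense (X := fun k => M.obj (L k))
    (fun h => M.res (hL.mono h)) (fun h => M.continuous_res _) (fun k y => M.res_self _ y)
    (fun h h' y => M.res_res _ _ y)
    -- Only the lowest level is prescribed; the higher ones need just to be compatible.
    (fun k => Nat.casesOn k (Metric.ball x ε) fun _ => Set.univ)
    (fun k => by
      cases k
      exacts [Metric.isOpen_ball, isOpen_univ])
    ⟨x, Metric.mem_ball_self hε⟩
    (fun k y _ δ hδ => by
      obtain ⟨z, hz⟩ := M.exists_res_near (hL.mono k.le_succ)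
        ((hL.r_eq k).trans (hL.r_eq (k + 1)).symm) y hδ
      exact ⟨z, trivial, hz⟩)
  obtain ⟨y, hy⟩ := M.exists_globalSection hL z hzc
  refine ⟨y, ?_⟩
  rw [hy 0]
  exact hz 0

/-- Global sections which generate the sections over all `[s, r₀]` generate the global sections. -/
theorem span_globalSection_eq_top (h₀ : 0 < r₀) {L : ℕ → ClosedInterval r₀} (hL : IsExhausting L)
    {n : ℕ} (x : Fin n → M.GlobalSection)
    (hx : ∀ k, Submodule.span (IntervalRing p A (L k))
      (Set.range fun i => (x i).1 ⟨L k, hL.r_eq k⟩) = ⊤) :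
    Submodule.span (FullRing p A r₀ h₀) (Set.range x) = ⊤ := by
  refine top_unique fun y _ => ?_
  -- Points of `X k` are coefficient vectors expressing `y` over `[s_k, r₀]`. A compatible choice
  -- for all `k` is a vector over the ring of `(0, r₀]`.
  let X : ℕ → Type u := fun k => {c : Fin n → IntervalRing p A (L k) //
    ∑ i, c i • (x i).1 ⟨L k, hL.r_eq k⟩ = y.1 ⟨L k, hL.r_eq k⟩}
  have hres : ∀ {j k : ℕ} (h : j ≤ k) (z : M.GlobalSection),
      M.res (hL.mono h) (z.1 ⟨L k, hL.r_eq k⟩) = z.1 ⟨L j, hL.r_eq j⟩ := fun h z =>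
    M.globalSection_res z _ _ _
  have hcl : ∀ k, CompleteSpace (X k) := fun k => by
    have : IsClosed {c : Fin n → IntervalRing p A (L k) |
        ∑ i, c i • (x i).1 ⟨L k, hL.r_eq k⟩ = y.1 ⟨L k, hL.r_eq k⟩} :=
      isClosed_singleton.preimage (continuous_sum_smul (R := IntervalRing p A (L k))
        fun i => (x i).1 ⟨L k, hL.r_eq k⟩)
    exact this.completeSpace_coe
  let f : ∀ {j k : ℕ}, j ≤ k → X k → X j := fun {j k} h c =>
    ⟨mapVec (AnRing.restrict (ClosedInterval.region_subset (hL.mono h))) c.1, by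
      have h1 := congrArg (M.res (hL.mono h)) c.2
      rw [map_sum_smul, hres h y] at h1
      simp_rw [hres h] at h1
      exact h1⟩
  obtain ⟨z, -, hz⟩ := exists_compatible_of_dense (X := X) f
    (fun h => Continuous.subtype_mk (continuous_pi fun i => (AnRing.continuous_restrict (hL.mono h)).comp
      ((continuous_apply i).comp continuous_subtype_val)) _)
    (fun _ _ => rfl) (fun _ _ _ => rfl) (fun _ => Set.univ) (fun _ => isOpen_univ)
    (by
      obtain ⟨c, hc⟩ := exists_sum_eq_of_span_eq_top (hx 0) (y.1 ⟨L 0, hL.r_eq 0⟩)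
      exact ⟨⟨c, hc⟩, trivial⟩)
    (fun k c _ ε hε => by
      obtain ⟨c', hc'⟩ := exists_sum_eq_of_span_eq_top (hx (k + 1)) (y.1 ⟨L (k + 1), hL.r_eq (k + 1)⟩)
      have h1 : k ≤ k + 1 := k.le_succ
      set φ := AnRing.restrict (p := p) (A := A)
        (ClosedInterval.region_subset (hL.mono h1)) with hφ
      -- Two expressions of `y` differ by a relation, hence by a combination of relations already
      -- available over the larger annulus. Approximating only its coefficients `a` corrects `c'`
      -- without destroying the equation for `y`.
      have hd := M.mem_span_relations (hL.mono h1) (hx (k + 1)) (a := c.1 - mapVec φ c') (by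
        have h2 := congrArg (M.res (hL.mono h1)) hc'
        rw [map_sum_smul, hres h1 y] at h2
        simp only [Pi.sub_apply, sub_smul, Finset.sum_sub_distrib, hres h1] at h2 ⊢
        rw [h2]
        exact sub_eq_zero.2 c.2)
      obtain ⟨l, a, g, hg⟩ := Submodule.mem_span_set'.1 hd
      choose b hb hbg using fun i => (g i).2
      have hcont : Continuous fun a : Fin l → IntervalRing p A (L k) => ∑ i, a i • mapVec φ (b i) := by
        fun_prop
      obtain ⟨δ, hδ, hδ'⟩ := Metric.continuousAt_iff.1 (hcont.continuousAt (x := a)) ε hε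
      obtain ⟨a', ha'⟩ := exists_mapVec_near (hL.mono h1)
        ((hL.r_eq k).trans (hL.r_eq (k + 1)).symm) a hδ
      refine ⟨⟨c' + ∑ j, a' j • b j, ?_⟩, trivial, ?_⟩
      · have e1 : ∀ j, ∑ i, b j i • (x i).1 ⟨L (k + 1), hL.r_eq (k + 1)⟩ = 0 := hb
        have e2 : ∑ i, (∑ j, a' j • b j) i • (x i).1 ⟨L (k + 1), hL.r_eq (k + 1)⟩ = 0 := by
          simp_rw [Finset.sum_apply, Finset.sum_smul, Pi.smul_apply, smul_eq_mul, mul_smul]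
          rw [Finset.sum_comm]
          simp_rw [← Finset.smul_sum, e1, smul_zero, Finset.sum_const_zero]
        simp only [Pi.add_apply, add_smul, Finset.sum_add_distrib]
        rw [hc', e2, add_zero]
      · rw [Subtype.dist_eq]
        change dist (mapVec φ (c' + ∑ j, a' j • b j)) c.1 < ε
        have e3 : mapVec φ (∑ j, a' j • b j) = ∑ j, mapVec φ a' j • mapVec φ (b j) := by
          funext t
          simp [mapVec, Finset.sum_apply]
        have e4 : c.1 = mapVec φ c' + ∑ j, a j • mapVec φ (b j) := by
          have e5 : ∑ j, a j • mapVec φ (b j) = c.1 - mapVec φ c' := by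
            rw [← hg]
            exact Finset.sum_congr rfl fun j _ => by rw [← hbg j]
          rw [e5]
          abel
        rw [mapVec_add, e3, e4, dist_add_left]
        exact hδ' ha')
  choose d hd using fun i => exists_fullRing h₀ hL (fun k => (z k).1 i) fun {j k} h => by
    rw [← hz h]
  have : y = ∑ i, d i • x i := by
    refine M.globalSection_ext hL fun k => ?_
    rw [sum_smul_apply]
    simp_rw [hd]
    exact (z k).2.symm
  rw [this]
  exact Submodule.sum_mem _ fun i _ => Submodule.smul_mem _ _ (Submodule.subset_span ⟨i, rfl⟩)

end CoherentSheaf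

/-! ### Coverings of the half-open interval -/

section Coverings

variable {r₀ : ℝ≥0∞}

/-- In a locally finite covering, some member covers `a` and points to its left, and among those
one reaches farthest to the left. -/
theorem exists_leftmost {𝒱 : Set (ClosedInterval r₀)} (hc : Covers 𝒱) (hf : IsLocallyFinite 𝒱)
    {a : ℝ≥0∞} (h0 : 0 < a) (ha : a ≤ r₀) :
    ∃ J ∈ 𝒱, J.s < a ∧ a ≤ J.r ∧ ∀ K ∈ 𝒱, K.s < a → a ≤ K.r → J.s ≤ K.s := by
  obtain ⟨W, hW, hfin⟩ := hf a h0 ha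
  have hmem : ∀ K ∈ 𝒱, K.s < a → a ≤ K.r →
      K ∈ {J ∈ 𝒱 | (Set.Icc J.s J.r ∩ W).Nonempty} := fun K hK h1 h2 =>
    ⟨hK, a, ⟨h1.le, h2⟩, mem_of_mem_nhds hW⟩
  -- Otherwise each of the finitely many members near `a` would miss the points immediately to the
  -- left of `a`, and these would remain uncovered.
  have hne : ({J ∈ 𝒱 | (Set.Icc J.s J.r ∩ W).Nonempty} ∩ {J | J.s < a ∧ a ≤ J.r}).Nonempty := by
    by_contra hcon
    have : (𝓝[<] a).NeBot := nhdsLT_neBot_of_exists_lt ⟨0, h0⟩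
    have h1 : ∀ J ∈ {J ∈ 𝒱 | (Set.Icc J.s J.r ∩ W).Nonempty}, ∀ᶠ t in 𝓝[<] a,
        t ∉ Set.Icc J.s J.r := by
      intro J hJ
      rcases le_or_gt a J.s with h | h
      · filter_upwards [self_mem_nhdsWithin] with t ht ht'
        exact (ht.trans_le h).not_ge ht'.1
      · have hr : J.r < a := lt_of_not_ge fun h' => hcon ⟨J, hJ, h, h'⟩
        filter_upwards [nhdsWithin_le_nhds (Ioi_mem_nhds hr)] with t ht ht'
        exact (Set.mem_Ioi.1 ht).not_ge ht'.2
    have h2 := (hfin.eventually_all (l := 𝓝[<] a)).2 h1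
    have h3 : ∀ᶠ t in 𝓝[<] a, t ∈ W ∧ t < a ∧ 0 < t :=
      (show ∀ᶠ t in 𝓝[<] a, t ∈ W from nhdsWithin_le_nhds hW).and
        ((show ∀ᶠ t in 𝓝[<] a, t < a from self_mem_nhdsWithin).and
          (show ∀ᶠ t in 𝓝[<] a, 0 < t from nhdsWithin_le_nhds (Ioi_mem_nhds h0)))
    obtain ⟨t, ht, htW, hta, ht0⟩ := (h2.and h3).exists
    obtain ⟨J, hJ, hJt⟩ := hc t ht0 ((le_of_lt hta).trans ha)
    exact ht J ⟨hJ, t, hJt, htW⟩ hJt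
  obtain ⟨J, hJ, hmin⟩ := Set.exists_min_image _ (fun J : ClosedInterval r₀ => J.s)
    (hfin.inter_of_left {J | J.s < a ∧ a ≤ J.r}) hne
  exact ⟨J, hJ.1.1, hJ.2.1, hJ.2.2, fun K hK h1 h2 => hmin K ⟨hmem K hK h1 h2, h1, h2⟩⟩

/-- A locally finite covering contains a chain of intervals in which only consecutive ones meet. -/
theorem exists_chain (h₀ : 0 < r₀) {𝒱 : Set (ClosedInterval r₀)} (hc : Covers 𝒱)
    (hf : IsLocallyFinite 𝒱) : ∃ J : ℕ → ClosedInterval r₀, (∀ k, J k ∈ 𝒱) ∧ (J 0).r = r₀ ∧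
      (∀ k, (J (k + 1)).s < (J k).s) ∧ (∀ k, (J k).s ≤ (J (k + 1)).r) ∧
      (∀ k, (J (k + 2)).r < (J k).s) ∧ ∀ t, 0 < t → ∃ k, (J k).s ≤ t := by
  choose nxt hmem hlt hle hmin using fun a : {a : ℝ≥0∞ // 0 < a ∧ a ≤ r₀} =>
    exists_leftmost hc hf a.2.1 a.2.2
  let pt : ClosedInterval r₀ → {a : ℝ≥0∞ // 0 < a ∧ a ≤ r₀} := fun J =>
    ⟨J.s, J.s_pos, J.s_le_r.trans J.r_le⟩
  let J : ℕ → ClosedInterval r₀ := fun k =>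
    Nat.rec (nxt ⟨r₀, h₀, le_rfl⟩) (fun _ I => nxt (pt I)) k
  have hJ0 : J 0 = nxt ⟨r₀, h₀, le_rfl⟩ := rfl
  have hJs : ∀ k, J (k + 1) = nxt (pt (J k)) := fun _ => rfl
  have hV : ∀ k, J k ∈ 𝒱 := fun k => by
    cases k
    exacts [hmem _, hmem _]
  have hdec : ∀ k, (J (k + 1)).s < (J k).s := fun k => hlt (pt (J k))
  refine ⟨J, hV, le_antisymm (J 0).r_le (hle _), hdec, fun k => hle (pt (J k)), fun k => ?_, ?_⟩
  -- Otherwise `J (k + 2)` would be a candidate at the point `(J k).s` reaching farther left than `J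
  -- (k + 1)`.
  · by_contra hcon
    exact (hmin (pt (J k)) (J (k + 2)) (hV (k + 2)) ((hdec (k + 1)).trans (hdec k)) (not_lt.1 hcon)).not_gt
      (hdec (k + 1))
  · intro t ht
    -- Left ends bounded away from `0` would decrease strictly to a positive limit, near which
    -- infinitely many members would accumulate, against local finiteness.
    by_contra! hcon
    have hanti : StrictAnti fun k => (J k).s := strictAnti_nat_of_succ_lt hdec
    have hlim := tendsto_atTop_iInf hanti.antitone
    have hpos : 0 < ⨅ k, (J k).s := ht.trans_le (le_iInf fun k => (hcon k).le)
    obtain ⟨W, hW, hfin⟩ := hf _ hpos ((iInf_le _ 0).trans ((J 0).s_le_r.trans (J 0).r_le))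
    obtain ⟨N, hN⟩ := eventually_atTop.1 (hlim.eventually hW)
    refine Set.infinite_of_injective_forall_mem (f := fun k => J (N + k)) (fun a b hab => ?_)
      (fun k => ?_) hfin
    · have := hanti.injective (congrArg ClosedInterval.s hab)
      omega
    · exact ⟨hV _, (J (N + k)).s, ⟨le_rfl, (J (N + k)).s_le_r⟩, hN _ (Nat.le_add_right _ _)⟩

/-- The intervals `[s_k, r₀]` all contain `r₀`, so local finiteness has to come from the refinement
by `[s_0, r₀]` and the `[s_{k+1}, s_k]`. -/
theorem exists_isExhausting_isAdmissibleCovering (h₀ : 0 < r₀) (hr₀ : IsRationalRadius r₀) :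
    ∃ L : ℕ → ClosedInterval r₀, CoherentSheaf.IsExhausting L ∧
      IsAdmissibleCovering (Set.range L) := by
  obtain ⟨q, -, hq, hq'⟩ := ENNReal.lt_iff_exists_rat_btwn.1 h₀
  obtain ⟨L, hL, hL0⟩ := CoherentSheaf.exists_isExhausting (r₀ := r₀)
    ⟨ENNReal.ofReal q, r₀, hq, ENNReal.ofReal_ne_top, hq'.le, le_rfl, Or.inr ⟨q, rfl⟩, hr₀⟩ rfl
  have hlt : ∀ k, (L k).s < r₀ := fun k => by
    refine lt_of_le_of_lt (hL.mono (Nat.zero_le k)).1 ?_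
    rw [hL0]
    exact hq'
  have hs : ∀ k, (L (k + 1)).s ≤ (L k).s := fun k => (hL.mono k.le_succ).1
  let I : ℕ → ClosedInterval r₀ := fun k => ⟨(L (k + 1)).s, (L k).s, (L (k + 1)).s_pos,
    (L (k + 1)).s_ne_top, hs k, (hlt k).le, (L (k + 1)).s_rational, (L k).s_rational⟩
  refine ⟨L, hL, fun t ht ht' => ?_, ?_, insert (L 0) (Set.range I), fun t ht ht' => ?_, ?_,
    fun t ht ht' => ?_⟩
  · obtain ⟨k, hk⟩ := hL.small t ht
    exact ⟨L k, ⟨k, rfl⟩, hk, ht'.trans_eq (hL.r_eq k).symm⟩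
  · rintro _ ⟨k, rfl⟩
    rw [hL.r_eq]
    exact hlt k
  · classical
    obtain ⟨k, hk, hmin⟩ : ∃ k, (L k).s ≤ t ∧ ∀ j < k, t < (L j).s :=
      ⟨Nat.find (hL.small t ht), Nat.find_spec (hL.small t ht), fun j hj =>
        not_le.1 (Nat.find_min (hL.small t ht) hj)⟩
    cases k with
    | zero => exact ⟨L 0, Set.mem_insert _ _, hk, ht'.trans_eq (hL.r_eq 0).symm⟩
    | succ k => exact ⟨I k, Or.inr ⟨k, rfl⟩, hk, (hmin k k.lt_succ_self).le⟩
  · rintro _ (rfl | ⟨k, rfl⟩)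
    · exact ⟨L 0, ⟨0, rfl⟩, ClosedInterval.le_rfl' _⟩
    · exact ⟨L (k + 1), ⟨k + 1, rfl⟩, le_rfl, (I k).r_le.trans_eq (hL.r_eq _).symm⟩
  · obtain ⟨u, hu, hut⟩ := exists_between ht
    obtain ⟨k, hk⟩ := hL.small u hu
    refine ⟨Set.Ioi (L k).s, Ioi_mem_nhds (hk.trans_lt hut), ?_⟩
    refine ((Set.finite_singleton (L 0)).union ((Set.finite_Iio k).image I)).subset ?_
    rintro _ ⟨rfl | ⟨j, rfl⟩, x, hx, hxk⟩
    · exact Or.inl rfl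
    · refine Or.inr ⟨j, ?_, rfl⟩
      by_contra hj
      exact (Set.mem_Ioi.1 hxk).not_ge (hx.2.trans (hL.mono (not_lt.1 hj)).1)

end Coverings

/-! ### Stability of generating families and scalars for the approximation. -/

theorem exists_pos_span_eq_top {R N : Type*} [NormedRing R] [CompleteSpace R]
    [NormedAddCommGroup N] [Module R N] [FinBanachModule R N] {n : ℕ} {y : Fin n → N}
    (hy : Submodule.span R (Set.range y) = ⊤) :
    ∃ δ > 0, ∀ g : Fin n → N, (∀ i, dist (g i) (y i) < δ) →
      Submodule.span R (Set.range g) = ⊤ := by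
  obtain ⟨δ, hδ, h⟩ := Metric.isOpen_iff.1 (isOpen_span_eq_top (R := R) (N := N) n) y hy
  exact ⟨δ, hδ, fun g hg => h (Metric.mem_ball.2 ((dist_pi_lt_iff hδ).2 hg))⟩

theorem span_eq_top_of_forall_mem {R N : Type*} [Ring R] [AddCommGroup N] [Module R N]
    {ι κ : Type*} {y : ι → N} {z : κ → N} (hz : Submodule.span R (Set.range z) = ⊤)
    (h : ∀ k, z k ∈ Submodule.span R (Set.range y)) : Submodule.span R (Set.range y) = ⊤ := by
  rw [← top_le_iff, ← hz, Submodule.span_le]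
  rintro _ ⟨k, rfl⟩
  exact h k

theorem span_eq_top_of_smul {R N : Type*} [Ring R] [AddCommGroup N] [Module R N] {ι : Type*}
    {y : ι → N} {u : R} (h : Submodule.span R (Set.range fun i => u • y i) = ⊤) :
    Submodule.span R (Set.range y) = ⊤ :=
  span_eq_top_of_forall_mem h fun i => Submodule.smul_mem _ _ (Submodule.subset_span ⟨i, rfl⟩)

theorem IsFinGenBy.succ {R N : Type*} [Ring R] [AddCommGroup N] [Module R N] {n : ℕ}
    (h : IsFinGenBy R N n) : IsFinGenBy R N (n + 1) := by
  obtain ⟨e, he⟩ := h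
  exact ⟨Fin.cons 0 e, span_eq_top_of_forall_mem he fun i =>
    Submodule.subset_span ⟨i.succ, Fin.cons_succ _ _ _⟩⟩

/-- A scalar `c` making both `c a ^ N` and `(c b ^ N)⁻¹` small. -/
theorem exists_scalar_pow_small (𝕜 : Type*) [NontriviallyNormedField 𝕜] {a b : ℝ} (ha : 0 < a)
    (hab : a < b) {η δ : ℝ} (hη : 0 < η) (hδ : 0 < δ) :
    ∃ (N : ℕ) (c : 𝕜), c ≠ 0 ∧ ‖c‖ * a ^ N < η ∧ ‖c⁻¹‖ * (b ^ N)⁻¹ < δ := by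
  obtain ⟨c₀, hc₀⟩ := NormedField.exists_one_lt_norm 𝕜
  have hb : 0 < b := ha.trans hab
  have h1 := (tendsto_pow_atTop_nhds_zero_of_lt_one (by positivity : 0 ≤ a / b)
    ((div_lt_one hb).2 hab)).const_mul (η⁻¹ * ‖c₀‖)
  rw [mul_zero] at h1
  obtain ⟨N, hN⟩ := (h1.eventually_lt_const hδ).exists
  have haN : 0 < a ^ N := pow_pos ha N
  -- The value group is discrete or dense, but in either case `‖d‖` can be chosen within a factor
  -- `‖c₀‖` below `η / a ^ N`. The choice of `N` makes the ratio `(a / b) ^ N` absorb this factor.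
  obtain ⟨d, hd, h2, -, h3⟩ := rescale_to_shell hc₀ (div_pos hη haN) (one_ne_zero (α := 𝕜))
  rw [smul_eq_mul, mul_one, lt_div_iff₀ haN] at h2
  refine ⟨N, d, hd, h2, lt_of_le_of_lt ?_ hN⟩
  rw [norm_one, mul_one, inv_div] at h3
  rw [norm_inv]
  refine (mul_le_mul_of_nonneg_right h3 (inv_pos.2 (pow_pos hb N)).le).trans_eq ?_
  rw [div_pow]
  field_simp

/-! ### Generation by finitely many global sections. -/

namespace CoherentSheaf

variable {p : ℕ} [hp : Fact p.Prime] {A : Type u} [NormedRing A] [IsUltrametricDist A]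
  [CompleteSpace A] {r₀ : ℝ≥0∞} (M : CoherentSheaf.{u, v} p A r₀)

variable [NormedAlgebra ℚ_[p] A] [∀ J : ClosedInterval r₀, IsNoetherianRing (IntervalRing p A J)]

/-- The restriction of a global section to a closed interval. -/
noncomputable def eval (hr₀ : IsRationalRadius r₀) (J : ClosedInterval r₀) (x : M.GlobalSection) :
    M.obj J := M.res (J.le_extend hr₀) (x.1 ⟨J.extend hr₀, rfl⟩)

theorem eval_eq (hr₀ : IsRationalRadius r₀) (J : ClosedInterval r₀) (hJ : J.r = r₀)
    (x : M.GlobalSection) : M.eval hr₀ J x = x.1 ⟨J, hJ⟩ := M.globalSection_res x _ _ _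

theorem res_apply (hr₀ : IsRationalRadius r₀) {J L : ClosedInterval r₀} (h : J ≤ L) (hL : L.r = r₀)
    (x : M.GlobalSection) : M.res h (x.1 ⟨L, hL⟩) = M.eval hr₀ J x := by
  have h1 : J.extend hr₀ ≤ L := ⟨h.1, hL.ge⟩
  rw [eval, ← M.globalSection_res x rfl hL h1, M.res_res]

theorem res_eval (hr₀ : IsRationalRadius r₀) {J'' J' : ClosedInterval r₀} (h : J'' ≤ J')
    (x : M.GlobalSection) : M.res h (M.eval hr₀ J' x) = M.eval hr₀ J'' x := by
  rw [eval, M.res_res]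
  exact M.res_apply hr₀ _ _ _

/-- Generators over `I` may be perturbed, so it is enough to approximate them from `L`. If the right
ends differ, this is possible only up to the factor `T ^ (-N)`, which is harmless for generation. -/
theorem exists_extension_generators {I L : ClosedInterval r₀} (h : I ≤ L) {n : ℕ}
    (hI : IsFinGenBy (IntervalRing p A I) (M.obj I) n) :
    ∃ X : Fin n → M.obj L,
      Submodule.span (IntervalRing p A I) (Set.range fun i => M.res h (X i)) = ⊤ := by
  obtain ⟨y, hy⟩ := hI
  obtain ⟨δ, hδ, hδ'⟩ := exists_pos_span_eq_top hy
  by_cases hr : I.r = L.r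
  · choose X hX using fun i => M.exists_res_near h hr (y i) hδ
    exact ⟨X, hδ' _ hX⟩
  have hI' : I.r ≠ ⊤ := fun ht => hr (le_antisymm h.2 (ht ▸ le_top))
  obtain ⟨l, e, he⟩ := M.exists_generators L
  have he' := M.span_res_eq_top h he
  choose a ha using fun i => exists_sum_eq_of_span_eq_top he' (y i)
  have hc := continuous_sum_smul (R := IntervalRing p A I) (fun j => M.res h (e j))
  choose η hη hη' using fun i => Metric.continuousAt_iff.1 (hc.continuousAt (x := a i)) δ hδ
  choose N₀ hN₀ using fun i j => AnRing.exists_restrict_mul_near h hI' (a i j) (hη i)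
  obtain ⟨N, hN⟩ : ∃ N, ∀ i j, N₀ i j ≤ N :=
    ⟨∑ i, ∑ j, N₀ i j, fun i j => (Finset.single_le_sum (f := fun j => N₀ i j)
      (fun _ _ => Nat.zero_le _) (Finset.mem_univ j)).trans (Finset.single_le_sum
        (f := fun i => ∑ j, N₀ i j) (fun _ _ => Nat.zero_le _) (Finset.mem_univ i))⟩
  choose b hb using fun i j => hN₀ i j N (hN i j)
  refine ⟨fun i => ∑ j, b i j • e j, span_eq_top_of_smul
    (u := AnRing.mono I (-N) 1 fun ht => absurd ht hI') (hδ' _ fun i => ?_)⟩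
  rw [map_sum_smul, Finset.smul_sum, ← ha i]
  simp_rw [← mul_smul]
  exact hη' i ((dist_pi_lt_iff (hη i)).2 (hb i))

/-- Sections over the smaller `L` are approximated by sections over `L'` which generate over an
interval `I` to the left of `L`. -/
theorem exists_near_generators {I L L' : ClosedInterval r₀} (hI : I ≤ L') (hL : L ≤ L')
    (hr : L.r = L'.r) (hIL : I.r < L.s) {n : ℕ} (Z : Fin n → M.obj L)
    (hy : IsFinGenBy (IntervalRing p A I) (M.obj I) n) {ε : ℝ} (hε : 0 < ε) :
    ∃ X : Fin n → M.obj L',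
      Submodule.span (IntervalRing p A I) (Set.range fun i => M.res hI (X i)) = ⊤ ∧
      ∀ i, dist (M.res hL (X i)) (Z i) < ε := by
  obtain ⟨y, hy⟩ := M.exists_extension_generators hI hy
  choose z hz using fun i => M.exists_res_near hL hr (Z i) (half_pos hε)
  obtain ⟨δ, hδ, hδ'⟩ := exists_pos_span_eq_top hy
  have hIt : I.r ≠ ⊤ := hIL.ne_top
  set B : ℝ := 1 + ∑ i, ‖M.res hL (y i)‖ with hB
  set C : ℝ := 1 + ∑ i, ‖M.res hI (z i)‖ with hC
  have hB0 : 0 < B := by positivity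
  have hC0 : 0 < C := by positivity
  have hBi : ∀ i, ‖M.res hL (y i)‖ ≤ B := fun i =>
    (Finset.single_le_sum (f := fun i => ‖M.res hL (y i)‖) (fun _ _ => norm_nonneg _)
      (Finset.mem_univ i)).trans (le_add_of_nonneg_left zero_le_one)
  have hCi : ∀ i, ‖M.res hI (z i)‖ ≤ C := fun i =>
    (Finset.single_le_sum (f := fun i => ‖M.res hI (z i)‖) (fun _ _ => norm_nonneg _)
      (Finset.mem_univ i)).trans (le_add_of_nonneg_left zero_le_one)
  -- The norm of `1` in `A` is not assumed to be `1`, so it enters the estimates for monomials.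
  have hA : ‖(1 : A)‖ < ‖(1 : A)‖ + 1 := lt_add_one _
  set D : ℝ := ‖(1 : A)‖ + 1
  have hD : 0 < D := by positivity
  obtain ⟨N, c, hc0, hc1, hc2⟩ := exists_scalar_pow_small ℚ_[p] (absT_pos (p := p) L.s)
    (absT_lt hIL L.s_ne_top) (η := ε / 2 / (D * B)) (δ := δ / (D * C)) (by positivity)
    (by positivity)
  -- The function `u = c T ^ N` is small on `L`, while its inverse `w` is small on `I`. Both are
  -- possible because `I.r < L.s`, so `|T|` is larger on `I` than on `L`.
  let u (J : ClosedInterval r₀) : IntervalRing p A J :=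
    c • AnRing.mono J N 1 fun _ => Nat.cast_nonneg N
  let w : IntervalRing p A I := c⁻¹ • AnRing.mono I (-N) 1 fun ht => absurd ht hIt
  have hwu : w * u I = 1 := by
    simp only [w, u]
    rw [smul_mul_assoc]
    ext m
    rw [AnRing.coeff_smul, AnRing.coeff_mono_mul, AnRing.coeff_smul, one_mul, smul_smul,
      inv_mul_cancel₀ hc0, one_smul, AnRing.coeff_mono, AnRing.coeff_one, sub_neg_eq_add]
    by_cases hm : m = 0
    · subst hm
      simp
    · rw [Pi.single_eq_of_ne (by omega), Pi.single_eq_of_ne hm]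
  have hures : ∀ {J : ClosedInterval r₀} (h : J ≤ L'),
      AnRing.restrict (ClosedInterval.region_subset h) (u L') = u J := fun _ => rfl
  have hu : ‖u L‖ * B < ε / 2 := by
    have h1 : ‖u L‖ ≤ ‖c‖ * absT p L.s ^ N * D := by
      refine (norm_smul_le _ _).trans ?_
      rw [mul_assoc]
      refine mul_le_mul_of_nonneg_left ((AnRing.norm_mono_le _ _ _).trans ?_) (norm_nonneg _)
      rw [weight_of_nonneg L (Nat.cast_nonneg N), zpow_natCast, mul_comm]
      exact mul_le_mul_of_nonneg_left hA.le (pow_pos (absT_pos _) N).le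
    refine (mul_le_mul_of_nonneg_right h1 hB0.le).trans_lt ?_
    rw [mul_assoc]
    exact (lt_div_iff₀ (by positivity)).1 hc1
  have hw : ‖w‖ * C < δ := by
    have h1 : ‖w‖ ≤ ‖c⁻¹‖ * (absT p I.r ^ N)⁻¹ * D := by
      refine (norm_smul_le _ _).trans ?_
      rw [mul_assoc]
      refine mul_le_mul_of_nonneg_left ((AnRing.norm_mono_le _ _ _).trans ?_) (norm_nonneg _)
      rw [weight_of_nonpos I (by simp), ClosedInterval.upper_eq hIt, zpow_neg, zpow_natCast,
        mul_comm]
      exact mul_le_mul_of_nonneg_left hA.le (inv_pos.2 (pow_pos (absT_pos _) N)).le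
    refine (mul_le_mul_of_nonneg_right h1 hC0.le).trans_lt ?_
    rw [mul_assoc]
    exact (lt_div_iff₀ (by positivity)).1 hc2
  -- On `L` the term `u y` is negligible and `z` is close to `Z`. On `I`, multiplication by `w`
  -- gives `w z + y`, close to the generators `y`.
  refine ⟨fun i => z i + u L' • y i, span_eq_top_of_smul (u := w) (hδ' _ fun i => ?_), fun i => ?_⟩
  · rw [map_add, map_smulₛₗ, hures hI, smul_add, ← mul_smul, hwu, one_smul, dist_eq_norm,
      add_sub_cancel_right]
    exact ((FinBanachModule.norm_smul_le' _ _).trans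
      (mul_le_mul_of_nonneg_left (hCi i) (norm_nonneg _))).trans_lt hw
  · rw [map_add, map_smulₛₗ, hures hL]
    calc _ ≤ dist (M.res hL (z i) + u L • M.res hL (y i)) (M.res hL (z i)) +
          dist (M.res hL (z i)) (Z i) := dist_triangle _ _ _
      _ < ε / 2 + ε / 2 := by
        refine add_lt_add ?_ (hz i)
        rw [dist_eq_norm, add_sub_cancel_left]
        exact ((FinBanachModule.norm_smul_le' _ _).trans
          (mul_le_mul_of_nonneg_left (hBi i) (norm_nonneg _))).trans_lt hu
      _ = ε := add_halves ε

theorem isExhausting_extend (hr₀ : IsRationalRadius r₀) {I : ℕ → ClosedInterval r₀}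
    (hI : ∀ k, (I (k + 1)).s ≤ (I k).s) (hI0 : ∀ t, 0 < t → ∃ k, (I k).s ≤ t) :
    IsExhausting fun k => (I k).extend hr₀ :=
  ⟨fun _ => rfl, fun h => ⟨antitone_nat_of_succ_le (f := fun k => (I k).s) hI h, le_rfl⟩, hI0⟩

/-- Finitely many global sections generate over all members of a sequence of disjoint intervals. -/
theorem exists_generators_of_disjoint (hr₀ : IsRationalRadius r₀) {I : ℕ → ClosedInterval r₀}
    (hI : ∀ k, (I (k + 1)).r < (I k).s) (hI0 : ∀ t, 0 < t → ∃ k, (I k).s ≤ t) {n : ℕ}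
    (hn : ∀ k, IsFinGenBy (IntervalRing p A (I k)) (M.obj (I k)) n) :
    ∃ x : Fin n → M.GlobalSection, ∀ k, Submodule.span (IntervalRing p A (I k))
      (Set.range fun i => M.eval hr₀ (I k) (x i)) = ⊤ := by
  have hL := isExhausting_extend hr₀ (fun k => ((I (k + 1)).s_le_r.trans_lt (hI k)).le) hI0
  obtain ⟨x, hxG, hx⟩ := exists_compatible_of_dense (X := fun k => Fin n → M.obj ((I k).extend hr₀))
    (fun h X i => M.res (hL.mono h) (X i))
    (fun h => continuous_pi fun i => (M.continuous_res (hL.mono h)).comp (continuous_apply i))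
    (fun k X => funext fun i => M.res_self _ _) (fun h h' X => funext fun i => M.res_res _ _ _)
    (fun k => {X | Submodule.span (IntervalRing p A (I k))
      (Set.range fun i => M.res ((I k).le_extend hr₀) (X i)) = ⊤})
    (fun k => (isOpen_span_eq_top (R := IntervalRing p A (I k)) (N := M.obj (I k)) n).preimage
      (continuous_pi fun i => (M.continuous_res ((I k).le_extend hr₀)).comp (continuous_apply i)))
    (M.exists_extension_generators ((I 0).le_extend hr₀) (hn 0))
    (fun k Z _ ε hε => by
      obtain ⟨X, hX, hXZ⟩ := M.exists_near_generators ((I (k + 1)).le_extend hr₀)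
        (hL.mono k.le_succ) rfl (hI k) Z (hn (k + 1)) hε
      exact ⟨X, hX, (dist_pi_lt_iff hε).2 hXZ⟩)
  choose y hy using fun i => M.exists_globalSection hL (fun k => x k i) fun h =>
    congrFun (hx h) i
  refine ⟨y, fun k => ?_⟩
  have : (fun i => M.eval hr₀ (I k) (y i)) = fun i => M.res ((I k).le_extend hr₀) (x k i) :=
    funext fun i => by rw [← hy i k]; rfl
  rw [this]
  exact hxG k

/-- The chain is split into its even and its odd members, each a sequence of disjoint intervals
requiring `n` sections. The `2n` sections together generate on every member, and gluing inductively
gives generation on each `[s, r₀]`. -/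
theorem exists_span_globalSection_eq_top (h₀ : 0 < r₀) (hr₀ : IsRationalRadius r₀)
    (hM : M.IsUniformlyFinGen) : ∃ (n : ℕ) (x : Fin n → M.GlobalSection),
      Submodule.span (FullRing p A r₀ h₀) (Set.range x) = ⊤ := by
  obtain ⟨n, -, 𝒰, h𝒰, hn⟩ := hM
  obtain ⟨𝒱, hc, href, hf⟩ := h𝒰.refinement
  obtain ⟨J, hJ𝒱, hJ0, hdec, hmeet, hdisj, hsmall⟩ := exists_chain h₀ hc hf
  have hJn : ∀ k, IsFinGenBy (IntervalRing p A (J k)) (M.obj (J k)) n := fun k => by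
    obtain ⟨K, hK, hJK⟩ := href _ (hJ𝒱 k)
    obtain ⟨e, he⟩ := hn K hK
    exact ⟨_, M.span_res_eq_top hJK he⟩
  have hanti : StrictAnti fun k => (J k).s := strictAnti_nat_of_succ_lt hdec
  obtain ⟨x, hx⟩ := M.exists_generators_of_disjoint hr₀ (I := fun k => J (2 * k))
    (fun k => hdisj (2 * k)) (fun t ht => (hsmall t ht).imp fun k hk =>
      (hanti.antitone (by omega : k ≤ 2 * k)).trans hk) fun k => hJn _
  obtain ⟨x', hx'⟩ := M.exists_generators_of_disjoint hr₀ (I := fun k => J (2 * k + 1))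
    (fun k => hdisj (2 * k + 1)) (fun t ht => (hsmall t ht).imp fun k hk =>
      (hanti.antitone (by omega : k ≤ 2 * k + 1)).trans hk) fun k => hJn _
  let y : Fin (n + n) → M.GlobalSection := Fin.append x x'
  have hy : ∀ k, Submodule.span (IntervalRing p A (J k))
      (Set.range fun i => M.eval hr₀ (J k) (y i)) = ⊤ := by
    intro k
    obtain ⟨l, rfl | rfl⟩ := Nat.even_or_odd' k
    · exact span_eq_top_of_forall_mem (hx l) fun i => Submodule.subset_span
        ⟨Fin.castAdd n i, by simp only [y, Fin.append_left]⟩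
    · exact span_eq_top_of_forall_mem (hx' l) fun i => Submodule.subset_span
        ⟨Fin.natAdd n i, by simp only [y, Fin.append_right]⟩
  have hL := isExhausting_extend hr₀ (fun k => (hdec k).le) hsmall
  refine ⟨n + n, y, M.span_globalSection_eq_top h₀ hL y fun k => ?_⟩
  induction k with
  | zero =>
    have : (J 0).extend hr₀ = J 0 := by
      rw [ClosedInterval.extend]
      cases h : J 0
      simp_all
    have key : ∀ I : ClosedInterval r₀, I = J 0 → Submodule.span (IntervalRing p A I)
        (Set.range fun i => M.eval hr₀ I (y i)) = ⊤ := by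
      rintro _ rfl
      exact hy 0
    simp_rw [← M.eval_eq hr₀ _ (hL.r_eq 0)]
    exact key _ this
  | succ k ih =>
    -- The interval `[s_{k+1}, s_k]` lies in `J (k + 1)` because consecutive members meet, and it
    -- meets `[s_k, r₀]` exactly at the radius `s_k`, as gluing requires.
    let J₁ : ClosedInterval r₀ := ⟨(J (k + 1)).s, (J k).s, (J (k + 1)).s_pos, (J (k + 1)).s_ne_top,
      (hdec k).le, (J k).s_le_r.trans (J k).r_le, (J (k + 1)).s_rational, (J k).s_rational⟩
    have h₁ : J₁ ≤ J (k + 1) := ⟨le_rfl, hmeet k⟩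
    have h₂ : J₁ ≤ (J (k + 1)).extend hr₀ := ⟨le_rfl, J₁.r_le⟩
    refine M.span_eq_top_of_union h₂ (hL.mono k.le_succ) rfl rfl rfl _ ?_ ?_
    · simp_rw [M.res_apply hr₀ h₂]
      have := M.span_res_eq_top h₁ (hy (k + 1))
      simp_rw [M.res_eval] at this
      exact this
    · simp_rw [M.globalSection_res _ (hL.r_eq k) (hL.r_eq (k + 1))]
      exact ih

/-- By density, generators over `[J.s, r₀]` can be perturbed to global sections, and these are
combinations of the `x i`. -/
theorem span_eval_eq_top (h₀ : 0 < r₀) (hr₀ : IsRationalRadius r₀) {n : ℕ}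
    {x : Fin n → M.GlobalSection}
    (hx : Submodule.span (FullRing p A r₀ h₀) (Set.range x) = ⊤) (J : ClosedInterval r₀) :
    Submodule.span (IntervalRing p A J) (Set.range fun i => M.eval hr₀ J (x i)) = ⊤ := by
  refine M.span_res_eq_top (J.le_extend hr₀) (e := fun i => (x i).1 ⟨J.extend hr₀, rfl⟩) ?_
  obtain ⟨l, e, he⟩ := M.exists_generators (J.extend hr₀)
  obtain ⟨δ, hδ, h⟩ := exists_pos_span_eq_top he
  choose z hz using fun i => M.exists_globalSection_near (J.extend hr₀) rfl (e i) hδ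
  refine span_eq_top_of_forall_mem (h _ hz) fun k => ?_
  obtain ⟨c, hc⟩ := exists_sum_eq_of_span_eq_top hx (z k)
  rw [← hc, sum_smul_apply]
  exact Submodule.sum_mem _ fun i _ => Submodule.smul_mem _ _ (Submodule.subset_span ⟨i, rfl⟩)

theorem isUniformlyFinGen_iff (h₀ : 0 < r₀) (hr₀ : IsRationalRadius r₀) :
    M.IsUniformlyFinGen ↔ Module.Finite (FullRing p A r₀ h₀) M.GlobalSection := by
  constructor
  · intro h
    obtain ⟨n, x, hx⟩ := M.exists_span_globalSection_eq_top h₀ hr₀ h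
    exact ⟨hx ▸ Submodule.fg_span (Set.finite_range x)⟩
  · intro h
    obtain ⟨n, x, hx⟩ := Module.Finite.exists_fin (R := FullRing p A r₀ h₀) (M := M.GlobalSection)
    obtain ⟨L, hL, hLc⟩ := exists_isExhausting_isAdmissibleCovering h₀ hr₀
    -- One superfluous generator guarantees that the number is positive.
    exact ⟨n + 1, n.succ_pos, _, hLc, fun J _ => IsFinGenBy.succ ⟨_, M.span_eval_eq_top h₀ hr₀ hx J⟩⟩

end CoherentSheaf

theorem IsFinPresBy.isFinGenBy {R P : Type*} [Ring R] [AddCommGroup P] [Module R P] {m n : ℕ}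
    (h : IsFinPresBy R P m n) : IsFinGenBy R P n := by
  obtain ⟨-, g, -, hg⟩ := h
  refine ⟨fun i => g (Pi.single i 1), top_unique fun x _ => ?_⟩
  obtain ⟨a, rfl⟩ := hg x
  rw [show a = ∑ i, a i • Pi.single i (1 : R) by funext j; simp [Pi.single_apply], map_sum]
  refine Submodule.sum_mem _ fun i _ => ?_
  rw [map_smul]
  exact Submodule.smul_mem _ _ (Submodule.subset_span ⟨i, rfl⟩)

theorem isFinPresBy_of_isFinGenBy_ker {R P : Type*} [Ring R] [AddCommGroup P] [Module R P]
    {m n : ℕ} (q : (Fin n → R) →ₗ[R] P) (hq : Function.Surjective q)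
    (h : IsFinGenBy R (LinearMap.ker q) m) : IsFinPresBy R P m n := by
  obtain ⟨e, he⟩ := h
  refine ⟨Fintype.linearCombination R fun i => (e i : Fin n → R), q, fun a => ⟨fun ha => ?_, ?_⟩, hq⟩
  · obtain ⟨b, hb⟩ := exists_sum_eq_of_span_eq_top he ⟨a, ha⟩
    refine ⟨b, ?_⟩
    have h1 := congrArg Subtype.val hb
    rw [Submodule.coe_sum] at h1
    exact h1
  · rintro ⟨b, rfl⟩
    rw [Fintype.linearCombination_apply, map_sum]
    exact Finset.sum_eq_zero fun i _ => by rw [map_smul, (e i).2, smul_zero]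

theorem linearCombination_surjective {R P : Type*} [Ring R] [AddCommGroup P] [Module R P]
    {ι : Type*} [Fintype ι] {e : ι → P} (he : Submodule.span R (Set.range e) = ⊤) :
    Function.Surjective (Fintype.linearCombination R e) := by
  rw [← LinearMap.range_eq_top, Fintype.range_linearCombination, he]

/-! ### The sheaf of relations and finite presentation. -/

namespace CoherentSheaf

variable {p : ℕ} [hp : Fact p.Prime] {A : Type u} [NormedRing A] [IsUltrametricDist A]
  [CompleteSpace A] {r₀ : ℝ≥0∞} (M : CoherentSheaf.{u, v} p A r₀)
  [NormedAlgebra ℚ_[p] A] [∀ J : ClosedInterval r₀, IsNoetherianRing (IntervalRing p A J)]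
  {N : ℕ} (x : Fin N → M.GlobalSection)

/-- The map `Π_J ^ N → M_J` given by `N` global sections. -/
noncomputable def evalMap (hr₀ : IsRationalRadius r₀) (J : ClosedInterval r₀) :
    (Fin N → IntervalRing p A J) →ₗ[IntervalRing p A J] M.obj J :=
  Fintype.linearCombination (IntervalRing p A J) fun i => M.eval hr₀ J (x i)

theorem evalMap_apply (hr₀ : IsRationalRadius r₀) (J : ClosedInterval r₀)
    (a : Fin N → IntervalRing p A J) :
    M.evalMap x hr₀ J a = ∑ i, a i • M.eval hr₀ J (x i) := Fintype.linearCombination_apply _ _ _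

theorem evalMap_mapVec (hr₀ : IsRationalRadius r₀) {J'' J' : ClosedInterval r₀} (h : J'' ≤ J')
    (a : Fin N → IntervalRing p A J') :
    M.evalMap x hr₀ J'' (mapVec (AnRing.restrict (ClosedInterval.region_subset h)) a) =
      M.res h (M.evalMap x hr₀ J' a) := by
  rw [evalMap_apply, evalMap_apply, map_sum_smul]
  simp_rw [res_eval]

/-- The relations between `N` sections, on the various intervals. -/
noncomputable def kerRes (hr₀ : IsRationalRadius r₀) {J'' J' : ClosedInterval r₀} (h : J'' ≤ J') :
    LinearMap.ker (M.evalMap x hr₀ J') →ₛₗ[AnRing.restrict (p := p) (A := A)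
      (ClosedInterval.region_subset h)] LinearMap.ker (M.evalMap x hr₀ J'') where
  toFun a := ⟨mapVec (AnRing.restrict (ClosedInterval.region_subset h)) a.1, by
    rw [LinearMap.mem_ker, M.evalMap_mapVec x hr₀ h, a.2, map_zero]⟩
  map_add' a b := Subtype.ext (mapVec_add _ _)
  map_smul' r a := Subtype.ext (mapVec_smul _ _)

theorem span_range_kerRes (hr₀ : IsRationalRadius r₀) (hx : ∀ J, Submodule.span (IntervalRing p A J)
      (Set.range fun i => M.eval hr₀ J (x i)) = ⊤) {J'' J' : ClosedInterval r₀} (h : J'' ≤ J') :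
    Submodule.span (IntervalRing p A J'') (Set.range (M.kerRes x hr₀ h)) = ⊤ := by
  refine top_unique fun a _ => ?_
  have h1 := M.mem_span_relations h (hx J') (a := a.1) (by
    simp_rw [res_eval]
    rw [← evalMap_apply]
    exact a.2)
  have h2 : a.1 ∈ (Submodule.span (IntervalRing p A J'') (Set.range (M.kerRes x hr₀ h))).map
      (Submodule.subtype _) := by
    rw [Submodule.map_span, ← Set.range_comp]
    refine Submodule.span_mono ?_ h1
    rintro _ ⟨b, hb, rfl⟩
    exact ⟨⟨b, (M.evalMap_apply x hr₀ J' b).trans hb⟩, rfl⟩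
  obtain ⟨b, hb, hba⟩ := h2
  rwa [← Subtype.ext hba]

/-- Surjectivity holds because relations between restricted sections come from the larger annulus.
Injectivity is flatness of restriction, applied to generators of the relation module inside the free
module. -/
theorem lift_kerRes_bijective (hr₀ : IsRationalRadius r₀)
    (hx : ∀ J, Submodule.span (IntervalRing p A J)
      (Set.range fun i => M.eval hr₀ J (x i)) = ⊤) {J'' J' : ClosedInterval r₀} (h : J'' ≤ J') :
    Function.Bijective (ExtendScalars.lift (AnRing.restrict (p := p) (A := A)
      (ClosedInterval.region_subset h)) (M.kerRes x hr₀ h)) := by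
  obtain ⟨l, e, he⟩ := Module.Finite.exists_fin (R := IntervalRing p A J')
    (M := LinearMap.ker (M.evalMap x hr₀ J'))
  refine lift_bijective_of_relations (M.span_range_kerRes x hr₀ hx h) he fun a ha => ?_
  have h1 := AnRing.flatHom_restrict (p := p) (A := A) h l N (fun i => (e i).1) a (by
    have := congrArg Subtype.val ha
    rw [Submodule.coe_sum] at this
    exact this)
  refine Submodule.span_mono (Set.image_mono fun b hb => ?_) h1
  refine Subtype.ext ?_
  rw [Submodule.coe_sum]
  exact hb

/-- The coherent sheaf of relations between sections which generate everywhere. -/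
noncomputable def kerSheaf (hr₀ : IsRationalRadius r₀)
    (hx : ∀ J, Submodule.span (IntervalRing p A J)
      (Set.range fun i => M.eval hr₀ J (x i)) = ⊤) : CoherentSheaf.{u, u} p A r₀ where
  obj J := LinearMap.ker (M.evalMap x hr₀ J)
  finite _ := inferInstance
  res h := M.kerRes x hr₀ h
  res_self _ _ := rfl
  res_res _ _ _ := rfl
  baseChange h := M.lift_kerRes_bijective x hr₀ hx h

variable (hr₀ : IsRationalRadius r₀) (h₀ : 0 < r₀)
  (hx : ∀ J, Submodule.span (IntervalRing p A J) (Set.range fun i => M.eval hr₀ J (x i)) = ⊤)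

theorem evalMap_mapVec_full (c : Fin N → FullRing p A r₀ h₀) (J : ClosedInterval r₀) (hJ : J.r = r₀) :
    M.evalMap x hr₀ J (mapVec (AnRing.restrict (region_subset_full h₀ J)) c) =
      (Fintype.linearCombination (FullRing p A r₀ h₀) x c).1 ⟨J, hJ⟩ := by
  rw [evalMap_apply, Fintype.linearCombination_apply, sum_smul_apply]
  simp_rw [M.eval_eq hr₀ J hJ]

/-- Relations between global sections, as global sections of the sheaf of relations. -/
noncomputable def kerToGlobalSection :
    LinearMap.ker (Fintype.linearCombination (FullRing p A r₀ h₀) x) →ₗ[FullRing p A r₀ h₀]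
      (M.kerSheaf x hr₀ hx).GlobalSection where
  toFun c := ⟨fun J => ⟨mapVec (AnRing.restrict (region_subset_full h₀ J.1)) c.1, by
    rw [LinearMap.mem_ker, M.evalMap_mapVec_full x hr₀ h₀ c.1 J.1 J.2, c.2]
    rfl⟩, fun _ _ _ => rfl⟩
  map_add' a b := Subtype.ext (funext fun J => Subtype.ext (mapVec_add a.1 b.1))
  map_smul' r a := Subtype.ext (funext fun J => Subtype.ext (mapVec_smul r a.1))

/-- Kernels commute with inverse limits: compatible relations over all `[s, r₀]` have the same
Laurent coefficients, so they form one vector over `(0, r₀]`, and it is a relation because it is one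
at every level. -/
theorem kerToGlobalSection_bijective :
    Function.Bijective (M.kerToGlobalSection x hr₀ h₀ hx) := by
  obtain ⟨L, hL, -⟩ := exists_isExhausting_isAdmissibleCovering h₀ hr₀
  constructor
  · intro a b hab
    refine Subtype.ext (funext fun i => AnRing.ext ?_)
    have h1 := congrArg Subtype.val (congrFun (congrArg Subtype.val hab) ⟨L 0, hL.r_eq 0⟩)
    exact congrArg (fun f : IntervalRing p A (L 0) => f.coeff) (congrFun h1 i)
  · intro z
    have hz : ∀ {j k : ℕ} (h : j ≤ k), M.kerRes x hr₀ (hL.mono h) (z.1 ⟨L k, hL.r_eq k⟩) =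
        z.1 ⟨L j, hL.r_eq j⟩ := fun h =>
      (M.kerSheaf x hr₀ hx).globalSection_res z (hL.r_eq _) (hL.r_eq _) (hL.mono h)
    choose d hd using fun i => exists_fullRing h₀ hL (fun k => (z.1 ⟨L k, hL.r_eq k⟩).1 i)
      fun h => by rw [← hz h]; rfl
    have hd' : ∀ k, mapVec (AnRing.restrict (region_subset_full h₀ (L k))) d =
        (z.1 ⟨L k, hL.r_eq k⟩).1 := fun k => funext fun i => hd i k
    refine ⟨⟨d, M.globalSection_ext hL fun k => ?_⟩,
      (M.kerSheaf x hr₀ hx).globalSection_ext hL fun k => Subtype.ext (hd' k)⟩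
    rw [← M.evalMap_mapVec_full x hr₀, hd']
    exact (z.1 ⟨L k, hL.r_eq k⟩).2

theorem isUniformlyFinGen_kerSheaf_iff : (M.kerSheaf x hr₀ hx).IsUniformlyFinGen ↔
    (LinearMap.ker (Fintype.linearCombination (FullRing p A r₀ h₀) x)).FG := by
  rw [isUniformlyFinGen_iff _ h₀ hr₀, ← Module.Finite.iff_fg]
  exact (Module.Finite.equiv_iff (LinearEquiv.ofBijective _
    (M.kerToGlobalSection_bijective x hr₀ h₀ hx))).symm

/-- Once global generators are fixed, both sides say that their relations are finitely generated,
uniformly on a covering or globally. The equivalence is then `isUniformlyFinGen_iff` for the sheaf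
of relations. -/
theorem isUniformlyFinPres_iff (h₀ : 0 < r₀) (hr₀ : IsRationalRadius r₀) : M.IsUniformlyFinPres ↔
    Module.FinitePresentation (FullRing p A r₀ h₀) M.GlobalSection := by
  constructor
  · rintro ⟨m, n, hm, hn, 𝒰, h𝒰, h⟩
    obtain ⟨N, x, hx⟩ := M.exists_span_globalSection_eq_top h₀ hr₀
      ⟨n, hn, 𝒰, h𝒰, fun J hJ => (h J hJ).isFinGenBy⟩
    have hx' := M.span_eval_eq_top h₀ hr₀ hx
    exact Module.finitePresentation_of_surjective _ (linearCombination_surjective hx)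
      ((M.isUniformlyFinGen_kerSheaf_iff x hr₀ h₀ hx').1 ⟨m + N, Nat.add_pos_left hm N, 𝒰, h𝒰,
        fun J hJ => isFinGenBy_ker_of_isFinPresBy (h J hJ) _ (linearCombination_surjective (hx' J))⟩)
  · intro h
    obtain ⟨N, hN⟩ := Module.Finite.exists_fin (R := FullRing p A r₀ h₀) (M := M.GlobalSection)
    obtain ⟨x, hx⟩ := IsFinGenBy.succ hN
    have hx' := M.span_eval_eq_top h₀ hr₀ hx
    obtain ⟨m, hm, 𝒰, h𝒰, hgen⟩ := (M.isUniformlyFinGen_kerSheaf_iff x hr₀ h₀ hx').2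
      (Module.FinitePresentation.fg_ker _ (linearCombination_surjective hx))
    exact ⟨m, N + 1, hm, N.succ_pos, 𝒰, h𝒰, fun J hJ =>
      isFinPresBy_of_isFinGenBy_ker _ (linearCombination_surjective (hx' J)) (hgen J hJ)⟩

end CoherentSheaf

end RelRobba

theorem mainTheorem11 (p : ℕ) [Fact p.Prime] (A : Type u) [NormedRing A] [NormedAlgebra ℚ_[p] A]
    [IsUltrametricDist A] [CompleteSpace A]
    [IsNoetherianRing A] [IsNoetherianRing Aᵐᵒᵖ]
    (r₀ : ℝ≥0∞) (hr₀ : 0 < r₀) (hr₀' : RelRobba.IsRationalRadius r₀)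
    (hnoeth : ∀ J : RelRobba.ClosedInterval r₀,
      IsNoetherianRing (RelRobba.IntervalRing p A J) ∧
        IsNoetherianRing (RelRobba.IntervalRing p A J)ᵐᵒᵖ)
    (M : RelRobba.CoherentSheaf.{u, v} p A r₀) :
    (M.IsUniformlyFinGen ↔ Module.Finite (RelRobba.FullRing p A r₀ hr₀) M.GlobalSection) ∧
      (M.IsUniformlyFinPres ↔
        Module.FinitePresentation (RelRobba.FullRing p A r₀ hr₀) M.GlobalSection) := by
  have := fun J => (hnoeth J).1
  exact ⟨M.isUniformlyFinGen_iff hr₀ hr₀', M.isUniformlyFinPres_iff hr₀ hr₀'⟩
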